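/- Let $C$ be a smooth projective geometrically irreducible curve over a finite field $\mathbb{F}_q$, $\infty\in C(\mathbb{F}_q)$, $Q=\mathbb{F}_q(C)$ its function field, $L\supset\mathbb{F}_q$ a field, $C_L=C\times_{\mathbb{F}_q}\operatorname{Spec}L$ with generic point $\eta$, $\sigma=\mathrm{id}_C\times\operatorname{Spec}(\mathrm{Frob}_q)$, and let $c:\operatorname{Spec}L\to C$ be an $\mathbb{F}_q$-morphism; let $\mathcal{I}$ be the ideal sheaf on $C_L$ of the graph of $c$. An abelian $\tau$-sheaf $\underline{\mathcal F}=(\mathcal F_i,\Pi_i,\tau_i)_{i\in\mathbb Z}$ of rank $r\ge0$, dimension $d\ge0$ and characteristic $c$ consists of locally free sheaves $\mathcal F_i$ of rank $r$ on $C_L$ and injective $\mathcal O_{C_L}$-homomorphisms $\Pi_i:\mathcal F_i\to\mathcal F_{i+1}$, $\tau_i:\sigma^*\mathcal F_i\to\mathcal F_{i+1}$ such that for all $i$: $\Pi_{i+1}\tau_i=\tau_{i+1}\sigma^*\Pi_i$; there are integers $k,l>0$, independent of $i$, with $ld=kr$ such that $\Pi_{i+l-1}\cdots\Pi_i$ identifies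 $\mathcal F_i$ with $\mathcal F_{i+l}(-k\cdot\infty)\subset\mathcal F_{i+l}$; $\dim_L\operatorname{coker}\Pi_i=d=\dim_L\operatorname{coker}\tau_i$; and $\mathcal I^d\operatorname{coker}\tau_i=0$. Its weight is $d/r$ ($0$ if $r=0$). A morphism is a family of $\mathcal O_{C_L}$-homomorphisms $f_i$ commuting with the $\Pi_i$ and $\tau_i$; it is an isogeny if all $f_i$ are injective and the supports of all $\operatorname{coker}f_i$ lie in $Z\times\operatorname{Spec}L$ for one finite closed $Z\subset C$. For an effective divisor $D$ on $C$ put $\underline{\mathcal F}(D)=\underline{\mathcal F}\otimes\mathcal O_{C_L}(D)$. Let $\mathrm{QHom}(\underline{\mathcal F},\underline{\mathcal F}')$ be the set of morphisms $f:\underline{\mathcal F}\to\underline{\mathcal F}'(D)$, $D$ an effective divisor on $C$, where $f_1:\underline{\mathcal F}\to\underline{\mathcal F}'(D_1)$ and $f_2:\underline{\mathcal F}\to\underline{\mathcal F}'(D_2)$ are identified if they agree as morphisms to $\underline{\mathcal F}'(D_1+D_2)$; let $\mathrm{QIsog}(\underline{\mathcal F},\underline{\mathcal F}')$ be the subset of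 classes represented by isogenies. With addition in a common twist, $a\cdot[f]=[af:\underline{\mathcal F}\to\underline{\mathcal F}'(D+(a)_\infty)]$ for $a\in Q$ with divisor of poles $(a)_\infty$, and composition $[f']\circ[f]=[(f'\otimes\mathrm{id}_{\mathcal O(D)})\circ f]$, $\mathrm{QHom}(\underline{\mathcal F},\underline{\mathcal F}')$ is a $Q$-vector space and $\mathrm{QEnd}(\underline{\mathcal F})=\mathrm{QHom}(\underline{\mathcal F},\underline{\mathcal F})$ is a $Q$-algebra. Let $\underline{\mathcal F},\underline{\mathcal F}'$ be abelian $\tau$-sheaves of characteristic $c$. (1) Let $f:\underline{\mathcal F}\to\underline{\mathcal F}'(D)$ be an isogeny. There is $a\in Q^\times$ with $a\cdot\operatorname{coker}f_i=0$ for all $i$, meaning that the map $\operatorname{coker}f_i\to\operatorname{coker}(f_i\otimes\mathrm{id}_{\mathcal O((a)_\infty)})$ induced by $a$ is zero. For every such $a$ there is a unique morphism $f^\vee:\underline{\mathcal F}'(D)\to\underline{\mathcal F}((a)_\infty)$ with $f^\vee\circ f=a$ and $(f\otimes\mathrm{id})\circ f^\vee=a$. It is an isogeny, the quasi-morphism from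 $\underline{\mathcal F}'$ to $\underline{\mathcal F}$ which it defines by restriction to $\underline{\mathcal F}'\subset\underline{\mathcal F}'(D)$ lies in $\mathrm{QIsog}(\underline{\mathcal F}',\underline{\mathcal F})$, and $a^{-1}\cdot f^\vee$ is a two-sided inverse of $[f]$: $(a^{-1}f^\vee)\circ[f]=\mathrm{id}$ and $[f]\circ(a^{-1}f^\vee)=\mathrm{id}$. (2) $\mathrm{QIsog}(\underline{\mathcal F},\underline{\mathcal F})$ is the group of units of the $Q$-algebra $\mathrm{QEnd}(\underline{\mathcal F})$. (3) The maps $\Pi_{0,\eta}$ and $\Pi'_{0,\eta}$ are bijective. If $\underline{\mathcal F}$ and $\underline{\mathcal F}'$ have the same weight (and characteristic $c$), then $[f]\mapsto f_{0,\eta}$ is an isomorphism of $Q$-vector spaces from $\mathrm{QHom}(\underline{\mathcal F},\underline{\mathcal F}')$ onto $$\{\varphi:\mathcal F_{0,\eta}\to\mathcal F'_{0,\eta}\ \text{linear over the function field of } C_L:\ \varphi\circ\Pi_{0,\eta}^{-1}\circ\tau_{0,\eta}=(\Pi'_{0,\eta})^{-1}\circ\tau'_{0,\eta}\circ\sigma^*\varphi\},$$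 and these isomorphisms are compatible with composition of quasi-morphisms. -/

import Mathlib

open CategoryTheory Limits AlgebraicGeometry TopologicalSpace Opposite

universe u

namespace TauSheaf

noncomputable section

section Generic

variable {X Y : Scheme.{u}}

theorem generic_mem [IrreducibleSpace X] {U : X.Opens} {x : X} (hx : x ∈ U) :
    genericPoint X ∈ U :=
  ((genericPoint_spec X).mem_open_set_iff U.isOpen).mpr ⟨x, trivial, hx⟩

theorem map_generic [IrreducibleSpace X] [IrreducibleSpace Y] (f : X ⟶ Y) [IsDominant f] :
    f (genericPoint X) = genericPoint Y := by
  have h := (genericPoint_spec X).image f.continuous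
  rw [Set.image_univ, f.denseRange.closure_range] at h
  exact h.eq (genericPoint_spec Y)

theorem generic_specializes [IrreducibleSpace X] (x : X) : genericPoint X ⤳ x :=
  (genericPoint_spec X).specializes trivial

/-- The homomorphism of function fields induced by a dominant morphism. -/
def fnMap [IrreducibleSpace X] [IrreducibleSpace Y] (f : X ⟶ Y) [IsDominant f] :
    Y.functionField →+* X.functionField :=
  (Y.presheaf.stalkSpecializes (specializes_of_eq (map_generic f)) ≫
    f.stalkMap (genericPoint X)).hom

theorem fnMap_germ [IrreducibleSpace X] [IrreducibleSpace Y] (f : X ⟶ Y) [IsDominant f]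
    (W : Y.Opens) (hY : genericPoint Y ∈ W) (hX : genericPoint X ∈ f ⁻¹ᵁ W) (g : Γ(Y, W)) :
    fnMap f (Y.presheaf.germ W _ hY g) = X.presheaf.germ (f ⁻¹ᵁ W) _ hX (f.app W g) := by
  have := Y.presheaf.germ_stalkSpecializes hY (specializes_of_eq (map_generic f))
  have h2 := f.germ_stalkMap W (genericPoint X) hX
  simp only [fnMap, CommRingCat.hom_comp, RingHom.comp_apply]
  have e1 := congr($(this).hom g)
  have e2 := congr($(h2).hom g)
  simp only [CommRingCat.hom_comp, RingHom.comp_apply] at e1 e2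
  rw [e1, e2]

/-- The stalk of a sheaf of modules at a point. -/
abbrev Stalk (M : X.Modules) (x : X) : Type u := ↑(TopCat.Presheaf.stalk (C := Ab) M.presheaf x)

instance (M : X.Modules) (x : X) : Module (X.presheaf.stalk x) (Stalk M x) :=
  PresheafOfModules.instModuleCarrierStalkCommRingCatCarrierAbPresheafOpensCarrier
    (R := X.presheaf) M.val x

/-- The germ at `x` of a section. -/
def germ (M : X.Modules) {U : X.Opens} {x : X} (hx : x ∈ U) : Γ(M, U) →+ Stalk M x :=
  (TopCat.Presheaf.germ (C := Ab) M.presheaf U x hx).hom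

theorem germ_smul (M : X.Modules) {U : X.Opens} {x : X} (hx : x ∈ U) (r : Γ(X, U)) (m : Γ(M, U)) :
    germ M hx (r • m) = X.presheaf.germ U x hx r • germ M hx m :=
  PresheafOfModules.germ_smul (R := X.presheaf) M.val x U hx r m

theorem germ_exists (M : X.Modules) {x : X} (v : Stalk M x) :
    ∃ (U : X.Opens) (hx : x ∈ U) (m : Γ(M, U)), germ M hx m = v := by
  obtain ⟨U, hx, m, h⟩ := TopCat.Presheaf.exists_germ_eq (C := Ab) M.presheaf v
  exact ⟨U, hx, m, h⟩

theorem germ_res (M : X.Modules) {U V : X.Opens} (i : V ⟶ U) {x : X} (hx : x ∈ V) (m : Γ(M, U)) :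
    germ M hx (M.presheaf.map i.op m) = germ M (i.le hx) m :=
  TopCat.Presheaf.germ_res_apply (C := Ab) M.presheaf i x hx m

/-- The cospecialization map `M_y → M_x` for a specialization `x ⤳ y`. -/
def cosp (M : X.Modules) {x y : X} (h : x ⤳ y) : Stalk M y →+ Stalk M x :=
  (TopCat.Presheaf.stalkSpecializes (C := Ab) M.presheaf h).hom

theorem cosp_germ (M : X.Modules) {x y : X} (h : x ⤳ y) {U : X.Opens} (hy : y ∈ U) (m : Γ(M, U)) :
    cosp M h (germ M hy m) = germ M (h.mem_open U.isOpen hy) m :=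
  congr($(TopCat.Presheaf.germ_stalkSpecializes (C := Ab) M.presheaf hy h).hom m)

/-- The map on stalks induced by a morphism of sheaves of modules. -/
def stalkHom {M N : X.Modules} (f : M ⟶ N) (x : X) : Stalk M x →ₗ[X.presheaf.stalk x] Stalk N x where
  toFun := ((TopCat.Presheaf.stalkFunctor Ab x).map f.mapPresheaf).hom
  map_add' := map_add _
  map_smul' r v := by
    obtain ⟨U, hU, m, rfl⟩ := germ_exists M v
    obtain ⟨V, hV, s, rfl⟩ := X.presheaf.exists_germ_eq r
    have hx : x ∈ V ⊓ U := ⟨hV, hU⟩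
    have e1 : (TopCat.Presheaf.germ X.presheaf V x hV).hom s = X.presheaf.germ (V ⊓ U) x hx
        (X.presheaf.map (Opens.infLELeft V U).op s) :=
      (X.presheaf.germ_res_apply (Opens.infLELeft V U) x hx s).symm
    have e3 : ∀ m' : Γ(M, V ⊓ U), ((TopCat.Presheaf.stalkFunctor Ab x).map f.mapPresheaf).hom
        (germ M hx m') = germ N hx (f.app _ m') := fun m' =>
      TopCat.Presheaf.stalkFunctor_map_germ_apply (C := Ab) _ x hx f.mapPresheaf m'
    rw [← germ_res M (Opens.infLERight V U) hx m]
    erw [e1]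
    rw [← germ_smul, e3, e3, Scheme.Modules.Hom.app_smul, germ_smul]

theorem stalkHom_germ {M N : X.Modules} (f : M ⟶ N) {x : X} {U : X.Opens} (hx : x ∈ U)
    (m : Γ(M, U)) : stalkHom f x (germ M hx m) = germ N hx (f.app U m) :=
  TopCat.Presheaf.stalkFunctor_map_germ_apply (C := Ab) U x hx f.mapPresheaf m


/-- A morphism of sheaves of modules from a compatible family of additive maps on sections. -/
def mkHom {M N : X.Modules} (φ : ∀ U : X.Opens, Γ(M, U) →+ Γ(N, U))
    (hres : ∀ {U V : X.Opens} (i : V ⟶ U) (m : Γ(M, U)),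
      φ V (M.presheaf.map i.op m) = N.presheaf.map i.op (φ U m))
    (hsmul : ∀ (U : X.Opens) (r : Γ(X, U)) (m : Γ(M, U)), φ U (r • m) = r • φ U m) : M ⟶ N :=
  ⟨PresheafOfModules.homMk
    { app := fun U => AddCommGrpCat.ofHom (φ U.unop)
      naturality := fun U V i => by
        ext m
        exact hres i.unop m }
    (fun U r m => hsmul U.unop r m)⟩

theorem mkHom_app {M N : X.Modules} (φ : ∀ U : X.Opens, Γ(M, U) →+ Γ(N, U))
    (hres : ∀ {U V : X.Opens} (i : V ⟶ U) (m : Γ(M, U)),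
      φ V (M.presheaf.map i.op m) = N.presheaf.map i.op (φ U m))
    (hsmul : ∀ (U : X.Opens) (r : Γ(X, U)) (m : Γ(M, U)), φ U (r • m) = r • φ U m)
    (U : X.Opens) (m : Γ(M, U)) : (mkHom φ hres hsmul).app U m = φ U m := rfl

end Generic

section Twist

/-- An effective divisor `D` on a regular integral curve, given by its ideal sheaf `O(-D)`: an
ideal sheaf which is non-zero on every non-empty affine open (and hence invertible). -/
structure EffDiv (C : Scheme.{u}) where
  ideal : C.IdealSheafData
  ne_bot : ∀ W : C.affineOpens, (W.1 : Set C).Nonempty → ideal.ideal W ≠ ⊥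

/-- The fibre at the generic point. -/
abbrev GenFib {X : Scheme.{u}} [IrreducibleSpace X] (M : X.Modules) : Type u :=
  Stalk M (genericPoint X)

variable {X C : Scheme.{u}} [IrreducibleSpace X] [IrreducibleSpace C] (pr : X ⟶ C) [IsDominant pr]

/-- The germ `v` at the generic point belongs to the stalk of `M(D)` at `y`: multiplication by the
ideal of `D` carries it into (the image of) the stalk of `M` at `y`. -/
def LocTwist (D : EffDiv C) (M : X.Modules) (y : X) (v : GenFib M) : Prop :=
  ∀ (W : C.affineOpens) (hy : pr y ∈ W.1), ∀ g ∈ D.ideal.ideal W,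
    ∃ m : Stalk M y, cosp M (generic_specializes y) m =
      fnMap pr (C.presheaf.germ W.1 _ (generic_mem hy) g) • v

/-- Sections of `M(D)` are constant functions with values in the generic fibre which satisfy the
pole condition at all points. -/
def IsTwistSection (D : EffDiv C) (M : X.Modules) {U : X.Opens} (s : U → GenFib M) : Prop :=
  (∀ y z, s y = s z) ∧
  ∀ y : U, LocTwist pr D M y.1 (s y)

/-- The local predicate cutting out the sections of the twisted sheaf. -/
def twistPredicate (D : EffDiv C) (M : X.Modules) :
    TopCat.LocalPredicate (X := X.toTopCat) (fun _ => GenFib M) where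
  pred s := IsTwistSection pr D M s
  res i s hs := ⟨fun y z => hs.1 _ _, fun y => hs.2 (i y)⟩
  locality {U} s h := by
    have key : ∀ y : U, ∃ hg : genericPoint X ∈ U, s y = s ⟨_, hg⟩ := fun y => by
      obtain ⟨V, hy, i, hV⟩ := h y
      exact ⟨generic_mem y.2, hV.1 ⟨y.1, hy⟩ ⟨_, generic_mem hy⟩⟩
    refine ⟨fun y z => ?_, fun y => ?_⟩
    · obtain ⟨_, e⟩ := key y
      obtain ⟨_, e'⟩ := key z
      rw [e, e']
    · obtain ⟨V, hy, i, hV⟩ := h y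
      exact hV.2 ⟨y.1, hy⟩

/-- The group of sections of the twisted sheaf over `U`. -/
def twistSections (D : EffDiv C) (M : X.Modules) (U : X.Opens) : AddSubgroup (U → GenFib M) where
  carrier := {s | IsTwistSection pr D M s}
  zero_mem' := ⟨fun _ _ => rfl, fun y W hy g _ => ⟨0, by simp⟩⟩
  add_mem' := by
    rintro s t ⟨hs, hs'⟩ ⟨ht, ht'⟩
    refine ⟨fun y z => congrArg₂ (· + ·) (hs y z) (ht y z), fun y W hy g hg => ?_⟩
    obtain ⟨m, hm⟩ := hs' y W hy g hg
    obtain ⟨n, hn⟩ := ht' y W hy g hg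
    exact ⟨m + n, by rw [map_add, hm, hn, Pi.add_apply, smul_add]⟩
  neg_mem' := by
    rintro s ⟨hs, hs'⟩
    refine ⟨fun y z => congrArg Neg.neg (hs y z), fun y W hy g hg => ?_⟩
    obtain ⟨m, hm⟩ := hs' y W hy g hg
    exact ⟨-m, by rw [map_neg, hm, Pi.neg_apply, smul_neg]⟩

theorem cosp_smul (M : X.Modules) {U : X.Opens} {y : X} (hy : y ∈ U) (r : Γ(X, U))
    (m : Stalk M y) : cosp M (generic_specializes y) (X.presheaf.germ U y hy r • m) =
      X.presheaf.germ U _ (generic_mem hy) r • cosp M (generic_specializes y) m := by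
  obtain ⟨V, hV, m, rfl⟩ := germ_exists M m
  have h : y ∈ U ⊓ V := ⟨hy, hV⟩
  have e : ∀ z (hz : z ∈ U ⊓ V), X.presheaf.germ U z hz.1 r = X.presheaf.germ (U ⊓ V) z hz
      (X.presheaf.map (Opens.infLELeft U V).op r) := fun z hz =>
    (X.presheaf.germ_res_apply (Opens.infLELeft U V) z hz r).symm
  rw [← germ_res M (Opens.infLERight U V) h m, e y h, e _ (generic_mem h), ← germ_smul, cosp_germ,
    cosp_germ, germ_smul]

instance (D : EffDiv C) (M : X.Modules) (U : X.Opens) : SMul Γ(X, U) (twistSections pr D M U) where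
  smul r s := ⟨fun y => X.presheaf.germ U _ (generic_mem y.2) r • s.1 y,
    fun y z => congrArg (fun t => X.presheaf.germ U _ (generic_mem y.2) r • t) (s.2.1 y z),
    fun y W hy g hg => by
      obtain ⟨m, hm⟩ := s.2.2 y W hy g hg
      exact ⟨X.presheaf.germ U y.1 y.2 r • m, by rw [cosp_smul, hm, smul_comm]⟩⟩

instance (D : EffDiv C) (M : X.Modules) (U : X.Opens) :
    Module Γ(X, U) (twistSections pr D M U) where
  one_smul s := Subtype.ext (funext fun y => by
    change X.presheaf.germ U _ (generic_mem y.2) 1 • s.1 y = s.1 y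
    rw [map_one, one_smul])
  mul_smul r r' s := Subtype.ext (funext fun y => by
    change X.presheaf.germ U _ (generic_mem y.2) (r * r') • s.1 y =
      X.presheaf.germ U _ (generic_mem y.2) r • X.presheaf.germ U _ (generic_mem y.2) r' • s.1 y
    rw [map_mul, mul_smul])
  smul_zero r := Subtype.ext (funext fun y => smul_zero _)
  smul_add r s t := Subtype.ext (funext fun y => smul_add _ _ _)
  add_smul r r' s := Subtype.ext (funext fun y => by
    change X.presheaf.germ U _ (generic_mem y.2) (r + r') • s.1 y =
      X.presheaf.germ U _ (generic_mem y.2) r • s.1 y +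
        X.presheaf.germ U _ (generic_mem y.2) r' • s.1 y
    rw [map_add, add_smul])
  zero_smul s := Subtype.ext (funext fun y => by
    change X.presheaf.germ U _ (generic_mem y.2) 0 • s.1 y = 0
    rw [map_zero, zero_smul])

/-- Restriction of sections of the twisted sheaf. -/
def twistRes (D : EffDiv C) (M : X.Modules) {U V : X.Opens} (i : V ≤ U) :
    twistSections pr D M U →+ twistSections pr D M V where
  toFun s := ⟨fun y => s.1 ⟨y.1, i y.2⟩, fun _ _ => s.2.1 _ _, fun y => s.2.2 ⟨y.1, i y.2⟩⟩
  map_zero' := rfl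
  map_add' _ _ := rfl

/-- The underlying presheaf of abelian groups of the twisted sheaf. -/
def twistPresheaf (D : EffDiv C) (M : X.Modules) : TopCat.Presheaf Ab X.toTopCat where
  obj U := AddCommGrpCat.of (twistSections pr D M U.unop)
  map i := AddCommGrpCat.ofHom (twistRes pr D M i.unop.le)

instance (D : EffDiv C) (M : X.Modules) (U : (Opens X)ᵒᵖ) :
    Module (X.ringCatSheaf.obj.obj U) ((twistPresheaf pr D M).obj U) :=
  inferInstanceAs (Module Γ(X, U.unop) (twistSections pr D M U.unop))

/-- The sheaf `M(D) = M ⊗ O(pr^* D)` of sections of `M` with poles bounded by `D`, as a subsheaf of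
the constant sheaf given by the generic fibre of `M` (here `M` is locally free and `X` integral). -/
def twist (D : EffDiv C) (M : X.Modules) : X.Modules :=
  SheafOfModules.mk
    (PresheafOfModules.ofPresheaf (R := X.ringCatSheaf.obj) (twistPresheaf pr D M) (by
      intro U V i r m
      apply Subtype.ext
      funext y
      exact congrArg (fun t => t • _) (X.presheaf.germ_res_apply i.unop _ (generic_mem y.2) r).symm))
    ((TopCat.Presheaf.isSheaf_iff_isSheaf_comp (forget Ab) _).2
      (TopCat.subpresheafToTypes.isSheaf (twistPredicate pr D M)))


theorem stalkHom_cosp {M N : X.Modules} (f : M ⟶ N) {y : X} (v : Stalk M y) :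
    stalkHom f _ (cosp M (generic_specializes y) v) =
      cosp N (generic_specializes y) (stalkHom f y v) := by
  obtain ⟨V, hV, m, rfl⟩ := germ_exists M v
  rw [cosp_germ, stalkHom_germ, stalkHom_germ, cosp_germ]


theorem germ_smul' (M : X.Modules) {U : X.Opens} (hU : genericPoint X ∈ U) (r : Γ(X, U))
    (m : Γ(M, U)) : germ M hU (r • m) =
      (X.presheaf.germ U (genericPoint X) hU r : X.functionField) • (germ M hU m : GenFib M) :=
  germ_smul M hU r m

/-- The value of the germ of a section of the twisted sheaf, as an additive map. -/
def evalAdd (D : EffDiv C) (M : X.Modules) : GenFib (twist pr D M) →+ GenFib M :=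
  AddCommGrpCat.Hom.hom (Y := AddCommGrpCat.of (GenFib M))
    (colimit.desc ((OpenNhds.inclusion (genericPoint X)).op ⋙ twistPresheaf pr D M)
    { pt := AddCommGrpCat.of (GenFib M)
      ι :=
      { app := fun U => AddCommGrpCat.ofHom
          { toFun := fun s : twistSections pr D M U.unop.1 => s.1 ⟨_, U.unop.2⟩
            map_zero' := rfl
            map_add' := fun _ _ => rfl } } })

theorem evalAdd_germ (D : EffDiv C) (M : X.Modules) {U : X.Opens} (hU : genericPoint X ∈ U)
    (s : twistSections pr D M U) :
    evalAdd pr D M (germ (twist pr D M) hU s) = s.1 ⟨_, hU⟩ := by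
  have := colimit.ι_desc (F := (OpenNhds.inclusion (genericPoint X)).op ⋙ twistPresheaf pr D M)
    { pt := AddCommGrpCat.of (GenFib M)
      ι :=
      { app := fun U => AddCommGrpCat.ofHom
          { toFun := fun s : twistSections pr D M U.unop.1 => s.1 ⟨_, U.unop.2⟩
            map_zero' := rfl
            map_add' := fun _ _ => rfl } } } (op ⟨U, hU⟩)
  exact congr($(this).hom s)

end Twist

section Twist
variable {X C : Scheme.{u}} [IrreducibleSpace X] [IrreducibleSpace C] (pr : X ⟶ C) [IsDominant pr]

theorem exists_common_germ (M : X.Modules) {x : X} (r : X.presheaf.stalk x) (v : Stalk M x) :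
    ∃ (U : X.Opens) (hx : x ∈ U) (s : Γ(X, U)) (m : Γ(M, U)),
      X.presheaf.germ U x hx s = r ∧ germ M hx m = v := by
  obtain ⟨U, hU, m, rfl⟩ := germ_exists M v
  obtain ⟨V, hV, s, rfl⟩ := X.presheaf.exists_germ_eq r
  exact ⟨V ⊓ U, ⟨hV, hU⟩, X.presheaf.map (Opens.infLELeft V U).op s,
    M.presheaf.map (Opens.infLERight V U).op m,
    X.presheaf.germ_res_apply (Opens.infLELeft V U) x ⟨hV, hU⟩ s,
    germ_res M (Opens.infLERight V U) ⟨hV, hU⟩ m⟩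

/-- The identification of the generic fibre of `M(D)` with that of `M`. -/
def eval (D : EffDiv C) (M : X.Modules) : GenFib (twist pr D M) →ₗ[X.functionField] GenFib M where
  toFun := evalAdd pr D M
  map_add' := map_add _
  map_smul' r v := by
    obtain ⟨U, hx, s, m, rfl, rfl⟩ := exists_common_germ (twist pr D M) r v
    change evalAdd pr D M ((X.presheaf.germ U _ hx s) • germ (twist pr D M) hx m) = _
    rw [← germ_smul]
    erw [evalAdd_germ pr D M hx, evalAdd_germ pr D M hx]
    rfl

theorem eval_germ (D : EffDiv C) (M : X.Modules) {U : X.Opens} (hU : genericPoint X ∈ U)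
    (s : twistSections pr D M U) :
    eval pr D M (germ (twist pr D M) hU s) = s.1 ⟨_, hU⟩ :=
  evalAdd_germ pr D M hU s

theorem locTwist_eval (D : EffDiv C) (M : X.Modules) {y : X} (v : Stalk (twist pr D M) y) :
    LocTwist pr D M y (eval pr D M (cosp _ (generic_specializes y) v)) := by
  obtain ⟨U, hU, s, rfl⟩ := germ_exists _ v
  have hg := generic_mem hU
  rw [cosp_germ]
  erw [eval_germ pr D M hg s]
  rw [s.2.1 ⟨_, hg⟩ ⟨y, hU⟩]
  exact s.2.2 ⟨y, hU⟩

/-- The morphism `M ⟶ N(D)` with prescribed effect on the generic fibres. -/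
def ofGen {D : EffDiv C} {M N : X.Modules} (φ : GenFib M →ₗ[X.functionField] GenFib N)
    (h : ∀ (y : X) (v : Stalk M y), LocTwist pr D N y (φ (cosp M (generic_specializes y) v))) :
    M ⟶ twist pr D N :=
  mkHom (N := twist pr D N)
    (fun U =>
      { toFun := fun m => (⟨fun y => φ (germ M (generic_mem y.2) m), fun _ _ => rfl, fun y => by
          have := h y.1 (germ M y.2 m)
          rw [cosp_germ] at this
          exact this⟩ : twistSections pr D N U)
        map_zero' := Subtype.ext (funext fun y => by
          change φ (germ M _ 0) = 0
          rw [map_zero, map_zero])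
        map_add' := fun a b => Subtype.ext (funext fun y => by
          change φ (germ M _ (a + b)) = φ (germ M _ a) + φ (germ M _ b)
          rw [map_add, map_add]) })
    (fun {U V} i m => Subtype.ext (funext fun y => by
      change φ (germ M _ _) = φ (germ M _ m)
      rw [germ_res M i (generic_mem y.2)]))
    (fun U r m => Subtype.ext (funext fun y => by
      change φ (germ M (generic_mem y.2) (r • m)) = X.presheaf.germ U _ _ r • φ (germ M _ m)
      rw [germ_smul]
      exact map_smul φ _ _))

/-- The effect of a morphism `M ⟶ N(D)` on generic fibres. -/
def gen {D : EffDiv C} {M N : X.Modules} (f : M ⟶ twist pr D N) :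
    GenFib M →ₗ[X.functionField] GenFib N :=
  eval pr D N ∘ₗ stalkHom f (genericPoint X)

theorem gen_ofGen {D : EffDiv C} {M N : X.Modules} (φ : GenFib M →ₗ[X.functionField] GenFib N)
    (h : ∀ (y : X) (v : Stalk M y), LocTwist pr D N y (φ (cosp M (generic_specializes y) v))) :
    gen pr (ofGen pr φ h) = φ := by
  ext v
  obtain ⟨U, hU, m, rfl⟩ := germ_exists M v
  change eval pr D N (stalkHom _ _ _) = _
  rw [stalkHom_germ]
  exact eval_germ pr D N hU _

theorem app_eq_gen {D : EffDiv C} {M N : X.Modules} (f : M ⟶ twist pr D N) (U : X.Opens)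
    (m : Γ(M, U)) (y : U) :
    (show twistSections pr D N U from f.app U m).1 y = gen pr f (germ M (generic_mem y.2) m) := by
  change _ = eval pr D N (stalkHom _ _ _)
  rw [stalkHom_germ]
  erw [eval_germ pr D N (generic_mem y.2)]
  exact (show twistSections pr D N U from f.app U m).2.1 _ _

theorem gen_injective {D : EffDiv C} {M N : X.Modules} :
    Function.Injective (gen pr : (M ⟶ twist pr D N) → _) := by
  intro f g h
  ext U m
  apply Subtype.ext
  funext y
  exact (app_eq_gen pr f U m y).trans ((congr($h _)).trans (app_eq_gen pr g U m y).symm)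

theorem locTwist_gen {D : EffDiv C} {M N : X.Modules} (f : M ⟶ twist pr D N) {y : X}
    (v : Stalk M y) : LocTwist pr D N y (gen pr f (cosp M (generic_specializes y) v)) := by
  change LocTwist pr D N y (eval pr D N (stalkHom _ _ _))
  rw [stalkHom_cosp]
  exact locTwist_eval _ _ _ _

theorem stalkHom_comp {M N P : X.Modules} (f : M ⟶ N) (g : N ⟶ P) (x : X) :
    stalkHom (f ≫ g) x = stalkHom g x ∘ₗ stalkHom f x := by
  ext v
  obtain ⟨U, hU, m, rfl⟩ := germ_exists M v
  simp only [LinearMap.comp_apply, stalkHom_germ]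
  rfl

theorem gen_comp {D : EffDiv C} {M N P : X.Modules} (f : M ⟶ N) (g : N ⟶ twist pr D P) :
    gen pr (f ≫ g) = gen pr g ∘ₗ stalkHom f _ := by
  simp only [gen]
  rw [stalkHom_comp]
  rfl

theorem stalkHom_add {M N : X.Modules} (f g : M ⟶ N) (x : X) :
    stalkHom (f + g) x = stalkHom f x + stalkHom g x := by
  ext v
  obtain ⟨U, hU, m, rfl⟩ := germ_exists M v
  simp only [LinearMap.add_apply, stalkHom_germ]
  rw [← map_add]
  rfl

theorem gen_add {D : EffDiv C} {M N : X.Modules} (f g : M ⟶ twist pr D N) :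
    gen pr (f + g) = gen pr f + gen pr g := by
  simp only [gen]
  rw [stalkHom_add, LinearMap.comp_add]

theorem stalkHom_neg {M N : X.Modules} (f : M ⟶ N) (x : X) :
    stalkHom (-f) x = -stalkHom f x := by
  ext v
  obtain ⟨U, hU, m, rfl⟩ := germ_exists M v
  simp only [LinearMap.neg_apply, stalkHom_germ]
  rw [← map_neg]
  rfl

theorem gen_neg {D : EffDiv C} {M N : X.Modules} (f : M ⟶ twist pr D N) :
    gen pr (-f) = -gen pr f := by
  simp only [gen]
  rw [stalkHom_neg, LinearMap.comp_neg]

theorem gen_zero {D : EffDiv C} {M N : X.Modules} :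
    gen pr (0 : M ⟶ twist pr D N) = 0 := by
  have := gen_add pr (0 : M ⟶ twist pr D N) 0
  rw [add_zero] at this
  exact left_eq_add.1 this

end Twist

section Divisors

variable {C : Scheme.{u}}

theorem EffDiv.ext {D E : EffDiv C} (h : D.ideal = E.ideal) : D = E := by
  cases D; cases E; cases h; rfl

/-- The sum of two effective divisors. -/
instance [IsIntegral C] : Add (EffDiv C) where
  add D E := ⟨D.ideal * E.ideal, fun W hW => by
    have : Nonempty W.1 := hW.to_subtype
    change D.ideal.ideal W * E.ideal.ideal W ≠ ⊥
    rw [← bot_lt_iff_ne_bot, bot_lt_iff_ne_bot, Ne, Ideal.mul_eq_bot, not_or]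
    exact ⟨D.ne_bot W hW, E.ne_bot W hW⟩⟩

theorem EffDiv.add_ideal [IsIntegral C] (D E : EffDiv C) (W : C.affineOpens) :
    (D + E).ideal.ideal W = D.ideal.ideal W * E.ideal.ideal W := rfl

/-- The ideal of denominators of a rational function on an affine open. -/
def denIdeal [IrreducibleSpace C] (a : C.functionField) (W : C.Opens) : Ideal Γ(C, W) where
  carrier := {g | ∃ h : Γ(C, W), ∀ hW : genericPoint C ∈ W,
    (C.presheaf.germ W _ hW g : C.functionField) * a = C.presheaf.germ W _ hW h}
  zero_mem' := ⟨0, fun _ => by rw [map_zero]; exact zero_mul a⟩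
  add_mem' := by
    rintro g g' ⟨h, e⟩ ⟨h', e'⟩
    exact ⟨h + h', fun hW => by rw [map_add, map_add, add_mul, e, e']⟩
  smul_mem' := by
    rintro r g ⟨h, e⟩
    exact ⟨r * h, fun hW => by rw [smul_eq_mul, map_mul, map_mul, mul_assoc, e]⟩

theorem denIdeal_map [IsIntegral C] (a : C.functionField) (U : C.affineOpens) (f : Γ(C, U)) :
    (denIdeal a U.1).map (C.presheaf.map (homOfLE <| C.basicOpen_le f).op).hom =
      denIdeal a (C.basicOpen f) := by
  set ρ := C.presheaf.map (homOfLE <| C.basicOpen_le f).op with hρ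
  apply le_antisymm
  · rw [Ideal.map_le_iff_le_comap]
    rintro g ⟨h, e⟩
    refine ⟨ρ.hom h, fun hW => ?_⟩
    have := e (C.basicOpen_le f hW)
    rw [← C.presheaf.germ_res_apply (homOfLE (C.basicOpen_le f)) _ hW,
      ← C.presheaf.germ_res_apply (homOfLE (C.basicOpen_le f)) _ hW h] at this
    exact this
  · let _ : Algebra Γ(C, U) Γ(C, C.basicOpen f) := ρ.hom.toAlgebra
    have : IsLocalization.Away f Γ(C, C.basicOpen f) := U.2.isLocalization_of_eq_basicOpen _ _ rfl
    rintro g ⟨h, e⟩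
    obtain ⟨n, g', hg⟩ := IsLocalization.Away.surj f g
    obtain ⟨m, h', hh⟩ := IsLocalization.Away.surj f h
    have hu : IsUnit (ρ.hom f) := IsLocalization.Away.algebraMap_isUnit f
    have hg : g * ρ.hom f ^ n = ρ.hom g' := hg
    have hh : h * ρ.hom f ^ m = ρ.hom h' := hh
    have hr : ∀ (hW : genericPoint C ∈ C.basicOpen f) (z : Γ(C, U)),
        C.presheaf.germ U.1 _ (C.basicOpen_le f hW) z = C.presheaf.germ _ _ hW (ρ.hom z) :=
      fun hW z => (C.presheaf.germ_res_apply (homOfLE (C.basicOpen_le f)) _ hW z).symm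
    by_cases hW : genericPoint C ∈ C.basicOpen f
    · have hG : f ^ m * g' ∈ denIdeal a U.1 := by
        refine ⟨f ^ n * h', fun hU => ?_⟩
        have := e hW
        have e1 : ρ.hom (f ^ n * h') = ρ.hom f ^ n * (h * ρ.hom f ^ m) := by
          rw [map_mul, map_pow, hh]
        have e2 : ρ.hom (f ^ m * g') = ρ.hom f ^ m * (g * ρ.hom f ^ n) := by
          rw [map_mul, map_pow, hg]
        rw [hr hW, hr hW, e1, e2]
        simp only [map_mul, map_pow] at this ⊢
        rw [show ∀ x y z w : C.functionField, x * (y * z) * w = x * z * (y * w) by intros; ring]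
        erw [this]
        ring
      have := Ideal.mem_map_of_mem ρ.hom hG
      rw [map_mul, ← hg, map_pow] at this
      have h2 : ρ.hom f ^ m * (g * ρ.hom f ^ n) = (ρ.hom f ^ (m + n)) * g := by ring
      rw [h2] at this
      exact (Ideal.unit_mul_mem_iff_mem _ (hu.pow _)).1 this
    · have hb : C.basicOpen f = ⊥ := by
        ext x
        simp only [Opens.coe_bot, Set.mem_empty_iff_false, iff_false]
        exact fun hx => hW (generic_mem hx)
      have : Subsingleton Γ(C, C.basicOpen f) := by
        rw [hb]; infer_instance
      rw [Subsingleton.elim (α := Γ(C, C.basicOpen f)) g 0]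
      exact Ideal.zero_mem _

/-- The divisor of poles of a rational function. -/
def poleDiv [IsIntegral C] (a : C.functionField) : EffDiv C where
  ideal := 
    { ideal := fun W => denIdeal a W.1
      map_ideal_basicOpen := denIdeal_map a }
  ne_bot W hW := by
    have : Nonempty W.1 := hW.to_subtype
    have := functionField_isFractionRing_of_isAffineOpen C W.1 W.2
    obtain ⟨x, y, hy, e⟩ := IsFractionRing.div_surjective (A := Γ(C, W.1)) a
    rw [Ne, Submodule.eq_bot_iff]
    intro h
    refine nonZeroDivisors.ne_zero hy (h y ⟨x, fun hW => ?_⟩)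
    have hy' : algebraMap Γ(C, W.1) C.functionField y ≠ 0 :=
      IsFractionRing.to_map_ne_zero_of_mem_nonZeroDivisors hy
    change algebraMap Γ(C, W.1) C.functionField y * a = algebraMap Γ(C, W.1) C.functionField x
    rw [← e]
    field_simp

end Divisors

section Natural

variable {X C : Scheme.{u}} [IsIntegral C] [IrreducibleSpace X] (pr : X ⟶ C) [IsDominant pr]

theorem smul_cosp (M : X.Modules) {y : X} (W : C.Opens) (hy : pr y ∈ W) (g : Γ(C, W))
    (v : Stalk M y) : ∃ m : Stalk M y, cosp M (generic_specializes y) m =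
      fnMap pr (C.presheaf.germ W _ (generic_mem hy) g) • cosp M (generic_specializes y) v := by
  have hy' : y ∈ pr ⁻¹ᵁ W := hy
  refine ⟨X.presheaf.germ (pr ⁻¹ᵁ W) y hy' (pr.app W g) • v, ?_⟩
  rw [fnMap_germ pr W _ (generic_mem hy')]
  exact cosp_smul M hy' _ v

/-- The natural inclusion `M ⟶ M(D)`. -/
def toTwist (D : EffDiv C) (M : X.Modules) : M ⟶ twist pr D M :=
  ofGen pr LinearMap.id fun y v W hy g _ => smul_cosp pr M W.1 hy g v

/-- The functoriality of `M ↦ M(D)`, that is, `f ⊗ id`. -/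
def twistMap (D : EffDiv C) {M N : X.Modules} (f : M ⟶ N) : twist pr D M ⟶ twist pr D N :=
  ofGen pr (stalkHom f _ ∘ₗ eval pr D M) fun y v W hy g hg => by
    obtain ⟨m, hm⟩ := locTwist_eval pr D M v W hy g hg
    refine ⟨stalkHom f y m, ?_⟩
    rw [← stalkHom_cosp, hm]
    exact map_smul (stalkHom f (genericPoint X)) _ _

/-- The natural inclusion `M(D) ⟶ M(D + E)`. -/
def twistIncl (D E : EffDiv C) (M : X.Modules) : twist pr D M ⟶ twist pr (D + E) M :=
  ofGen pr (eval pr D M) fun y v W hy g hg =>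
    locTwist_eval pr D M v W hy g
      (Ideal.mul_le_left (I := D.ideal.ideal W) (J := E.ideal.ideal W) hg)

/-- The natural inclusion `M(E) ⟶ M(D + E)`. -/
def twistIncl' (D E : EffDiv C) (M : X.Modules) : twist pr E M ⟶ twist pr (D + E) M :=
  ofGen pr (eval pr E M) fun y v W hy g hg =>
    locTwist_eval pr E M v W hy g
      (Ideal.mul_le_right (I := D.ideal.ideal W) (J := E.ideal.ideal W) hg)

/-- The natural map `M(E)(D) ⟶ M(D + E)`. -/
def twistTwist (D E : EffDiv C) (M : X.Modules) :
    twist pr D (twist pr E M) ⟶ twist pr (D + E) M :=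
  ofGen pr (eval pr E M ∘ₗ eval pr D _) fun y v W hy g hg => by
    rw [EffDiv.add_ideal] at hg
    induction hg using Submodule.mul_induction_on' with
    | mem_mul_mem d hd e he =>
      obtain ⟨m, hm⟩ := locTwist_eval pr D (twist pr E M) v W hy d hd
      obtain ⟨n, hn⟩ := locTwist_eval pr E M m W hy e he
      refine ⟨n, ?_⟩
      rw [hn, hm, LinearMap.map_smul, map_mul, map_mul, mul_comm, mul_smul, LinearMap.comp_apply,
        smul_comm]
    | add x hx y hy ihx ihy =>
      obtain ⟨m, hm⟩ := ihx
      obtain ⟨n, hn⟩ := ihy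
      exact ⟨m + n, by rw [map_add, hm, hn, map_add, map_add, add_smul]⟩

/-- Multiplication by a rational function, `M ⟶ M((a)_∞)`. -/
def mulPole (a : C.functionField) (M : X.Modules) : M ⟶ twist pr (poleDiv a) M :=
  ofGen pr (fnMap pr a • LinearMap.id) fun y v W hy g hg => by
    obtain ⟨h, e⟩ := hg
    obtain ⟨m, hm⟩ := smul_cosp pr M W.1 hy h v
    refine ⟨m, ?_⟩
    rw [hm, ← e (generic_mem hy), map_mul, mul_smul]
    rfl

end Natural

section GenLemmas

variable {X C : Scheme.{u}} [IsIntegral C] [IrreducibleSpace X] (pr : X ⟶ C) [IsDominant pr]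

theorem gen_toTwist (D : EffDiv C) (M : X.Modules) : gen pr (toTwist pr D M) = LinearMap.id :=
  gen_ofGen _ _ _

theorem gen_twistMap (D : EffDiv C) {M N : X.Modules} (f : M ⟶ N) :
    gen pr (twistMap pr D f) = stalkHom f _ ∘ₗ eval pr D M :=
  gen_ofGen _ _ _

theorem gen_twistIncl (D E : EffDiv C) (M : X.Modules) :
    gen pr (twistIncl pr D E M) = eval pr D M :=
  gen_ofGen _ _ _

theorem gen_twistIncl' (D E : EffDiv C) (M : X.Modules) :
    gen pr (twistIncl' pr D E M) = eval pr E M :=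
  gen_ofGen _ _ _

theorem gen_twistTwist (D E : EffDiv C) (M : X.Modules) :
    gen pr (twistTwist pr D E M) = eval pr E M ∘ₗ eval pr D _ :=
  gen_ofGen _ _ _

theorem gen_mulPole (a : C.functionField) (M : X.Modules) :
    gen pr (mulPole pr a M) = fnMap pr a • LinearMap.id :=
  gen_ofGen _ _ _

end GenLemmas

section Sharp

variable {X : Scheme.{u}} (σ : X ⟶ X)

/-- The `σ`-semilinear map on stalks attached to a homomorphism `M ⟶ σ_* N`. -/
def sharp {M N : X.Modules} (g : M ⟶ (Scheme.Modules.pushforward σ).obj N) (y : X) :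
    Stalk M (σ y) →+ Stalk N y :=
  (TopCat.Presheaf.stalkPushforward Ab σ.base N.presheaf y).hom.comp
    (stalkHom g (σ y)).toAddMonoidHom

theorem sharp_germ {M N : X.Modules} (g : M ⟶ (Scheme.Modules.pushforward σ).obj N) (y : X)
    {U : X.Opens} (hy : σ y ∈ U) (hy' : y ∈ σ ⁻¹ᵁ U) (m : Γ(M, U)) :
    sharp σ g y (germ M hy m) = germ N hy' (show Γ(N, σ ⁻¹ᵁ U) from g.app U m) := by
  change (TopCat.Presheaf.stalkPushforward Ab σ.base N.presheaf y).hom (stalkHom g (σ y) _) = _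
  rw [stalkHom_germ]
  exact congr($(TopCat.Presheaf.stalkPushforward_germ Ab σ.base N.presheaf U y hy).hom (g.app U m))

variable [IrreducibleSpace X] [IsDominant σ]

/-- The `σ`-semilinear map on generic fibres attached to a homomorphism `M ⟶ σ_* N`. -/
def sharpGen {M N : X.Modules} (g : M ⟶ (Scheme.Modules.pushforward σ).obj N) :
    GenFib M →ₛₗ[fnMap σ] GenFib N where
  toFun v := sharp σ g _ (cosp M (specializes_of_eq (map_generic σ)) v)
  map_add' v w := by rw [map_add, map_add]
  map_smul' r v := by
    obtain ⟨U, hU, s, m, rfl, rfl⟩ := exists_common_germ M r v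
    have hU' : genericPoint X ∈ σ ⁻¹ᵁ U := by
      change σ (genericPoint X) ∈ U
      rwa [map_generic]
    have e := fnMap_germ σ U hU hU' s
    change sharp σ g _ (cosp M _ (X.presheaf.germ U _ hU s • germ M hU m)) = _
    rw [← germ_smul, cosp_germ, cosp_germ, sharp_germ σ g _ _ hU', sharp_germ σ g _ _ hU',
      e, Scheme.Modules.Hom.app_smul]
    exact germ_smul N hU' (σ.app U s) _

theorem sharpGen_germ {M N : X.Modules} (g : M ⟶ (Scheme.Modules.pushforward σ).obj N)
    {U : X.Opens} (hU : genericPoint X ∈ U) (hU' : genericPoint X ∈ σ ⁻¹ᵁ U) (m : Γ(M, U)) :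
    sharpGen σ g (germ M hU m) = germ N hU' (show Γ(N, σ ⁻¹ᵁ U) from g.app U m) := by
  change sharp σ g _ (cosp M _ (germ M hU m)) = _
  rw [cosp_germ, sharp_germ σ g _ _ hU']

theorem sharpGen_cosp {M N : X.Modules} (g : M ⟶ (Scheme.Modules.pushforward σ).obj N) (y : X)
    (m : Stalk M (σ y)) :
    sharpGen σ g (cosp M (generic_specializes _) m) =
      cosp N (generic_specializes y) (sharp σ g y m) := by
  obtain ⟨U, hU, m, rfl⟩ := germ_exists M m
  have hy : y ∈ σ ⁻¹ᵁ U := hU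
  rw [cosp_germ, sharpGen_germ σ g _ (generic_mem hy), sharp_germ σ g y hU hy, cosp_germ]

theorem sharpGen_comp {L M N : X.Modules} (h : L ⟶ M)
    (g : M ⟶ (Scheme.Modules.pushforward σ).obj N) (v : GenFib L) :
    sharpGen σ (h ≫ g) v = sharpGen σ g (stalkHom h _ v) := by
  obtain ⟨U, hU, m, rfl⟩ := germ_exists L v
  have hU' : genericPoint X ∈ σ ⁻¹ᵁ U := by
    change σ (genericPoint X) ∈ U
    rwa [map_generic]
  rw [sharpGen_germ σ _ hU hU', stalkHom_germ, sharpGen_germ σ _ hU hU']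
  rfl

theorem sharpGen_comp_map {L M N : X.Modules} (g : L ⟶ (Scheme.Modules.pushforward σ).obj M)
    (h : M ⟶ N) (v : GenFib L) :
    sharpGen σ (g ≫ (Scheme.Modules.pushforward σ).map h) v =
      stalkHom h _ (sharpGen σ g v) := by
  obtain ⟨U, hU, m, rfl⟩ := germ_exists L v
  have hU' : genericPoint X ∈ σ ⁻¹ᵁ U := by
    change σ (genericPoint X) ∈ U
    rwa [map_generic]
  rw [sharpGen_germ σ _ hU hU', sharpGen_germ σ _ hU hU', stalkHom_germ]
  rfl

variable {C : Scheme.{u}} [IsIntegral C] (pr : X ⟶ C) [IsDominant pr]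

theorem fnMap_comp (h : σ ≫ pr = pr) (a : C.functionField) :
    fnMap σ (fnMap pr a) = fnMap pr a := by
  obtain ⟨W, hW, g, rfl⟩ := C.presheaf.exists_germ_eq a
  have hX : genericPoint X ∈ pr ⁻¹ᵁ W := by
    change pr (genericPoint X) ∈ W
    rwa [map_generic]
  have hX' : genericPoint X ∈ σ ⁻¹ᵁ (pr ⁻¹ᵁ W) := by
    change σ (genericPoint X) ∈ pr ⁻¹ᵁ W
    rwa [map_generic]
  have e1 := fnMap_germ pr W hW hX g
  have e2 := fnMap_germ σ (pr ⁻¹ᵁ W) hX hX' (pr.app W g)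
  have e3 : ∀ (f : X ⟶ C) (hf : f = pr) (hf' : genericPoint X ∈ f ⁻¹ᵁ W),
      X.presheaf.germ (f ⁻¹ᵁ W) _ hf' (f.app W g) =
        X.presheaf.germ (pr ⁻¹ᵁ W) _ hX (pr.app W g) := by
    rintro f rfl _
    rfl
  have e4 : X.presheaf.germ _ _ hX' (σ.app _ (pr.app W g)) =
      X.presheaf.germ (pr ⁻¹ᵁ W) _ hX (pr.app W g) := e3 (σ ≫ pr) h hX'
  exact (congrArg _ e1).trans (e2.trans (e4.trans e1.symm))

/-- The adjoint form of `τ ⊗ id` for `τ` with adjoint `g : M ⟶ σ_* N`. -/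
def twistTauAdj (h : σ ≫ pr = pr) (D : EffDiv C) {M N : X.Modules}
    (g : M ⟶ (Scheme.Modules.pushforward σ).obj N) :
    twist pr D M ⟶ (Scheme.Modules.pushforward σ).obj (twist pr D N) :=
  mkHom (N := (Scheme.Modules.pushforward σ).obj (twist pr D N))
    (fun U =>
      { toFun := fun s : twistSections pr D M U =>
          (⟨fun z => sharpGen σ g (s.1 ⟨σ z.1, z.2⟩), fun z w => congrArg _ (s.2.1 _ _),
            fun z W hz a ha => by
              have hz' : pr (σ z.1) ∈ W.1 := by
                rwa [← Scheme.Hom.comp_apply, h]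
              obtain ⟨m, hm⟩ := s.2.2 ⟨σ z.1, z.2⟩ W hz' a ha
              refine ⟨sharp σ g z.1 m, ?_⟩
              rw [← sharpGen_cosp, hm, LinearMap.map_smulₛₗ, fnMap_comp σ pr h]⟩ :
            twistSections pr D N (σ ⁻¹ᵁ U))
        map_zero' := Subtype.ext (funext fun z => map_zero (sharpGen σ g))
        map_add' := fun a b => Subtype.ext (funext fun z => map_add (sharpGen σ g) _ _) })
    (fun {U V} i m => rfl)
    (fun U r m => Subtype.ext (funext fun z => by
      have hg : genericPoint X ∈ σ ⁻¹ᵁ U := generic_mem z.2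
      have hg' : genericPoint X ∈ U := generic_mem (x := σ z.1) z.2
      change sharpGen σ g ((X.presheaf.germ U _ hg' r : X.functionField) • _) =
        (X.presheaf.germ _ _ hg (σ.app U r) : X.functionField) • _
      rw [LinearMap.map_smulₛₗ, fnMap_germ σ U hg' hg]
      rfl))

theorem eval_sharpGen_twistTauAdj (h : σ ≫ pr = pr) (D : EffDiv C) {M N : X.Modules}
    (g : M ⟶ (Scheme.Modules.pushforward σ).obj N) (v : GenFib (twist pr D M)) :
    eval pr D N (sharpGen σ (twistTauAdj σ pr h D g) v) = sharpGen σ g (eval pr D M v) := by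
  obtain ⟨U, hU, m, rfl⟩ := germ_exists _ v
  have hU' : genericPoint X ∈ σ ⁻¹ᵁ U := by
    change σ (genericPoint X) ∈ U
    rwa [map_generic]
  rw [sharpGen_germ σ _ hU hU']
  erw [eval_germ pr D M hU m, eval_germ pr D N hU']
  exact congrArg (sharpGen σ g) (m.2.1 _ _)

end Sharp

/-- The geometric data underlying the theory over a finite field `k` and a field extension `L`:
a smooth projective geometrically irreducible curve `C` over `k`, a `k`-rational point `∞` of `C`
and a characteristic, that is, a `k`-morphism `c : Spec L ⟶ C`. (A proper curve over a field is
projective, and a smooth irreducible curve over a field is integral.) -/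
structure Base (k L : Type u) [Field k] [Fintype k] [Field L] [Algebra k L] where
  C : Scheme.{u}
  struct : C ⟶ Spec (.of k)
  [integral : IsIntegral C]
  [proper : IsProper struct]
  [smooth : SmoothOfRelativeDimension 1 struct]
  [geomIrred : GeometricallyIrreducible struct]
  infty : Spec (.of k) ⟶ C
  infty_struct : infty ≫ struct = 𝟙 _
  char : Spec (.of L) ⟶ C
  char_struct : char ≫ struct = Spec.map (CommRingCat.ofHom (algebraMap k L))

namespace Base

variable {k L : Type u} [Field k] [Fintype k] [Field L] [Algebra k L] (B : Base k L)

instance : IsIntegral B.C := B.integral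
instance : IsProper B.struct := B.proper
instance : SmoothOfRelativeDimension 1 B.struct := B.smooth
instance : GeometricallyIrreducible B.struct := B.geomIrred
instance : Smooth B.struct := SmoothOfRelativeDimension.smooth 1 B.struct

/-- The base change `C_L = C ×_k Spec L`. -/
def CL : Scheme.{u} := pullback B.struct (Spec.map (CommRingCat.ofHom (algebraMap k L)))

/-- The projection `C_L ⟶ C`. -/
def pr : B.CL ⟶ B.C := pullback.fst _ _

/-- The projection `C_L ⟶ Spec L`. -/
def str : B.CL ⟶ Spec (.of L) := pullback.snd _ _

instance : IrreducibleSpace B.CL :=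
  inferInstanceAs (IrreducibleSpace
    ↑(pullback B.struct (Spec.map (CommRingCat.ofHom (algebraMap k L)))))

instance : Surjective B.pr :=
  inferInstanceAs (Surjective
    (pullback.fst B.struct (Spec.map (CommRingCat.ofHom (algebraMap k L)))))

instance : IsDominant B.pr := inferInstance

theorem isPullback : IsPullback B.pr B.str B.struct
    (Spec.map (CommRingCat.ofHom (algebraMap k L))) := IsPullback.of_hasPullback _ _

/-- The morphism `Spec L ⟶ Spec L` given by the `q`-Frobenius of `L`, where `q = #k`. -/
def frob (k L : Type u) [Field k] [Fintype k] [Field L] [Algebra k L] :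
    Spec (.of L) ⟶ Spec (.of L) :=
  Spec.map (CommRingCat.ofHom (FiniteField.frobeniusAlgHom k L).toRingHom)

theorem frob_comp : frob k L ≫ Spec.map (CommRingCat.ofHom (algebraMap k L)) =
    Spec.map (CommRingCat.ofHom (algebraMap k L)) := by
  rw [frob, ← Spec.map_comp, ← CommRingCat.ofHom_comp]
  congr 2
  exact (FiniteField.frobeniusAlgHom k L).comp_algebraMap

/-- The endomorphism `σ = id × Frob_q` of `C_L`. -/
def σ : B.CL ⟶ B.CL :=
  B.isPullback.lift B.pr (B.str ≫ frob k L) (by rw [Category.assoc, frob_comp, B.isPullback.w])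

theorem σ_pr : B.σ ≫ B.pr = B.pr := B.isPullback.lift_fst _ _ _

theorem σ_str : B.σ ≫ B.str = B.str ≫ frob k L := B.isPullback.lift_snd _ _ _

theorem isPullback_σ : IsPullback B.σ B.str B.str (frob k L) := by
  refine IsPullback.of_right (t := B.isPullback) ?_ B.σ_str
  rw [σ_pr, frob_comp]
  exact B.isPullback

instance : Surjective (frob k L) := by
  unfold frob
  infer_instance

instance : IsDominant B.σ := by
  have : Surjective B.σ := MorphismProperty.of_isPullback B.isPullback_σ.flip inferInstance
  infer_instance

/-- The section of `C_L` over `L` given by the graph of the characteristic. -/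
def graph : Spec (.of L) ⟶ B.CL :=
  B.isPullback.lift B.char (𝟙 _) (by rw [B.char_struct, Category.id_comp])

/-- The ideal sheaf of the graph of the characteristic. -/
def I : B.CL.IdealSheafData := B.graph.ker

/-- The function field `Q` of `C`. -/
abbrev Q : CommRingCat.{u} := B.C.functionField

/-- The function field `K` of `C_L`. -/
abbrev K : CommRingCat.{u} := B.CL.functionField

end Base

section

variable {k L : Type u} [Field k] [Fintype k] [Field L] [Algebra k L] (B : Base k L)

instance : (Scheme.Modules.pullback B.σ).Additive := inferInstance

/-- A homomorphism `σ^* M ⟶ N`, in adjoint form `M ⟶ σ_* N`. -/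
abbrev adj {M N : B.CL.Modules} (τ : (Scheme.Modules.pullback B.σ).obj M ⟶ N) :
    M ⟶ (Scheme.Modules.pushforward B.σ).obj N :=
  (Scheme.Modules.pullbackPushforwardAdjunction B.σ).homEquiv M N τ

/-- The `σ`-semilinear map `v ↦ τ (σ^* v)` on generic fibres attached to `τ : σ^* M ⟶ N`. -/
def semi {M N : B.CL.Modules} (τ : (Scheme.Modules.pullback B.σ).obj M ⟶ N) :
    GenFib M →ₛₗ[fnMap B.σ] GenFib N :=
  sharpGen B.σ (adj B τ)

/-- The homomorphism `τ ⊗ id : σ^* (M(D)) ⟶ N(D)`, using `σ^* (M(D)) = (σ^* M)(D)`. -/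
def twistTau (D : EffDiv B.C) {M N : B.CL.Modules}
    (τ : (Scheme.Modules.pullback B.σ).obj M ⟶ N) :
    (Scheme.Modules.pullback B.σ).obj (twist B.pr D M) ⟶ twist B.pr D N :=
  ((Scheme.Modules.pullbackPushforwardAdjunction B.σ).homEquiv _ _).symm
    (twistTauAdj B.σ B.pr B.σ_pr D (adj B τ))

theorem eval_semi_twistTau (D : EffDiv B.C) {M N : B.CL.Modules}
    (τ : (Scheme.Modules.pullback B.σ).obj M ⟶ N) (v : GenFib (twist B.pr D M)) :
    eval B.pr D N (semi B (twistTau B D τ) v) = semi B τ (eval B.pr D M v) := by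
  rw [semi, adj, twistTau, Equiv.apply_symm_apply]
  exact eval_sharpGen_twistTauAdj _ _ _ _ _ _

theorem square_iff {M N M' N' : B.CL.Modules} (τ : (Scheme.Modules.pullback B.σ).obj M ⟶ N)
    (τ' : (Scheme.Modules.pullback B.σ).obj M' ⟶ N') (f : M ⟶ M') (g : N ⟶ N') :
    τ ≫ g = (Scheme.Modules.pullback B.σ).map f ≫ τ' ↔
      adj B τ ≫ (Scheme.Modules.pushforward B.σ).map g = f ≫ adj B τ' := by
  rw [← ((Scheme.Modules.pullbackPushforwardAdjunction B.σ).homEquiv _ _).injective.eq_iff,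
    Adjunction.homEquiv_naturality_right, Adjunction.homEquiv_naturality_left]

theorem semi_square {M N M' N' : B.CL.Modules} {τ : (Scheme.Modules.pullback B.σ).obj M ⟶ N}
    {τ' : (Scheme.Modules.pullback B.σ).obj M' ⟶ N'} {f : M ⟶ M'} {g : N ⟶ N'}
    (h : τ ≫ g = (Scheme.Modules.pullback B.σ).map f ≫ τ') (v : GenFib M) :
    stalkHom g _ (semi B τ v) = semi B τ' (stalkHom f _ v) := by
  have := congrArg (fun t => sharpGen B.σ t v) ((square_iff B τ τ' f g).1 h)
  exact (sharpGen_comp_map B.σ (adj B τ) g v).symm.trans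
    (this.trans (sharpGen_comp B.σ f (adj B τ') v))

theorem push_ext {D : EffDiv B.C} {M N : B.CL.Modules}
    {g g' : M ⟶ (Scheme.Modules.pushforward B.σ).obj (twist B.pr D N)}
    (h : ∀ v, eval B.pr D N (sharpGen B.σ g v) = eval B.pr D N (sharpGen B.σ g' v)) :
    g = g' := by
  ext U m
  apply Subtype.ext
  funext y
  have hy : genericPoint B.CL ∈ B.σ ⁻¹ᵁ U := generic_mem y.2
  have hU : genericPoint B.CL ∈ U := generic_mem (x := B.σ y.1) y.2
  have key : ∀ t : M ⟶ (Scheme.Modules.pushforward B.σ).obj (twist B.pr D N),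
      (show twistSections B.pr D N (B.σ ⁻¹ᵁ U) from t.app U m).1 y =
        eval B.pr D N (sharpGen B.σ t (germ M hU m)) := fun t => by
    rw [sharpGen_germ B.σ t hU hy]
    erw [eval_germ B.pr D N hy]
    exact (show twistSections B.pr D N (B.σ ⁻¹ᵁ U) from t.app U m).2.1 _ _
  exact (key g).trans ((h _).trans (key g').symm)

theorem tau_square_of_gen {D : EffDiv B.C} {M N M' N' : B.CL.Modules}
    {τ : (Scheme.Modules.pullback B.σ).obj M ⟶ N}
    {τ' : (Scheme.Modules.pullback B.σ).obj M' ⟶ N'} {f : M ⟶ twist B.pr D M'}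
    {g : N ⟶ twist B.pr D N'}
    (h : ∀ v, gen B.pr g (semi B τ v) = semi B τ' (gen B.pr f v)) :
    τ ≫ g = (Scheme.Modules.pullback B.σ).map f ≫ twistTau B D τ' := by
  rw [square_iff]
  apply push_ext
  intro v
  rw [sharpGen_comp_map, sharpGen_comp]
  exact (h v).trans (eval_semi_twistTau B D τ' _).symm

/-- A family of sheaves of modules on `C_L` with maps `Π_i` and `τ_i`. -/
structure TauData where
  obj : ℤ → B.CL.Modules
  Pi : ∀ i, obj i ⟶ obj (i + 1)
  tau : ∀ i, (Scheme.Modules.pullback B.σ).obj (obj i) ⟶ obj (i + 1)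

variable {B}

namespace TauData

/-- The twist `F(D)`. -/
abbrev twist (F : TauData B) (D : EffDiv B.C) : TauData B where
  obj i := TauSheaf.twist B.pr D (F.obj i)
  Pi i := twistMap B.pr D (F.Pi i)
  tau i := twistTau B D (F.tau i)

/-- A morphism: a family of homomorphisms commuting with the `Π_i` and the `τ_i`. -/
@[ext]
structure Hom (F G : TauData B) where
  app : ∀ i, F.obj i ⟶ G.obj i
  Pi_comm : ∀ i, F.Pi i ≫ app (i + 1) = app i ≫ G.Pi i
  tau_comm : ∀ i, F.tau i ≫ app (i + 1) = (Scheme.Modules.pullback B.σ).map (app i) ≫ G.tau i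

namespace Hom

variable {F G H : TauData B}

/-- Composition of morphisms, in diagrammatic order. -/
def comp (f : Hom F G) (g : Hom G H) : Hom F H where
  app i := f.app i ≫ g.app i
  Pi_comm i := by rw [← Category.assoc, f.Pi_comm, Category.assoc, g.Pi_comm, Category.assoc]
  tau_comm i := by
    rw [← Category.assoc, f.tau_comm, Category.assoc, g.tau_comm, Functor.map_comp,
      Category.assoc]

instance : Zero (Hom F G) where
  zero := 
    { app := fun _ => 0
      Pi_comm := fun _ => by rw [comp_zero, zero_comp]
      tau_comm := fun _ => by rw [comp_zero, Functor.map_zero, zero_comp] }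

instance : Add (Hom F G) where
  add f g := 
    { app := fun i => f.app i + g.app i
      Pi_comm := fun _ => by
        rw [Preadditive.comp_add, Preadditive.add_comp, f.Pi_comm, g.Pi_comm]
      tau_comm := fun _ => by
        rw [Preadditive.comp_add, Functor.map_add, Preadditive.add_comp, f.tau_comm, g.tau_comm] }

instance : Neg (Hom F G) where
  neg f := 
    { app := fun i => -f.app i
      Pi_comm := fun _ => by rw [Preadditive.comp_neg, Preadditive.neg_comp, f.Pi_comm]
      tau_comm := fun _ => by
        rw [Preadditive.comp_neg, Functor.map_neg, Preadditive.neg_comp, f.tau_comm] }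

theorem gen_Pi (f : Hom F G) (i : ℤ) (v : GenFib (F.obj i)) :
    stalkHom (f.app (i + 1)) _ (stalkHom (F.Pi i) _ v) =
      stalkHom (G.Pi i) _ (stalkHom (f.app i) _ v) := by
  have := congrArg (fun t => stalkHom t (genericPoint B.CL) v) (f.Pi_comm i)
  simpa only [stalkHom_comp, LinearMap.comp_apply] using this

theorem gen_tau (f : Hom F G) (i : ℤ) (v : GenFib (F.obj i)) :
    stalkHom (f.app (i + 1)) _ (semi B (F.tau i) v) =
      semi B (G.tau i) (stalkHom (f.app i) _ v) :=
  semi_square B (f.tau_comm i) v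

/-- A morphism to a twist from homomorphisms which are compatible on generic fibres. -/
def ofGen {D : EffDiv B.C} (f : ∀ i, F.obj i ⟶ TauSheaf.twist B.pr D (G.obj i))
    (φ : ∀ i, GenFib (F.obj i) →ₗ[B.K] GenFib (G.obj i)) (hφ : ∀ i, gen B.pr (f i) = φ i)
    (hP : ∀ i v, φ (i + 1) (stalkHom (F.Pi i) _ v) = stalkHom (G.Pi i) _ (φ i v))
    (ht : ∀ i v, φ (i + 1) (semi B (F.tau i) v) = semi B (G.tau i) (φ i v)) :
    Hom F (G.twist D) where
  app := f
  Pi_comm i := by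
    apply gen_injective B.pr
    ext v
    have h1 := congr($(gen_comp B.pr (F.Pi i) (f (i + 1))) v)
    have h2 := congr($(gen_comp B.pr (f i) (TauSheaf.twistMap B.pr D (G.Pi i))) v)
    have h3 := congr($(gen_twistMap B.pr D (G.Pi i)) (stalkHom (f i) _ v))
    have h4 := congr($(hφ (i + 1)) (stalkHom (F.Pi i) _ v))
    have h5 := congr($(hφ i) v)
    exact h1.trans (h4.trans ((hP i v).trans
      ((congrArg (stalkHom (G.Pi i) _) h5.symm).trans (h3.symm.trans h2.symm))))
  tau_comm i := tau_square_of_gen B fun v => by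
    rw [hφ i, hφ (i + 1)]
    exact ht i v

/-- The natural inclusion `F ⟶ F(D)`. -/
def toTwist (F : TauData B) (D : EffDiv B.C) : Hom F (F.twist D) :=
  ofGen (fun i => TauSheaf.toTwist B.pr D (F.obj i)) _ (fun _ => gen_toTwist _ _ _)
    (fun _ _ => rfl) (fun _ _ => rfl)

theorem eval_Pi (F : TauData B) (D : EffDiv B.C) (i : ℤ) (v : GenFib ((F.twist D).obj i)) :
    eval B.pr D _ (stalkHom ((F.twist D).Pi i) _ v) =
      stalkHom (F.Pi i) _ (eval B.pr D _ v) :=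
  congr($(gen_twistMap B.pr D (F.Pi i)) v)

theorem eval_tau (F : TauData B) (D : EffDiv B.C) (i : ℤ) (v : GenFib ((F.twist D).obj i)) :
    eval B.pr D _ (semi B ((F.twist D).tau i) v) =
      semi B (F.tau i) (eval B.pr D _ v) :=
  eval_semi_twistTau B D (F.tau i) v

/-- The morphism `f ⊗ id : F(D) ⟶ G(D)`. -/
def twistMap (D : EffDiv B.C) (f : Hom F G) : Hom (F.twist D) (G.twist D) :=
  ofGen (F := F.twist D) (fun i => TauSheaf.twistMap B.pr D (f.app i)) _
    (fun _ => gen_twistMap _ _ _)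
    (fun i v => (congrArg (stalkHom (f.app (i + 1)) _) (eval_Pi F D i v)).trans (f.gen_Pi i _))
    (fun i v => (congrArg (stalkHom (f.app (i + 1)) _) (eval_tau F D i v)).trans (f.gen_tau i _))

/-- The natural inclusion `F(D) ⟶ F(D + E)`. -/
def incl (F : TauData B) (D E : EffDiv B.C) : Hom (F.twist D) (F.twist (D + E)) :=
  ofGen (F := F.twist D) (fun i => TauSheaf.twistIncl B.pr D E (F.obj i)) _
    (fun _ => gen_twistIncl _ _ _ _) (eval_Pi F D) (eval_tau F D)

/-- The natural inclusion `F(E) ⟶ F(D + E)`. -/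
def incl' (F : TauData B) (D E : EffDiv B.C) : Hom (F.twist E) (F.twist (D + E)) :=
  ofGen (F := F.twist E) (fun i => TauSheaf.twistIncl' B.pr D E (F.obj i)) _
    (fun _ => gen_twistIncl' _ _ _ _) (eval_Pi F E) (eval_tau F E)

/-- The natural map `F(E)(D) ⟶ F(D + E)`. -/
def twistTwist (F : TauData B) (D E : EffDiv B.C) :
    Hom ((F.twist E).twist D) (F.twist (D + E)) :=
  ofGen (F := (F.twist E).twist D) (fun i => TauSheaf.twistTwist B.pr D E (F.obj i)) _
    (fun _ => gen_twistTwist _ _ _ _)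
    (fun i v => (congrArg (eval B.pr E _) (eval_Pi (F.twist E) D i v)).trans (eval_Pi F E i _))
    (fun i v => (congrArg (eval B.pr E _) (eval_tau (F.twist E) D i v)).trans (eval_tau F E i _))

/-- Multiplication by a rational function `a`, as a morphism `F ⟶ F((a)_∞)`. -/
def mulPole (a : B.Q) (F : TauData B) : Hom F (F.twist (poleDiv a)) :=
  ofGen (fun i => TauSheaf.mulPole B.pr a (F.obj i)) _ (fun _ => gen_mulPole _ _ _)
    (fun i v => (map_smul (stalkHom (F.Pi i) (genericPoint B.CL)) (fnMap B.pr a) v).symm)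
    (fun i v => by
      change fnMap B.pr a • semi B (F.tau i) v = semi B (F.tau i) (fnMap B.pr a • v)
      rw [LinearMap.map_smulₛₗ, fnMap_comp B.σ B.pr B.σ_pr])

/-- The effect of a morphism to a twist on the `i`-th generic fibres. -/
def genFib {D : EffDiv B.C} (f : Hom F (G.twist D)) (i : ℤ) :
    GenFib (F.obj i) →ₗ[B.K] GenFib (G.obj i) :=
  gen B.pr (f.app i)

theorem genFib_ext {D : EffDiv B.C} {f g : Hom F (G.twist D)}
    (h : ∀ i, f.genFib i = g.genFib i) : f = g :=
  Hom.ext (funext fun i => gen_injective B.pr (h i))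

theorem genFib_comp {D : EffDiv B.C} (f : Hom F G) (g : Hom G (H.twist D)) (i : ℤ) :
    (f.comp g).genFib i = g.genFib i ∘ₗ stalkHom (f.app i) _ :=
  gen_comp B.pr (f.app i) (g.app i)

theorem genFib_add {D : EffDiv B.C} (f g : Hom F (G.twist D)) (i : ℤ) :
    (f + g).genFib i = f.genFib i + g.genFib i :=
  gen_add B.pr (f.app i) (g.app i)

theorem genFib_neg {D : EffDiv B.C} (f : Hom F (G.twist D)) (i : ℤ) :
    (-f).genFib i = -f.genFib i :=
  gen_neg B.pr (f.app i)

theorem genFib_zero {D : EffDiv B.C} (i : ℤ) :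
    (0 : Hom F (G.twist D)).genFib i = 0 :=
  gen_zero B.pr

theorem genFib_toTwist (F : TauData B) (D : EffDiv B.C) (i : ℤ) :
    (toTwist F D).genFib i = LinearMap.id := gen_toTwist _ _ _

theorem genFib_twistMap (D : EffDiv B.C) (f : Hom F G) (i : ℤ) :
    (twistMap D f).genFib i = stalkHom (f.app i) _ ∘ₗ eval B.pr D _ := gen_twistMap _ _ _

theorem genFib_incl (F : TauData B) (D E : EffDiv B.C) (i : ℤ) :
    (incl F D E).genFib i = eval B.pr D _ := gen_twistIncl _ _ _ _

theorem genFib_incl' (F : TauData B) (D E : EffDiv B.C) (i : ℤ) :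
    (incl' F D E).genFib i = eval B.pr E _ := gen_twistIncl' _ _ _ _

theorem genFib_twistTwist (F : TauData B) (D E : EffDiv B.C) (i : ℤ) :
    (twistTwist F D E).genFib i = eval B.pr E _ ∘ₗ eval B.pr D _ := gen_twistTwist _ _ _ _

theorem genFib_mulPole (a : B.Q) (F : TauData B) (i : ℤ) :
    (mulPole a F).genFib i = fnMap B.pr a • LinearMap.id := gen_mulPole _ _ _

/-- An isogeny: all components are injective, and the supports of all cokernels lie over one
finite closed subset of the curve. -/
def IsIsogeny (f : Hom F G) : Prop :=
  (∀ i, Mono (f.app i)) ∧ ∃ Z : Set B.C, Z.Finite ∧ IsClosed Z ∧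
    ∀ (i : ℤ) (y : B.CL), B.pr y ∉ Z → Subsingleton (Stalk (cokernel (f.app i)) y)

end Hom

end TauData

end

section

variable {k L : Type u} [Field k] [Fintype k] [Field L] [Algebra k L] {B : Base k L}

/-- A sheaf of modules is locally free of rank `r`. -/
def IsLocallyFree {X : Scheme.{u}} (M : X.Modules) (r : ℕ) : Prop :=
  ∀ x : X, ∃ U : X.Opens, x ∈ U ∧
    Nonempty (M.restrict U.ι ≅ SheafOfModules.free (ULift.{u} (Fin r)))

/-- The ring homomorphism `L → Γ(C_L, O)`. -/
def Base.scalars (B : Base k L) : L →+* Γ(B.CL, ⊤) :=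
  ((Scheme.ΓSpecIso (.of L)).inv ≫ B.str.appTop).hom

/-- The dimension over `L` of the space of global sections. -/
def dimL (M : B.CL.Modules) : Cardinal.{u} :=
  @Module.rank L Γ(M, ⊤) _ _ (Module.compHom _ B.scalars)

/-- The composite `Π_{i+l-1} ∘ ⋯ ∘ Π_i`. -/
def TauData.PiPow (F : TauData B) (i : ℤ) : ∀ l : ℕ, F.obj i ⟶ F.obj (i + l)
  | 0 => eqToHom (congrArg F.obj (by simp))
  | l + 1 => F.PiPow i l ≫ F.Pi (i + l) ≫
      eqToHom (congrArg F.obj (by push_cast; ring))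

/-- The sections of `O_{C_L}(-n·∞)` over an affine open `U ⊆ pr⁻¹ W`: the ideal generated by the
functions on `W` which vanish to order at least `n` at `∞`. -/
def inftyIdeal (B : Base k L) (n : ℕ) (W : B.C.affineOpens) (U : B.CL.Opens)
    (h : U ≤ B.pr ⁻¹ᵁ W.1) : Ideal Γ(B.CL, U) :=
  ((B.infty.ker ^ n).ideal W).map (B.pr.appLE W.1 U h).hom

variable (B) in
/-- An abelian `τ`-sheaf of rank `r` and dimension `d`: the `Π_i` and `τ_i` are injective and
commute; for some `m, l > 0` with `l d = m r` the map `Π_{i+l-1} ∘ ⋯ ∘ Π_i` identifies `F_i` with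
`F_{i+l}(-m·∞)` (tested on sections over small affine opens); `coker Π_i` and `coker τ_i` have
dimension `d` over `L`, and `coker τ_i` is annihilated by `I ^ d`. -/
structure AbelianTauSheaf extends TauData B where
  rank : ℕ
  dim : ℕ
  locallyFree : ∀ i, IsLocallyFree (obj i) rank
  mono_Pi : ∀ i, Mono (Pi i)
  mono_tau : ∀ i, Mono (tau i)
  comm : ∀ i, tau i ≫ Pi (i + 1) = (Scheme.Modules.pullback B.σ).map (Pi i) ≫ tau (i + 1)
  periodic : ∃ m l : ℕ, 0 < m ∧ 0 < l ∧ l * dim = m * rank ∧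
    ∀ (i : ℤ) (W : B.C.affineOpens) (U : B.CL.affineOpens) (h : U.1 ≤ B.pr ⁻¹ᵁ W.1)
      (s : Γ(obj (i + l), U.1)),
      (∃ t : Γ(obj i, U.1), (toTauData.PiPow i l).app U.1 t = s) ↔
        s ∈ (inftyIdeal B m W U.1 h • ⊤ : Submodule Γ(B.CL, U.1) Γ(obj (i + l), U.1))
  dim_coker_Pi : ∀ i, dimL (cokernel (Pi i)) = dim
  dim_coker_tau : ∀ i, dimL (cokernel (tau i)) = dim
  coker_tau_killed : ∀ (i : ℤ) (U : B.CL.affineOpens), ∀ a ∈ (B.I ^ dim).ideal U,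
    ∀ s : Γ(cokernel (tau i), U.1), a • s = 0

/-- The weight `d / r` of an abelian `τ`-sheaf (equal to `0` for the zero sheaf). -/
def AbelianTauSheaf.weight (F : AbelianTauSheaf B) : ℚ := F.dim / F.rank

variable (F G H : TauData B)

/-- A quasi-morphism `F ⟶ G`: a morphism `F ⟶ G(D)` for some effective divisor `D`. -/
structure QuasiMorphism where
  div : EffDiv B.C
  hom : TauData.Hom F (G.twist div)

variable {F G H}

namespace QuasiMorphism

open TauData

/-- The homomorphism on the `i`-th generic fibres induced by a quasi-morphism. -/
def gen (f : QuasiMorphism F G) (i : ℤ) : GenFib (F.obj i) →ₗ[B.K] GenFib (G.obj i) :=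
  f.hom.genFib i

/-- Two quasi-morphisms are equivalent if they agree as morphisms to `G(D₁ + D₂)`. -/
def Equivalent (f g : QuasiMorphism F G) : Prop :=
  f.hom.comp (Hom.incl G f.div g.div) = g.hom.comp (Hom.incl' G f.div g.div)

theorem genFib_incl (f : QuasiMorphism F G) (E : EffDiv B.C) (i : ℤ) :
    (f.hom.comp (Hom.incl G f.div E)).genFib i = f.gen i := by
  rw [Hom.genFib_comp, Hom.genFib_incl]; rfl

theorem genFib_incl' (f : QuasiMorphism F G) (E : EffDiv B.C) (i : ℤ) :
    (f.hom.comp (Hom.incl' G E f.div)).genFib i = f.gen i := by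
  rw [Hom.genFib_comp, Hom.genFib_incl']; rfl

theorem equivalent_iff (f g : QuasiMorphism F G) : f.Equivalent g ↔ f.gen = g.gen := by
  constructor
  · intro h
    funext i
    rw [← genFib_incl f g.div, ← genFib_incl' g f.div]
    exact congrArg (fun t => Hom.genFib t i) h
  · intro h
    refine Hom.genFib_ext fun i => ?_
    rw [genFib_incl, genFib_incl', h]

instance setoid (F G : TauData B) : Setoid (QuasiMorphism F G) where
  r := Equivalent
  iseqv :=
    { refl := fun f => (equivalent_iff f f).2 rfl
      symm := fun h => (equivalent_iff _ _).2 ((equivalent_iff _ _).1 h).symm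
      trans := fun h h' => (equivalent_iff _ _).2
        (((equivalent_iff _ _).1 h).trans ((equivalent_iff _ _).1 h')) }

/-- The sum, formed in `Hom(F, G(D₁ + D₂))`. -/
def add (f g : QuasiMorphism F G) : QuasiMorphism F G :=
  ⟨f.div + g.div, f.hom.comp (Hom.incl G f.div g.div) + g.hom.comp (Hom.incl' G f.div g.div)⟩

/-- The negative of a quasi-morphism. -/
def neg (f : QuasiMorphism F G) : QuasiMorphism F G := ⟨f.div, -f.hom⟩

/-- The product `a · f ∈ Hom(F, G((a)_∞ + D))`. -/
def smul (a : B.Q) (f : QuasiMorphism F G) : QuasiMorphism F G :=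
  ⟨poleDiv a + f.div, (f.hom.comp (Hom.mulPole a (G.twist f.div))).comp
    (Hom.twistTwist G (poleDiv a) f.div)⟩

/-- The composite `(f' ⊗ id) ∘ f ∈ Hom(F, H(D + D'))`. -/
def comp (f' : QuasiMorphism G H) (f : QuasiMorphism F G) : QuasiMorphism F H :=
  ⟨f.div + f'.div, (f.hom.comp (Hom.twistMap f.div f'.hom)).comp
    (Hom.twistTwist H f.div f'.div)⟩

theorem gen_add (f g : QuasiMorphism F G) (i : ℤ) : (f.add g).gen i = f.gen i + g.gen i :=
  (Hom.genFib_add _ _ i).trans (congrArg₂ (· + ·) (genFib_incl f _ i) (genFib_incl' g _ i))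

theorem gen_neg (f : QuasiMorphism F G) (i : ℤ) : f.neg.gen i = -f.gen i :=
  Hom.genFib_neg f.hom i

theorem gen_smul (a : B.Q) (f : QuasiMorphism F G) (i : ℤ) :
    (f.smul a).gen i = fnMap B.pr a • f.gen i := by
  have h1 := Hom.genFib_comp (f.hom.comp (Hom.mulPole a (G.twist f.div)))
    (Hom.twistTwist G (poleDiv a) f.div) i
  have h2 := Hom.genFib_comp f.hom (Hom.mulPole a (G.twist f.div)) i
  rw [Hom.genFib_twistTwist] at h1
  rw [Hom.genFib_mulPole] at h2
  refine h1.trans (LinearMap.ext fun v => ?_)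
  exact (congrArg (eval B.pr _ _) congr($h2 v)).trans (LinearMap.map_smul _ _ _)

theorem gen_comp (f' : QuasiMorphism G H) (f : QuasiMorphism F G) (i : ℤ) :
    (f'.comp f).gen i = f'.gen i ∘ₗ f.gen i := by
  have h1 := Hom.genFib_comp (f.hom.comp (Hom.twistMap f.div f'.hom))
    (Hom.twistTwist H f.div f'.div) i
  have h2 := Hom.genFib_comp f.hom (Hom.twistMap f.div f'.hom) i
  rw [Hom.genFib_twistTwist] at h1
  rw [Hom.genFib_twistMap] at h2
  refine h1.trans (LinearMap.ext fun v => ?_)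
  exact congrArg (eval B.pr _ _) congr($h2 v)

end QuasiMorphism

end

section

variable {k L : Type u} [Field k] [Fintype k] [Field L] [Algebra k L] {B : Base k L}

/-- The divisor `0`. -/
instance {C : Scheme.{u}} [IsIntegral C] : Zero (EffDiv C) where
  zero := ⟨⊤, fun W hW => by
    have : Nonempty W.1 := hW.to_subtype
    exact top_ne_bot⟩

/-- The set `QHom(F, G)` of quasi-morphisms modulo equivalence. -/
def QHom (F G : TauData B) : Type u := Quotient (QuasiMorphism.setoid F G)

namespace QHom

open TauData

variable {F G H : TauData B}

/-- The class of a morphism `f : F ⟶ G(D)`. -/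
def mk {D : EffDiv B.C} (f : Hom F (G.twist D)) : QHom F G := Quotient.mk _ ⟨D, f⟩

/-- The homomorphism on the `i`-th generic fibres induced by a quasi-morphism. -/
def gen (x : QHom F G) : ∀ i, GenFib (F.obj i) →ₗ[B.K] GenFib (G.obj i) :=
  Quotient.lift QuasiMorphism.gen (fun f g h => (f.equivalent_iff g).1 h) x

theorem gen_injective : Function.Injective (gen : QHom F G → _) := by
  rintro ⟨f⟩ ⟨g⟩ h
  exact Quotient.sound ((f.equivalent_iff g).2 h)

theorem ext' {x y : QHom F G} (h : ∀ i v, x.gen i v = y.gen i v) : x = y :=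
  gen_injective (funext fun i => LinearMap.ext (h i))

theorem gen_mk {D : EffDiv B.C} (f : Hom F (G.twist D)) : (mk f).gen = f.genFib := rfl

instance : Zero (QHom F G) where
  zero := mk (0 : Hom F (G.twist 0))

instance : Add (QHom F G) where
  add := Quotient.map₂ QuasiMorphism.add fun f f' h g g' h' =>
    (QuasiMorphism.equivalent_iff _ _).2 (funext fun i => by
      rw [QuasiMorphism.gen_add, QuasiMorphism.gen_add, (f.equivalent_iff f').1 h,
        (g.equivalent_iff g').1 h'])

instance : Neg (QHom F G) where
  neg := Quotient.map QuasiMorphism.neg fun f f' h =>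
    (QuasiMorphism.equivalent_iff _ _).2 (funext fun i => by
      rw [QuasiMorphism.gen_neg, QuasiMorphism.gen_neg, (f.equivalent_iff f').1 h])

instance : SMul B.Q (QHom F G) where
  smul a := Quotient.map (QuasiMorphism.smul a) fun f f' h =>
    (QuasiMorphism.equivalent_iff _ _).2 (funext fun i => by
      rw [QuasiMorphism.gen_smul, QuasiMorphism.gen_smul, (f.equivalent_iff f').1 h])

/-- The composite `y ∘ x` of quasi-morphisms. -/
def comp (y : QHom G H) (x : QHom F G) : QHom F H :=
  Quotient.map₂ QuasiMorphism.comp (fun f f' h g g' h' =>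
    (QuasiMorphism.equivalent_iff _ _).2 (funext fun i => by
      rw [QuasiMorphism.gen_comp, QuasiMorphism.gen_comp, (f.equivalent_iff f').1 h,
        (g.equivalent_iff g').1 h'])) y x

variable (F) in
/-- The class of the inclusion `F ⟶ F(0)`, the identity of `F`. -/
def id : QHom F F := mk (Hom.toTwist F 0)

@[simp] theorem gen_zero (i : ℤ) : (0 : QHom F G).gen i = 0 :=
  Hom.genFib_zero i

@[simp] theorem gen_add (x y : QHom F G) (i : ℤ) : (x + y).gen i = x.gen i + y.gen i := by
  obtain ⟨f⟩ := x
  obtain ⟨g⟩ := y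
  exact f.gen_add g i

@[simp] theorem gen_neg (x : QHom F G) (i : ℤ) : (-x).gen i = -x.gen i := by
  obtain ⟨f⟩ := x
  exact f.gen_neg i

@[simp] theorem gen_smul (a : B.Q) (x : QHom F G) (i : ℤ) :
    (a • x).gen i = fnMap B.pr a • x.gen i := by
  obtain ⟨f⟩ := x
  exact f.gen_smul a i

@[simp] theorem gen_comp (y : QHom G H) (x : QHom F G) (i : ℤ) :
    (y.comp x).gen i = y.gen i ∘ₗ x.gen i := by
  obtain ⟨f⟩ := x
  obtain ⟨g⟩ := y
  exact g.gen_comp f i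

@[simp] theorem gen_id (i : ℤ) : (id F).gen i = LinearMap.id :=
  Hom.genFib_toTwist F 0 i

/-- Addition of quasi-morphisms. -/
instance : AddCommGroup (QHom F G) where
  add_assoc x y z := ext' fun i v => by simp [add_assoc]
  zero_add x := ext' fun i v => by simp
  add_zero x := ext' fun i v => by simp
  add_comm x y := ext' fun i v => by simp [add_comm]
  neg_add_cancel x := ext' fun i v => by simp
  nsmul := nsmulRec
  zsmul := zsmulRec

/-- The `Q`-vector space structure on `QHom(F, G)`. -/
instance : Module B.Q (QHom F G) where
  one_smul x := ext' fun i v => by simp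
  mul_smul a b x := ext' fun i v => by simp [mul_smul]
  smul_zero a := ext' fun i v => by simp
  smul_add a x y := ext' fun i v => by simp
  add_smul a b x := ext' fun i v => by simp [add_smul]
  zero_smul x := ext' fun i v => by simp

/-- The subset `QIsog(F, G)` of classes represented by isogenies. -/
def QIsog (F G : TauData B) : Set (QHom F G) :=
  {x | ∃ (D : EffDiv B.C) (f : Hom F (G.twist D)), f.IsIsogeny ∧ x = mk f}

end QHom

/-- The `Q`-algebra `QEnd(F)`. -/
abbrev QEnd (F : TauData B) : Type u := QHom F F

instance (F : TauData B) : Ring (QEnd F) where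
  mul x y := QHom.comp x y
  one := QHom.id F
  mul_assoc x y z := QHom.ext' fun i v => by
    change ((x.comp y).comp z).gen i v = (x.comp (y.comp z)).gen i v
    simp
  one_mul x := QHom.ext' fun i v => by
    change ((QHom.id F).comp x).gen i v = _
    simp
  mul_one x := QHom.ext' fun i v => by
    change (x.comp (QHom.id F)).gen i v = _
    simp
  left_distrib x y z := QHom.ext' fun i v => by
    change (x.comp (y + z)).gen i v = (x.comp y + x.comp z).gen i v
    simp
  right_distrib x y z := QHom.ext' fun i v => by
    change ((x + y).comp z).gen i v = (x.comp z + y.comp z).gen i v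
    simp
  zero_mul x := QHom.ext' fun i v => by
    change ((0 : QHom F F).comp x).gen i v = _
    simp
  mul_zero x := QHom.ext' fun i v => by
    change (x.comp (0 : QHom F F)).gen i v = _
    simp
  neg_add_cancel := neg_add_cancel
  zsmul := zsmulRec

instance (F : TauData B) : Algebra B.Q (QEnd F) :=
  Algebra.ofModule
    (fun a x y => QHom.ext' fun i v => by
      change ((a • x).comp y).gen i v = (a • x.comp y).gen i v
      simp)
    (fun a x y => QHom.ext' fun i v => by
      change (x.comp (a • y)).gen i v = (a • x.comp y).gen i v
      simp)

/-- `Q` acts on homomorphisms of generic fibres through `Q → K`. -/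
instance (M N : B.CL.Modules) : Module B.Q (GenFib M →ₗ[B.K] GenFib N) :=
  Module.compHom _ (fnMap B.pr)

/-- The space of `K`-linear maps `φ : F_{0,η} → G_{0,η}` with
`φ ∘ Π_{0,η}⁻¹ ∘ τ_{0,η} = Π_{0,η}⁻¹ ∘ τ_{0,η} ∘ σ^* φ`. The equation of `K`-linear maps on
`σ^* F_{0,η}` is tested on the elements `σ^* v`; there `w = Π_{0,η}⁻¹ (τ_{0,η} (σ^* v))`. -/
def GenHom (F G : TauData B) : Submodule B.Q (GenFib (F.obj 0) →ₗ[B.K] GenFib (G.obj 0)) where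
  carrier := {φ | ∀ v w, stalkHom (F.Pi 0) _ w = semi B (F.tau 0) v →
    stalkHom (G.Pi 0) _ (φ w) = semi B (G.tau 0) (φ v)}
  zero_mem' v w _ := (map_zero (stalkHom (G.Pi 0) _)).trans (map_zero (semi B (G.tau 0))).symm
  add_mem' := fun {φ ψ} hφ hψ v w h =>
    (map_add (stalkHom (G.Pi 0) _) (φ w) (ψ w)).trans
      ((congrArg₂ (· + ·) (hφ v w h) (hψ v w h)).trans
        (map_add (semi B (G.tau 0)) (φ v) (ψ v)).symm)
  smul_mem' a φ hφ v w h := by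
    have h1 := LinearMap.map_smul (stalkHom (G.Pi 0) (genericPoint B.CL)) (fnMap B.pr a) (φ w)
    have h2 := LinearMap.map_smulₛₗ (semi B (G.tau 0)) (fnMap B.pr a) (φ v)
    rw [fnMap_comp B.σ B.pr B.σ_pr] at h2
    exact h1.trans ((congrArg (fnMap B.pr a • ·) (hφ v w h)).trans h2.symm)

end

section

variable {k L : Type u} [Field k] [Fintype k] [Field L] [Algebra k L] {B : Base k L}
  {F G : TauData B}

/-- Multiplication by `a` annihilates all cokernels of `f : F ⟶ G`, that is, the map
`a : coker f_i ⟶ coker (f_i ⊗ id)` induced by `a : G_i ⟶ G_i((a)_∞)` vanishes for all `i`. -/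
def Annihilates (a : B.Q) (f : TauData.Hom F G) : Prop :=
  ∀ i, (TauData.Hom.mulPole a G).app i ≫
    cokernel.π ((TauData.Hom.twistMap (poleDiv a) f).app i) = 0

/-- The morphism `g : G(D) ⟶ F((a)_∞)` is dual to `f : F ⟶ G(D)` with respect to `a`:
`g ∘ f = a` and `(f ⊗ id) ∘ g = a`. -/
def IsDual (a : B.Q) {D : EffDiv B.C} (f : TauData.Hom F (G.twist D))
    (g : TauData.Hom (G.twist D) (F.twist (poleDiv a))) : Prop :=
  f.comp g = TauData.Hom.mulPole a F ∧
    g.comp (TauData.Hom.twistMap (poleDiv a) f) = TauData.Hom.mulPole a (G.twist D)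

/-- The quasi-morphism from `G` to `F` represented by `g : G(D) ⟶ F(E)`, that is, by its
restriction to `G ⊆ G(D)`. -/
def dualClass {D E : EffDiv B.C} (g : TauData.Hom (G.twist D) (F.twist E)) : QHom G F :=
  QHom.mk ((TauData.Hom.toTwist G D).comp g)

end

end

end TauSheaf

/-! Everything is read off in the generic fibre of `F_0`. The curves `C` and `C_L` are integral and
Noetherian, and their local rings are valuation rings of the function fields. The `Π_i` are
bijective at the generic point, being injections between spaces of equal finite dimension, so every
`F_{i,η}` is identified with `F_{0,η}` and the stalk of `F_i` at `y` becomes a lattice in this one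
`K`-space. A morphism `F ⟶ F'(D)` then amounts to a `K`-linear map `φ` of the zeroth generic fibres
which is compatible with the Frobenius maps and whose poles, on the lattices for all `i` and all
`y`, are bounded by `D`. Quasi-morphisms are the compatible `φ` for which some `D` exists, and the
work lies in finding `D`.

Two facts produce it. The first concerns `i`. Periodicity says that the lattice with index `i + l`
at `y` is `t^(-m)` times the one with index `i`, where `t` generates the ideal of `∞` at `y` and `m
/ l` is the weight if the rank is not zero. Away from `∞` the lattice does not depend on `i`. If the
weights agree, both sheaves have a common period, so a `φ` which is regular off a finite closed
subset of `C` only has to be bounded for the indices of one period (`exists_bounded`). If the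
weights differ, a bounded `φ` has values, up to a fixed factor, divisible by all powers of `t`, and
vanishes (`weight_eq_of_bounded`).

The second fact concerns `y`. Any `φ` fails to preserve the lattices at finitely many points of
`C_L` only, but such a point might lie over the generic point of `C`, and then no finite closed
subset of `C` contains its image. Compatibility with Frobenius excludes this (`regular_of_generic`):
off the graph of the characteristic `τ` is surjective on stalks, so the bad points over the generic
point of `C` are stable under `σ` and its inverse, except at the graph point. As they are finite in
number, one of them would be periodic under `σ`. But the generic point is the only `σ`-periodic
point over the generic point of `C`, because an ideal of `L ⊗ A` stable under Frobenius on `L` and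
meeting `A` in zero is zero (`eq_bot_of_frobenius`).

Part (3) combines both facts. For (1), an isogeny is bijective at the generic point and its inverse
is regular off the finite set `Z`; the isogeny is bounded, which forces equal weights unless it is
zero, and so its inverse has poles bounded by some `E`. A rational function vanishing along `D + E`
(`exists_vanishing`) annihilates the cokernels. Conversely, that `a` annihilates the cokernels means
that `a · f⁻¹` carries `F'(D)` into `F((a)_∞)`, and this is the dual. For (2), two mutually inverse
quasi-morphisms induce isomorphisms away from the supports of the two divisors. -/

namespace TauSheaf

noncomputable section

/-! ### Stalks of monomorphisms, epimorphisms and cokernels of sheaves of modules -/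

section Sheaves

variable {X : Scheme.{u}} [IrreducibleSpace X]

set_option linter.unusedSectionVars false

theorem app_injective {M N : X.Modules} (f : M ⟶ N) [Mono f] (U : X.Opens) :
    Function.Injective (f.app U) := by
  have h1 : Mono ((Scheme.Modules.toPresheaf X).map f) := inferInstance
  have h2 := (NatTrans.mono_iff_mono_app _).1 h1 (op U)
  exact (AddCommGrpCat.mono_iff_injective _).1 h2

theorem mono_of_app_injective {M N : X.Modules} (f : M ⟶ N)
    (h : ∀ U, Function.Injective (f.app U)) : Mono f := by
  have h1 : Mono ((Scheme.Modules.toPresheaf X).map f) :=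
    (NatTrans.mono_iff_mono_app _).2 fun U => (AddCommGrpCat.mono_iff_injective _).2 (h U.unop)
  exact (Scheme.Modules.toPresheaf X).mono_of_mono_map h1

theorem germ_eq_zero {M : X.Modules} {U : X.Opens} {x : X} (hx : x ∈ U) {m : Γ(M, U)}
    (h : germ M hx m = 0) : ∃ (V : X.Opens) (i : V ⟶ U), x ∈ V ∧ M.presheaf.map i.op m = 0 := by
  obtain ⟨V, hV, i, j, e⟩ := TopCat.Presheaf.germ_eq (C := Ab) M.presheaf x hx hx m 0
    (h.trans (map_zero (germ M hx)).symm)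
  exact ⟨V, i, hV, e.trans (map_zero (M.presheaf.map j.op).hom)⟩

theorem stalkHom_injective {M N : X.Modules} (f : M ⟶ N) [Mono f] (x : X) :
    Function.Injective (stalkHom f x) := by
  rw [injective_iff_map_eq_zero]
  intro v hv
  obtain ⟨U, hU, m, rfl⟩ := germ_exists M v
  rw [stalkHom_germ] at hv
  obtain ⟨V, i, hV, e⟩ := germ_eq_zero hU hv
  have e2 : f.app V (M.presheaf.map i.op m) = N.presheaf.map i.op (f.app U m) :=
    congr($(f.mapPresheaf.naturality i.op) m)
  have e3 : M.presheaf.map i.op m = 0 :=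
    app_injective f V ((e2.trans e).trans (map_zero (f.app V).hom).symm)
  rw [← germ_res M i hV, e3, map_zero]

/-- The family of quotients of the stalks of a sheaf of modules by given submodules. -/
abbrev StalkQuot (N : X.Modules) (S : ∀ x : X, Submodule (X.presheaf.stalk x) (Stalk N x)) (x : X) :
    Type u := Stalk N x ⧸ S x

/-- The families of elements of the quotients of the stalks at the points of `U`. -/
def GodementSections (N : X.Modules) (S : ∀ x : X, Submodule (X.presheaf.stalk x) (Stalk N x))
    (U : X.Opens) : Type u := ∀ x : U, StalkQuot N S x.1

instance (N : X.Modules) (S : ∀ x : X, Submodule (X.presheaf.stalk x) (Stalk N x)) (U : X.Opens) :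
    AddCommGroup (GodementSections N S U) :=
  inferInstanceAs (AddCommGroup (∀ x : U, StalkQuot N S x.1))

instance (N : X.Modules) (S : ∀ x : X, Submodule (X.presheaf.stalk x) (Stalk N x)) (U : X.Opens) :
    SMul Γ(X, U) (GodementSections N S U) where
  smul r s x := X.presheaf.germ U x.1 x.2 r • s x

instance (N : X.Modules) (S : ∀ x : X, Submodule (X.presheaf.stalk x) (Stalk N x)) (U : X.Opens) :
    Module Γ(X, U) (GodementSections N S U) where
  one_smul s := funext fun x => by
    change X.presheaf.germ U x.1 x.2 1 • s x = s x
    rw [map_one, one_smul]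
  mul_smul r r' s := funext fun x => by
    change X.presheaf.germ U x.1 x.2 (r * r') • s x =
      X.presheaf.germ U x.1 x.2 r • X.presheaf.germ U x.1 x.2 r' • s x
    rw [map_mul, mul_smul]
  smul_zero r := funext fun x => by
    change X.presheaf.germ U x.1 x.2 r • (0 : StalkQuot N S x.1) = 0
    rw [smul_zero]
  smul_add r s t := funext fun x => by
    change X.presheaf.germ U x.1 x.2 r • (s x + t x) =
      X.presheaf.germ U x.1 x.2 r • s x + X.presheaf.germ U x.1 x.2 r • t x
    rw [smul_add]
  add_smul r r' s := funext fun x => by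
    change X.presheaf.germ U x.1 x.2 (r + r') • s x =
      X.presheaf.germ U x.1 x.2 r • s x + X.presheaf.germ U x.1 x.2 r' • s x
    rw [map_add, add_smul]
  zero_smul s := funext fun x => by
    change X.presheaf.germ U x.1 x.2 0 • s x = 0
    rw [map_zero, zero_smul]

/-- The presheaf of all families of elements of the quotients of the stalks. -/
def godementPresheaf (N : X.Modules) (S : ∀ x : X, Submodule (X.presheaf.stalk x) (Stalk N x)) :
    TopCat.Presheaf Ab X.toTopCat where
  obj U := AddCommGrpCat.of (GodementSections N S U.unop)
  map i := AddCommGrpCat.ofHom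
    { toFun := fun s x => s ⟨x.1, i.unop.le x.2⟩
      map_zero' := rfl
      map_add' := fun _ _ => rfl }

instance (N : X.Modules) (S : ∀ x : X, Submodule (X.presheaf.stalk x) (Stalk N x))
    (U : (Opens X)ᵒᵖ) : Module (X.ringCatSheaf.obj.obj U) ((godementPresheaf N S).obj U) :=
  inferInstanceAs (Module Γ(X, U.unop) (GodementSections N S U.unop))

/-- The sheaf of modules of all families of elements of the quotients of the stalks. -/
def godement (N : X.Modules) (S : ∀ x : X, Submodule (X.presheaf.stalk x) (Stalk N x)) :
    X.Modules :=
  SheafOfModules.mk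
    (PresheafOfModules.ofPresheaf (R := X.ringCatSheaf.obj) (godementPresheaf N S) (by
      intro U V i r m
      funext x
      exact congrArg (fun t : X.presheaf.stalk x.1 => t •
        (show StalkQuot N S x.1 from m ⟨x.1, i.unop.le x.2⟩))
        (X.presheaf.germ_res_apply i.unop _ x.2 r).symm))
    ((TopCat.Presheaf.isSheaf_iff_isSheaf_comp (forget Ab) _).2
      (TopCat.Presheaf.toTypes_isSheaf X.toTopCat (StalkQuot N S)))

/-- The morphism which maps a section to the family of the classes of its germs. -/
def toGodement (N : X.Modules) (S : ∀ x : X, Submodule (X.presheaf.stalk x) (Stalk N x)) :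
    N ⟶ godement N S :=
  mkHom (N := godement N S)
    (fun U =>
      { toFun := fun m => (fun x => (S x.1).mkQ (germ N x.2 m) : GodementSections N S U)
        map_zero' := funext fun x => by
          change (S x.1).mkQ (germ N x.2 0) = 0
          rw [map_zero, map_zero]
        map_add' := fun a b => funext fun x => by
          change (S x.1).mkQ (germ N x.2 (a + b)) =
            (S x.1).mkQ (germ N x.2 a) + (S x.1).mkQ (germ N x.2 b)
          rw [map_add, map_add] })
    (fun {U V} i m => funext fun x => by
      change (S x.1).mkQ (germ N x.2 _) = (S x.1).mkQ (germ N (i.le x.2) m)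
      rw [germ_res])
    (fun U r m => funext fun x => by
      change (S x.1).mkQ (germ N x.2 (r • m)) =
        X.presheaf.germ U x.1 x.2 r • (S x.1).mkQ (germ N x.2 m)
      rw [germ_smul, map_smul])

theorem toGodement_app_eq_zero {N : X.Modules}
    {S : ∀ x : X, Submodule (X.presheaf.stalk x) (Stalk N x)} {U : X.Opens} {m : Γ(N, U)} :
    (toGodement N S).app U m = 0 ↔ ∀ (x : X) (hx : x ∈ U), germ N hx m ∈ S x := by
  have : (toGodement N S).app U m = 0 ↔
      ∀ x : U, (S x.1).mkQ (germ N x.2 m) = (0 : StalkQuot N S x.1) := by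
    exact funext_iff
  rw [this]
  simp

/-- The sheaf of families of classes in stalk quotients serves as a test object: it turns a
condition on all stalks into the vanishing of a morphism, to which universal properties of cokernels
and adjunctions apply. -/
theorem comp_toGodement_eq_zero {M N : X.Modules} (f : M ⟶ N)
    (S : ∀ x : X, Submodule (X.presheaf.stalk x) (Stalk N x)) :
    f ≫ toGodement N S = 0 ↔ ∀ x, LinearMap.range (stalkHom f x) ≤ S x := by
  constructor
  · rintro h x _ ⟨v, rfl⟩
    obtain ⟨U, hU, m, rfl⟩ := germ_exists M v
    rw [stalkHom_germ]
    have h' : (toGodement N S).app U (f.app U m) = 0 := by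
      change (f ≫ toGodement N S).app U m = 0
      rw [h]
      rfl
    exact toGodement_app_eq_zero.1 h' x hU
  · intro h
    ext U m
    have : (toGodement N S).app U (f.app U m) = 0 :=
      toGodement_app_eq_zero.2 fun x hx => h x ⟨germ M hx m, stalkHom_germ f hx m⟩
    exact this

/-- Testing against the quotients of the stalks of `N` by the images of `f`: the test morphism is
killed by `f`, hence is zero. -/
theorem stalkHom_surjective_of_epi {M N : X.Modules} (f : M ⟶ N) [Epi f] (x : X) :
    Function.Surjective (stalkHom f x) := by
  intro v
  have h : f ≫ toGodement N (fun x => LinearMap.range (stalkHom f x)) = 0 :=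
    (comp_toGodement_eq_zero f _).2 fun _ => le_rfl
  have h' : toGodement N (fun x => LinearMap.range (stalkHom f x)) = 0 := by
    rw [← cancel_epi f, h, comp_zero]
  obtain ⟨U, hU, m, rfl⟩ := germ_exists N v
  have h2 : (toGodement N (fun x => LinearMap.range (stalkHom f x))).app U m = 0 := by
    rw [h']
    rfl
  exact toGodement_app_eq_zero.1 h2 x hU

theorem stalkHom_zero {M N : X.Modules} (x : X) : stalkHom (0 : M ⟶ N) x = 0 := by
  have := stalkHom_add (0 : M ⟶ N) 0 x
  rw [add_zero] at this
  exact left_eq_add.1 this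

/-- A morphism which vanishes on the cokernel of `f` has stalks in the images of those of `f`. -/
theorem range_le_of_comp_cokernel {M N P : X.Modules} (f : M ⟶ N) (h : P ⟶ N)
    (e : h ≫ cokernel.π f = 0) (x : X) :
    LinearMap.range (stalkHom h x) ≤ LinearMap.range (stalkHom f x) := by
  have h1 : f ≫ toGodement N (fun x => LinearMap.range (stalkHom f x)) = 0 :=
    (comp_toGodement_eq_zero f _).2 fun _ => le_rfl
  have h2 : h ≫ toGodement N (fun x => LinearMap.range (stalkHom f x)) = 0 := by
    rw [← cokernel.π_desc f _ h1, ← Category.assoc, e, zero_comp]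
  exact (comp_toGodement_eq_zero h _).1 h2 x

/-- The test morphism for the images of `f` factors through the cokernel, so a section which dies
near `x` in the cokernel has its germ in the image. This translates the support condition in the
definition of an isogeny into surjectivity on stalks. -/
theorem subsingleton_stalk_cokernel_iff {M N : X.Modules} (f : M ⟶ N) (x : X) :
    Subsingleton (Stalk (cokernel f) x) ↔ Function.Surjective (stalkHom f x) := by
  constructor
  · intro hs v
    obtain ⟨U, hU, m, rfl⟩ := germ_exists N v
    have h1 : f ≫ toGodement N (fun x => LinearMap.range (stalkHom f x)) = 0 :=
      (comp_toGodement_eq_zero f _).2 fun _ => le_rfl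
    obtain ⟨V, i, hV, e⟩ := germ_eq_zero (M := cokernel f) hU (m := (cokernel.π f).app U m)
      (Subsingleton.elim _ _)
    have e2 : (cokernel.π f).app V (N.presheaf.map i.op m) = 0 :=
      congr($((cokernel.π f).mapPresheaf.naturality i.op) m).trans e
    have e3 : (toGodement N (fun x => LinearMap.range (stalkHom f x))).app V
        (N.presheaf.map i.op m) = 0 := by
      rw [← cokernel.π_desc f _ h1]
      exact (congrArg ((cokernel.desc f _ h1).app V) e2).trans (map_zero _)
    have := toGodement_app_eq_zero.1 e3 x hV
    rwa [germ_res] at this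
  · intro hs
    refine subsingleton_of_forall_eq 0 fun v => ?_
    obtain ⟨w, rfl⟩ := stalkHom_surjective_of_epi (cokernel.π f) x v
    obtain ⟨w, rfl⟩ := hs w
    rw [← LinearMap.comp_apply, ← stalkHom_comp, cokernel.condition, stalkHom_zero]
    rfl

/-- If the stalk of the cokernel of `σ^* M ⟶ N` at `x` vanishes, then the stalk of `N` is
generated by the image of the stalk of `M` at `σ x`. -/
theorem span_sharp_eq_top (σ : X ⟶ X) {M N : X.Modules}
    (τ : (Scheme.Modules.pullback σ).obj M ⟶ N) (x : X)
    (hs : Subsingleton (Stalk (cokernel τ) x)) :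
    Submodule.span (X.presheaf.stalk x) (Set.range (sharp σ
      ((Scheme.Modules.pullbackPushforwardAdjunction σ).homEquiv M N τ) x)) = ⊤ := by
  set g := (Scheme.Modules.pullbackPushforwardAdjunction σ).homEquiv M N τ with hg
  set S := fun x => Submodule.span (X.presheaf.stalk x) (Set.range (sharp σ g x)) with hS
  -- By adjunction the vanishing may be checked on the adjoint of `τ`, whose values have germs in
  -- `S` by construction.
  have h1 : τ ≫ toGodement N S = 0 := by
    rw [← ((Scheme.Modules.pullbackPushforwardAdjunction σ).homEquiv _ _).injective.eq_iff,
      Adjunction.homEquiv_naturality_right, ← hg]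
    ext U m
    have : (toGodement N S).app (σ ⁻¹ᵁ U) (show Γ(N, σ ⁻¹ᵁ U) from g.app U m) = 0 := by
      refine toGodement_app_eq_zero.2 fun y hy => Submodule.subset_span ?_
      have hy' : σ y ∈ U := hy
      exact ⟨germ M hy' m, sharp_germ σ g y hy' hy m⟩
    rw [show ((Scheme.Modules.pullbackPushforwardAdjunction σ).homEquiv _ _) 0 = 0 by
      rw [Adjunction.homEquiv_unit, Functor.map_zero, comp_zero]]
    exact this
  have h2 : LinearMap.range (stalkHom τ x) ≤ S x := (comp_toGodement_eq_zero τ S).1 h1 x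
  rwa [LinearMap.range_eq_top.2 ((subsingleton_stalk_cokernel_iff τ x).1 hs), top_le_iff] at h2

end Sheaves

/-! ### Bases of sections and of stalks of locally free sheaves -/

section LocallyFree

/-- The structure sheaf as a sheaf of modules. -/
def unitModules (Y : Scheme.{u}) : Y.Modules := SheafOfModules.unit Y.ringCatSheaf

/-- The sections of the structure sheaf, as a sheaf of modules. -/
def unitSec {Y : Scheme.{u}} (V : Y.Opens) : Γ(Y, V) ≃+ Γ(unitModules Y, V) :=
  AddEquiv.refl Γ(Y, V)

theorem unitSec_mul {Y : Scheme.{u}} {V : Y.Opens} (a b : Γ(Y, V)) :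
    unitSec V (a * b) = a • unitSec V b := rfl

theorem unitSec_res {Y : Scheme.{u}} {U V : Y.Opens} (i : V ⟶ U) (a : Γ(Y, U)) :
    (unitModules Y).presheaf.map i.op (unitSec U a) = unitSec V (Y.presheaf.map i.op a) := rfl

/-- In a preadditive category a finite coproduct is a biproduct; its injections and projections,
transported along `φ`, encode freeness in equations which can be evaluated on sections over any open
set. -/
theorem exists_dual_bases {Y : Scheme.{u}} {N : Y.Modules} {r : ℕ}
    (φ : N ≅ SheafOfModules.free (ULift.{u} (Fin r))) :
    ∃ (e : Fin r → (unitModules Y ⟶ N)) (p : Fin r → (N ⟶ unitModules Y)),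
      (∀ i j, e i ≫ p j = if i = j then 𝟙 _ else 0) ∧ ∑ i, p i ≫ e i = 𝟙 N := by
  classical
  let A : Y.Modules := unitModules Y
  let Fr : Y.Modules := ∐ fun _ : ULift.{u} (Fin r) => A
  let ι : ULift.{u} (Fin r) → (A ⟶ Fr) := Sigma.ι (fun _ : ULift.{u} (Fin r) => A)
  let π : ULift.{u} (Fin r) → (Fr ⟶ A) := fun j => Sigma.desc fun i => if i = j then 𝟙 A else 0
  have h1 : ∀ i j, ι i ≫ π j = if i = j then 𝟙 A else 0 := fun i j => Sigma.ι_desc _ _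
  have h2 : ∑ i, π i ≫ ι i = 𝟙 Fr := by
    refine Sigma.hom_ext _ _ fun j => ?_
    change ι j ≫ _ = ι j ≫ _
    rw [Preadditive.comp_sum, Finset.sum_eq_single j]
    · rw [← Category.assoc, h1, if_pos rfl, Category.id_comp, Category.comp_id]
    · intro i _ hi
      rw [← Category.assoc, h1, if_neg hi.symm, zero_comp]
    · exact fun h => absurd (Finset.mem_univ j) h
  let ψ : N ≅ Fr := φ
  refine ⟨fun i => ι ⟨i⟩ ≫ ψ.inv, fun i => ψ.hom ≫ π ⟨i⟩, fun i j => ?_, ?_⟩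
  · change (ι ⟨i⟩ ≫ ψ.inv) ≫ ψ.hom ≫ π ⟨j⟩ = _
    rw [Category.assoc, ψ.inv_hom_id_assoc, h1]
    simp [ULift.ext_iff, A]
  · have h3 : ∑ i : Fin r, π ⟨i⟩ ≫ ι ⟨i⟩ = 𝟙 Fr := by
      rw [← h2]
      exact Fintype.sum_equiv Equiv.ulift.symm _ _ fun _ => rfl
    have : ψ.hom ≫ (∑ i : Fin r, π ⟨i⟩ ≫ ι ⟨i⟩) ≫ ψ.inv = 𝟙 N := by
      rw [h3, Category.id_comp, ψ.hom_inv_id]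
    rw [← this, Preadditive.sum_comp, Preadditive.comp_sum]
    simp only [Category.assoc]

theorem sum_app {Y : Scheme.{u}} {M N : Y.Modules} {r : ℕ} (f : Fin r → (M ⟶ N)) (V : Y.Opens)
    (m : Γ(M, V)) : (∑ i, f i : M ⟶ N).app V m = ∑ i, (f i).app V m :=
  map_sum (AddMonoidHom.mk' (fun f : M ⟶ N => f.app V m) fun _ _ => rfl) f Finset.univ

/-- A free sheaf of modules has sections which form bases of all groups of sections. -/
theorem exists_section_basis {Y : Scheme.{u}} {N : Y.Modules} {r : ℕ}
    (φ : N ≅ SheafOfModules.free (ULift.{u} (Fin r))) :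
    ∃ e : Fin r → Γ(N, ⊤), ∀ (V : Y.Opens) (m : Γ(N, V)), ∃! c : Fin r → Γ(Y, V),
      m = ∑ j, c j • N.presheaf.map (homOfLE le_top).op (e j) := by
  obtain ⟨e, p, h1, h2⟩ := exists_dual_bases φ
  have hone : ∀ (j : Fin r) (V : Y.Opens) (c : Γ(Y, V)), (e j).app V (unitSec V c) =
      c • N.presheaf.map (homOfLE le_top).op ((e j).app ⊤ (unitSec ⊤ 1)) := by
    intro j V c
    have n1 : (e j).app V ((unitModules Y).presheaf.map (homOfLE (le_top : V ≤ ⊤)).op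
      (unitSec ⊤ 1)) = N.presheaf.map (homOfLE le_top).op ((e j).app ⊤ (unitSec ⊤ 1)) :=
      congr($((e j).mapPresheaf.naturality (homOfLE (le_top : V ≤ ⊤)).op) (unitSec ⊤ 1))
    rw [← n1, unitSec_res, map_one, ← Scheme.Modules.Hom.app_smul, ← unitSec_mul, mul_one]
  refine ⟨fun j => (e j).app ⊤ (unitSec ⊤ 1), fun V m =>
    ⟨fun j => (unitSec V).symm ((p j).app V m), ?_, ?_⟩⟩
  · have h3 : (∑ i, p i ≫ e i : N ⟶ N).app V m = m := by rw [h2]; rfl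
    rw [sum_app] at h3
    refine h3.symm.trans (Finset.sum_congr rfl fun j _ => ?_)
    rw [← hone, AddEquiv.apply_symm_apply]
    rfl
  · rintro c rfl
    funext k
    rw [AddEquiv.eq_symm_apply]
    have h3 : ∀ j, (p k).app V (c j • N.presheaf.map (homOfLE le_top).op
        ((e j).app ⊤ (unitSec ⊤ 1))) = if j = k then unitSec V (c j) else 0 := fun j => by
      rw [← hone]
      change (e j ≫ p k).app V _ = _
      rw [h1]
      split_ifs <;> rfl
    refine Eq.symm ((map_sum ((p k).app V).hom _ _).trans ?_)
    refine (Finset.sum_congr rfl fun j _ => h3 j).trans ?_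
    simp

theorem smul_restrict {X : Scheme.{u}} (M : X.Modules) (U : X.Opens) (V : U.toScheme.Opens)
    (r : Γ(U.toScheme, V)) (m : Γ(M.restrict U.ι, V)) :
    r • m = (show Γ(M.restrict U.ι, V) from
      ((show Γ(X, U.ι ''ᵁ V) from r) • (show Γ(M, U.ι ''ᵁ V) from m) : Γ(M, U.ι ''ᵁ V))) := by
  have h : r • m = (show Γ(M.restrict U.ι, V) from
      ((U.ι.appIso V).inv r • (show Γ(M, U.ι ''ᵁ V) from m) : Γ(M, U.ι ''ᵁ V))) := rfl
  rw [h, Scheme.Opens.ι_appIso]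
  rfl

theorem exists_common_section {X : Scheme.{u}} {y : X} {r : ℕ} (U : X.Opens) (hU : y ∈ U)
    (c : Fin r → X.presheaf.stalk y) : ∃ (V : X.Opens) (_ : V ≤ U) (hV : y ∈ V)
      (s : Fin r → Γ(X, V)), ∀ j, X.presheaf.germ V y hV (s j) = c j := by
  choose V hV s hs using fun j => X.presheaf.exists_germ_eq (c j)
  have hy : y ∈ U ⊓ Finset.univ.inf V := by
    refine ⟨hU, ?_⟩
    change y ∈ ((Finset.univ.inf V : X.Opens) : Set X)
    rw [Opens.coe_finset_inf]
    simpa using hV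
  have hle : ∀ j, U ⊓ Finset.univ.inf V ≤ V j := fun j =>
    inf_le_right.trans (Finset.inf_le (Finset.mem_univ j))
  refine ⟨_, inf_le_left, hy, fun j => X.presheaf.map (homOfLE (hle j)).op (s j), fun j => ?_⟩
  rw [← hs j]
  exact X.presheaf.germ_res_apply (homOfLE (hle j)) y hy (s j)

theorem germ_sum {X : Scheme.{u}} (M : X.Modules) {V : X.Opens} {y : X} (hy : y ∈ V) {r : ℕ}
    (c : Fin r → Γ(X, V)) (e : Fin r → Γ(M, V)) : germ M hy (∑ j, c j • e j) =
      ∑ j, X.presheaf.germ V y hy (c j) • germ M hy (e j) := by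
  rw [map_sum]
  exact Finset.sum_congr rfl fun j _ => germ_smul M hy _ _

theorem res_res {X : Scheme.{u}} (M : X.Modules) {U V W : X.Opens} (i : V ⟶ U) (j : W ⟶ V)
    (m : Γ(M, U)) :
    M.presheaf.map j.op (M.presheaf.map i.op m) = M.presheaf.map (j ≫ i).op m := by
  rw [op_comp, Functor.map_comp]
  rfl

theorem ring_res_res {X : Scheme.{u}} {U V W : X.Opens} (i : V ⟶ U) (j : W ⟶ V) (m : Γ(X, U)) :
    X.presheaf.map j.op (X.presheaf.map i.op m) = X.presheaf.map (j ≫ i).op m := by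
  rw [op_comp, Functor.map_comp]
  rfl

/-- The same sections serve at all points of a neighbourhood, which the later finiteness arguments
need. Coordinates exist because a germ comes from a section over a smaller open set. -/
theorem exists_stalk_basis {X : Scheme.{u}} [IrreducibleSpace X] {M : X.Modules} {r : ℕ} (h : IsLocallyFree M r)
    (x : X) : ∃ U : X.Opens, x ∈ U ∧ ∃ e : Fin r → Γ(M, U), ∀ (y : X) (hy : y ∈ U)
      (v : Stalk M y), ∃! c : Fin r → X.presheaf.stalk y, v = ∑ j, c j • germ M hy (e j) := by
  obtain ⟨U, hx, ⟨φ⟩⟩ := h x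
  obtain ⟨e, he⟩ := exists_section_basis φ
  have hU : ∀ {y}, y ∈ U.ι ''ᵁ ⊤ ↔ y ∈ U := by simp
  obtain ⟨e', he'⟩ : ∃ e' : Fin r → Γ(M, U.ι ''ᵁ ⊤), ∀ (V : U.toScheme.Opens)
      (m : Γ(M, U.ι ''ᵁ V)), ∃! c : Fin r → Γ(X, U.ι ''ᵁ V),
        m = ∑ j, c j • M.presheaf.map (homOfLE (U.ι.image_mono le_top)).op (e' j) := by
    refine ⟨e, fun V m => ?_⟩
    have := he V m
    simp only [smul_restrict] at this
    exact this
  refine ⟨U.ι ''ᵁ ⊤, hU.2 hx, e', fun y hy v => ?_⟩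
  have hyU := hU.1 hy
  obtain ⟨V, hV, m, rfl⟩ := germ_exists M v
  have hle : ∀ V : X.Opens, U.ι ''ᵁ (U.ι ⁻¹ᵁ V) ≤ V := fun V => U.ι.image_preimage_le V
  have hmem : ∀ {V : X.Opens}, y ∈ V → y ∈ U.ι ''ᵁ (U.ι ⁻¹ᵁ V) := fun {V} hV =>
    ⟨⟨y, hyU⟩, hV, rfl⟩
  have hex : ∀ (V : U.toScheme.Opens) (hV : y ∈ U.ι ''ᵁ V) (c : Fin r → Γ(X, U.ι ''ᵁ V)),
      germ M hV (∑ j, c j • M.presheaf.map (homOfLE (U.ι.image_mono le_top)).op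
        (e' j)) = ∑ j, X.presheaf.germ _ y hV (c j) •
          germ M hy (e' j) := fun V hV c => by
    rw [germ_sum]
    exact Finset.sum_congr rfl fun j _ => congrArg _ (germ_res M _ hV _)
  -- A linear relation between germs holds over a smaller open set, where the coordinates of the
  -- zero section are unique.
  have hinj : ∀ d : Fin r → X.presheaf.stalk y,
      ∑ j, d j • germ M hy (e' j) = 0 → d = 0 := by
    intro d hd
    obtain ⟨V', -, hV', s, hs⟩ := exists_common_section ⊤ trivial d
    have h1 : germ M (hmem hV') (∑ j, (X.presheaf.map (homOfLE (hle V')).op (s j)) •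
        M.presheaf.map (homOfLE (U.ι.image_mono le_top)).op
          (e' j)) = 0 := by
      rw [hex, ← hd]
      refine Finset.sum_congr rfl fun j _ => ?_
      rw [← hs j]
      exact congrArg (fun t : X.presheaf.stalk y => t • germ M hy (e' j))
        (X.presheaf.germ_res_apply (homOfLE (hle V')) y (hmem hV') (s j))
    obtain ⟨V'', i, hV'', e3⟩ := germ_eq_zero _ h1
    have hle2 : V'' ≤ V' := i.le.trans (hle V')
    have e4 := congrArg (M.presheaf.map (homOfLE (hle V'')).op) e3
    rw [map_zero, map_sum, map_sum] at e4
    have e5 : ∀ j, M.presheaf.map (homOfLE (hle V'')).op (M.presheaf.map i.op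
        ((X.presheaf.map (homOfLE (hle V')).op (s j)) •
          M.presheaf.map (homOfLE (U.ι.image_mono le_top)).op (e' j))) =
        X.presheaf.map (homOfLE ((hle V'').trans hle2)).op (s j) •
          M.presheaf.map (homOfLE (U.ι.image_mono le_top)).op
            (e' j) := fun j => by
      rw [Scheme.Modules.map_smul, Scheme.Modules.map_smul]
      rw [res_res, res_res, ring_res_res, ring_res_res]
      rfl
    rw [Finset.sum_congr rfl fun j _ => e5 j] at e4
    have e6 := (he' (U.ι ⁻¹ᵁ V'') 0).unique e4.symm (y₂ := 0) (by simp)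
    funext j
    rw [← hs j, ← X.presheaf.germ_res_apply (homOfLE ((hle V'').trans hle2)) y (hmem hV'') (s j)]
    exact (congrArg _ (congrFun e6 j)).trans (map_zero _)
  obtain ⟨c, hc, -⟩ := he' (U.ι ⁻¹ᵁ V) (M.presheaf.map (homOfLE (hle V)).op m)
  have hc' : germ M hV m = ∑ j, X.presheaf.germ _ y (hmem hV) (c j) •
      germ M hy (e' j) := by
    rw [← germ_res M (homOfLE (hle V)) (hmem hV) m, hc]
    exact hex _ (hmem hV) c
  refine ⟨fun j => X.presheaf.germ _ y (hmem hV) (c j), hc', fun d hd => ?_⟩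
  rw [← sub_eq_zero]
  refine hinj _ ?_
  simp only [Pi.sub_apply, sub_smul, Finset.sum_sub_distrib]
  rw [← hc', sub_eq_zero]
  exact hd.symm

end LocallyFree

/-! ### Local rings and topology of smooth curves over a field -/

section Curves

/-- A Noetherian local ring whose maximal ideal is generated by a regular element is a domain. -/
theorem isDomain_of_maximalIdeal_eq_span {A : Type*} [CommRing A] [IsLocalRing A]
    [IsNoetherianRing A] {π : A} (h : IsLocalRing.maximalIdeal A = Ideal.span {π})
    (hπ : π ∈ nonZeroDivisors A) : IsDomain A := by
  have key : ∀ a : A, a ≠ 0 → a ∈ nonZeroDivisors A := by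
    intro a ha
    have hne : ∃ n, a ∉ IsLocalRing.maximalIdeal A ^ n := by
      by_contra! hn
      have h1 := Ideal.iInf_pow_eq_bot_of_isLocalRing (IsLocalRing.maximalIdeal A)
        (IsLocalRing.maximalIdeal.isMaximal A).ne_top
      exact ha (by rw [← Ideal.mem_bot, ← h1]; exact Ideal.mem_iInf.2 hn)
    classical
    -- Krull's intersection theorem gives `a` an exact order `n`; then `a = b π ^ n` with `b` a
    -- unit, and `π` is regular.
    obtain ⟨n, hn⟩ : ∃ n, a ∈ IsLocalRing.maximalIdeal A ^ n ∧
        a ∉ IsLocalRing.maximalIdeal A ^ (n + 1) := by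
      have h0 : Nat.find hne ≠ 0 := by
        intro h0
        have := Nat.find_spec hne
        rw [h0] at this
        simp at this
      obtain ⟨n, hn⟩ := Nat.exists_eq_succ_of_ne_zero h0
      exact ⟨n, not_not.1 (Nat.find_min hne (by omega)), by
        have := Nat.find_spec hne; rwa [hn] at this⟩
    rw [h, Ideal.span_singleton_pow, Ideal.span_singleton_pow] at hn
    obtain ⟨b, rfl⟩ := Ideal.mem_span_singleton'.1 hn.1
    have hb : IsUnit b := by
      by_contra hb
      have : b ∈ IsLocalRing.maximalIdeal A := hb
      rw [h] at this
      obtain ⟨c, rfl⟩ := Ideal.mem_span_singleton'.1 this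
      exact hn.2 (Ideal.mem_span_singleton'.2 ⟨c, by ring⟩)
    exact mul_mem hb.mem_nonZeroDivisors (pow_mem hπ n)
  have : NoZeroDivisors A := ⟨fun {a b} hab => by
    by_contra! hne
    exact hne.2 ((mul_left_mem_nonZeroDivisors_eq_zero_iff (key a hne.1)).1 hab)⟩
  exact NoZeroDivisors.to_isDomain A

/-- The local rings of an étale algebra over a principal ideal domain are principal ideal
domains. -/
theorem isPrincipalIdealRing_localization_of_etale (R S : Type*) [CommRing R] [IsDomain R]
    [IsPrincipalIdealRing R] [CommRing S] [Algebra R S] [Algebra.Etale R S] (q : Ideal S)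
    [q.IsPrime] : IsDomain (Localization.AtPrime q) ∧
      IsPrincipalIdealRing (Localization.AtPrime q) := by
  have : IsNoetherianRing S := Algebra.FiniteType.isNoetherianRing R S
  have : IsNoetherianRing (Localization.AtPrime q) :=
    IsLocalization.isNoetherianRing q.primeCompl _ inferInstance
  let p := q.under R
  let := Localization.AtPrime.algebraOfLiesOver p q
  -- Unramifiedness: the maximal ideal upstairs is generated by the prime below, hence by its
  -- generator `π`.
  have hm := ((Algebra.isUnramifiedAt_iff_map_eq R p q).1 inferInstance).2
  obtain ⟨π, hπ⟩ := (IsPrincipalIdealRing.principal p).principal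
  have hπ' : p = Ideal.span {π} := hπ
  rw [hπ', Ideal.map_span, Set.image_singleton] at hm
  have : Module.Flat R (Localization.AtPrime q) := Module.Flat.trans R S _
  have hdom : IsDomain (Localization.AtPrime q) := by
    -- If `π = 0` the local ring is a field; otherwise flatness over the domain `R` keeps `π`
    -- regular.
    by_cases h0 : π = 0
    · rw [h0, map_zero, Ideal.span_singleton_zero] at hm
      have := (IsLocalRing.isField_iff_maximalIdeal_eq).2 hm.symm
      exact this.isDomain
    · refine isDomain_of_maximalIdeal_eq_span hm.symm ?_
      have := Module.Flat.isSMulRegular_of_nonZeroDivisors (M := Localization.AtPrime q)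
        (mem_nonZeroDivisors_of_ne_zero h0)
      rw [mem_nonZeroDivisors_iff_right]
      intro x hx
      refine this ?_
      change π • x = π • 0
      rw [smul_zero, Algebra.smul_def, mul_comm, hx]
  refine ⟨hdom, ⟨fun I => ?_⟩⟩
  by_cases hI : I = ⊥
  · rw [hI]; infer_instance
  · have hp : (IsLocalRing.maximalIdeal (Localization.AtPrime q)).IsPrincipal := ⟨_, hm.symm⟩
    obtain ⟨n, rfl⟩ := exists_maximalIdeal_pow_eq_of_principal _ hp I hI
    rw [← hm, Ideal.span_singleton_pow]
    exact ⟨_, rfl⟩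

theorem isPrincipalIdealRing_mvPolynomial {k : Type*} [CommRing k] (hk : IsField k) :
    IsDomain (MvPolynomial (Fin 1) k) ∧ IsPrincipalIdealRing (MvPolynomial (Fin 1) k) := by
  let := hk.toField
  exact ⟨inferInstance, IsPrincipalIdealRing.of_surjective
    (MvPolynomial.uniqueAlgEquiv k (Fin 1)).symm.toRingHom
      (MvPolynomial.uniqueAlgEquiv k (Fin 1)).symm.surjective⟩

theorem isField_sections_of_spec {k : Type u} [Field k] {U : (Spec (.of k)).Opens}
    {x : Spec (.of k)} (hx : x ∈ U) : IsField Γ(Spec (.of k), U) := by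
  have : U = ⊤ := by
    ext y
    have : y = x := Subsingleton.elim (α := PrimeSpectrum k) y x
    simp [this, hx]
  subst this
  exact (Scheme.ΓSpecIso (.of k)).commRingCatIsoToRingEquiv.toMulEquiv.isField (Field.toIsField k)

/-- The local structure theorem yields étale coordinates over the sections of `Spec k` on some
non-empty open set. As `Spec k` is a point, this ring is a field. -/
theorem exists_etale_of_smooth {k : Type u} [Field k] {X : Scheme.{u}} (f : X ⟶ Spec (.of k))
    [SmoothOfRelativeDimension 1 f] (x : X) : ∃ (V : X.affineOpens) (_ : x ∈ V.1)
      (k' : Type u) (_ : CommRing k') (_ : IsField k')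
      (g : MvPolynomial (Fin 1) k' →+* Γ(X, V.1)), g.Etale := by
  obtain ⟨U, hU, V, hV, hx, e, hf⟩ :=
    SmoothOfRelativeDimension.exists_isStandardSmoothOfRelativeDimension (n := 1) (f := f) x
  obtain ⟨g, -, hg⟩ := hf.exists_etale_mvPolynomial
  exact ⟨⟨V, hV⟩, hx, _, _, isField_sections_of_spec (e hx), g, hg⟩

theorem stalk_of_smooth {k : Type u} [Field k] {X : Scheme.{u}} (f : X ⟶ Spec (.of k))
    [SmoothOfRelativeDimension 1 f] (x : X) :
    IsDomain (X.presheaf.stalk x) ∧ IsPrincipalIdealRing (X.presheaf.stalk x) := by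
  obtain ⟨V, hx, k', _, hk', g, hg⟩ := exists_etale_of_smooth f x
  obtain ⟨h1, h2⟩ := isPrincipalIdealRing_mvPolynomial hk'
  algebraize [g]
  obtain ⟨x, rfl⟩ : ∃ x' : V.1, x'.1 = x := ⟨⟨x, hx⟩, rfl⟩
  have := V.2.isLocalization_stalk x
  obtain ⟨h3, h4⟩ := isPrincipalIdealRing_localization_of_etale (MvPolynomial (Fin 1) k') Γ(X, V.1)
    (V.2.primeIdealOf x).asIdeal
  let e := IsLocalization.algEquiv (V.2.primeIdealOf x).asIdeal.primeCompl
    (Localization.AtPrime (V.2.primeIdealOf x).asIdeal) (X.presheaf.stalk x.1)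
  exact ⟨e.symm.toMulEquiv.isDomain _, IsPrincipalIdealRing.of_surjective e.toRingHom e.surjective⟩

/-- An integral Noetherian scheme whose local rings are principal ideal rings. -/
class IsCurve (X : Scheme.{u}) : Prop where
  integral : IsIntegral X
  noetherian : IsNoetherian X
  principal : ∀ x, IsPrincipalIdealRing (X.presheaf.stalk x)

attribute [instance] IsCurve.integral IsCurve.noetherian IsCurve.principal

theorem isCurve_of_smooth {k : Type u} [Field k] {X : Scheme.{u}} [IrreducibleSpace X]
    (f : X ⟶ Spec (.of k)) [SmoothOfRelativeDimension 1 f] [IsProper f] : IsCurve X := by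
  have : ∀ x, _root_.IsReduced (X.presheaf.stalk x) := fun x => by
    have := (stalk_of_smooth f x).1
    infer_instance
  have : IsReduced X := isReduced_of_isReduced_stalk X
  have h : IsLocallyNoetherian X := LocallyOfFiniteType.isLocallyNoetherian f
  have hc : CompactSpace X := QuasiCompact.compactSpace_of_compactSpace f
  exact ⟨isIntegral_of_irreducibleSpace_of_isReduced X, {}, fun x => (stalk_of_smooth f x).2⟩

variable {X : Scheme.{u}} [IsCurve X]

/-- The generizations of `y` are the primes of its local ring, a local principal ideal domain: only
zero and the maximal ideal occur. -/
theorem eq_generic_or_eq_of_specializes {x y : X} (h : x ⤳ y) : x = genericPoint X ∨ x = y := by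
  have hr := X.range_fromSpecStalk (x := y)
  have key : ∀ z : X, z ⤳ y → ∃ p, X.fromSpecStalk y p = z := fun z hz => by
    have : z ∈ Set.range (X.fromSpecStalk y) := by rw [hr]; exact hz
    exact this
  obtain ⟨p, rfl⟩ := key x h
  obtain ⟨q, hq⟩ := key _ (generic_specializes y)
  by_cases hp : p.asIdeal = ⊥
  · left
    rw [← hq]
    have h1 : p ⤳ q := (PrimeSpectrum.le_iff_specializes p q).1 (by
      change p.asIdeal ≤ q.asIdeal
      rw [hp]; exact bot_le)
    have h2 := h1.map (X.fromSpecStalk y).continuous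
    refine (h2.antisymm ?_).eq
    rw [hq]
    exact (generic_specializes _)
  · right
    have : p.asIdeal.IsPrime := p.2
    have := IsPrime.to_maximal_ideal hp
    have h3 : p = IsLocalRing.closedPoint _ := PrimeSpectrum.ext (IsLocalRing.eq_maximalIdeal this)
    rw [h3, Scheme.fromSpecStalk_closedPoint]

theorem isClosed_singleton_of_ne {x : X} (hx : x ≠ genericPoint X) : IsClosed {x} := by
  rw [← closure_subset_iff_isClosed]
  intro y hy
  rcases eq_generic_or_eq_of_specializes (specializes_iff_mem_closure.2 hy) with h | h
  · exact absurd h hx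
  · exact h.symm

theorem isClosed_of_finite {Z : Set X} (hZ : Z.Finite) (h : genericPoint X ∉ Z) : IsClosed Z := by
  rw [← Set.biUnion_of_singleton Z]
  exact hZ.isClosed_biUnion fun x hx => isClosed_singleton_of_ne fun e => h (e ▸ hx)

/-- A closed subset of a Noetherian space is a finite union of irreducible closed ones. Each of
these has a generic point different from that of `X`, hence a closed point. -/
theorem finite_of_isClosed {Z : Set X} (hZ : IsClosed Z) (h : genericPoint X ∉ Z) : Z.Finite := by
  obtain ⟨S, hS, hS', hS'', rfl⟩ := NoetherianSpace.exists_finite_set_isClosed_irreducible hZ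
  refine hS.sUnion fun T hT => ?_
  obtain ⟨x, hx⟩ := QuasiSober.sober (hS'' T hT) (hS' T hT)
  have hxT : x ∈ T := hx.mem
  have hx' : x ≠ genericPoint X := fun e => h (Set.mem_sUnion.2 ⟨T, hT, e ▸ hxT⟩)
  rw [← hx.def, (isClosed_singleton_of_ne hx').closure_eq]
  exact Set.finite_singleton x

/-- Otherwise `X` would be finite and Jacobson, hence a single point, and a chart étale over a
polynomial ring would be a field. This makes the finite exceptional set of an isogeny avoid the
generic point of `C`. -/
theorem generic_notMem_of_finite {k : Type u} [Field k] {X : Scheme.{u}} [IsIntegral X]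
    (f : X ⟶ Spec (.of k)) [SmoothOfRelativeDimension 1 f] {Z : Set X} (hZ : Z.Finite)
    (hZ' : IsClosed Z) : genericPoint X ∉ Z := by
  intro hmem
  have huniv : Z = Set.univ := Set.eq_univ_of_univ_subset
    ((genericPoint_spec X).def ▸ hZ'.closure_subset_iff.2 (Set.singleton_subset_iff.2 hmem))
  have : Smooth f := SmoothOfRelativeDimension.smooth 1 f
  have : Finite X := Set.finite_univ_iff.1 (huniv ▸ hZ)
  have : JacobsonSpace X := LocallyOfFiniteType.jacobsonSpace f
  obtain ⟨V, hx, k', _, hk', g, hg⟩ := exists_etale_of_smooth f (genericPoint X)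
  have hV : ∀ x : X, x = genericPoint X := fun x =>
    ((generic_specializes x).eq).symm
  have : Nonempty V.1 := ⟨⟨_, hx⟩⟩
  have hF : IsField Γ(X, V.1) := by
    refine ⟨⟨0, 1, zero_ne_one⟩, mul_comm, fun {a} ha => ?_⟩
    have : X.basicOpen a ≠ ⊥ := fun h => ha ((basicOpen_eq_bot_iff a).1 h)
    obtain ⟨y, hy⟩ := (Opens.ne_bot_iff_nonempty _).1 this
    have : IsUnit a := X.toLocallyRingedSpace.toRingedSpace.isUnit_of_isUnit_germ V.1 a fun z hz => by
      have : z ∈ X.basicOpen a := by rw [hV z, ← hV y]; exact hy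
      exact (X.mem_basicOpen a z hz).1 this
    obtain ⟨b, hb⟩ := this.exists_right_inv
    exact ⟨b, hb⟩
  let := hF.toField
  let := hk'.toField
  algebraize [g]
  -- Zariski's lemma: a field of finite type over a Jacobson ring is finite over it. The polynomial
  -- ring injects into it by flatness, so it would itself be a field.
  have hfin : Module.Finite (MvPolynomial (Fin 1) k') Γ(X, V.1) :=
    finite_of_finite_type_of_isJacobsonRing _ _
  have hinj : Function.Injective (algebraMap (MvPolynomial (Fin 1) k') Γ(X, V.1)) := by
    rw [injective_iff_map_eq_zero]
    intro p hp
    by_contra h0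
    have := Module.Flat.isSMulRegular_of_nonZeroDivisors (M := Γ(X, V.1))
      (mem_nonZeroDivisors_of_ne_zero h0)
    refine one_ne_zero (α := Γ(X, V.1)) (this ?_)
    change p • (1 : Γ(X, V.1)) = p • 0
    rw [smul_zero, Algebra.smul_def, hp, zero_mul]
  have := isField_of_isIntegral_of_isField hinj hF
  have hX : (MvPolynomial.X 0 : MvPolynomial (Fin 1) k') ≠ 0 := MvPolynomial.X_ne_zero 0
  obtain ⟨b, hb⟩ := this.mul_inv_cancel hX
  have := congrArg (MvPolynomial.eval (fun _ => (0 : k'))) hb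
  simp at this

end Curves

/-! ### Frobenius-stable ideals in a tensor product -/

section FixedPoints

open TensorProduct

/-- A descent argument: a non-zero element of `P` with the fewest coordinates over `L`, normalised,
has coordinates fixed by `φ`. These are roots of `X ^ N - X`, so the element is integral over `A`,
and in a domain an ideal with a non-zero integral element meets `A` non-trivially. -/
theorem eq_bot_of_frobenius {k L A : Type*} [Field k] [Field L] [CommRing A] [Algebra k L]
    [Algebra k A] [IsDomain (L ⊗[k] A)] [Nontrivial A] (φ : L →ₐ[k] L) {N : ℕ} (hN : 2 ≤ N)
    (hφ : ∀ x, φ x = x ^ N) (P : Ideal (L ⊗[k] A))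
    (hP : ∀ x ∈ P, Algebra.TensorProduct.map φ (AlgHom.id k A) x ∈ P)
    (hA : P.comap (Algebra.TensorProduct.includeRight : A →ₐ[k] L ⊗[k] A) = ⊥) : P = ⊥ := by
  classical
  by_contra hne
  let b := Module.Free.chooseBasis k A
  let β := Algebra.TensorProduct.basis L b
  set s := Algebra.TensorProduct.map φ (AlgHom.id k A) with hs
  have hrepr : ∀ x i, β.repr (s x) i = φ (β.repr x i) := by
    intro x i
    induction x using TensorProduct.induction_on with
    | zero => simp
    | tmul l a =>
      simp only [s, β, Algebra.TensorProduct.map_tmul, Algebra.TensorProduct.basis_repr_tmul,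
        Finsupp.smul_apply, Finsupp.mapRange_apply, smul_eq_mul, map_mul, AlgHom.coe_id, id,
        AlgHom.commutes]
    | add x y hx hy => simp only [map_add, Finsupp.add_apply, hx, hy]
  have hex : ∃ n, ∃ x ∈ P, x ≠ 0 ∧ (β.repr x).support.card = n := by
    obtain ⟨x, hx, hx0⟩ := Submodule.exists_mem_ne_zero_of_ne_bot hne
    exact ⟨_, x, hx, hx0, rfl⟩
  obtain ⟨x, hx, hx0, hc⟩ := Nat.find_spec hex
  have hmin : ∀ y ∈ P, (β.repr y).support.card < (β.repr x).support.card → y = 0 := by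
    intro y hy hlt
    by_contra hy0
    rw [hc] at hlt
    exact Nat.find_min hex hlt ⟨y, hy, hy0, rfl⟩
  obtain ⟨j, hj⟩ : (β.repr x).support.Nonempty := by
    rw [Finset.nonempty_iff_ne_empty, Ne, Finsupp.support_eq_empty]
    exact fun h => hx0 (β.repr.map_eq_zero_iff.1 h)
  have hj' : β.repr x j ≠ 0 := Finsupp.mem_support_iff.1 hj
  have hsmul : ∀ (l : L), ∀ y ∈ P, l • y ∈ P := fun l y hy => by
    rw [Algebra.smul_def]; exact P.mul_mem_left _ hy
  -- With the `j`-th coordinate equal to 1, which `φ` fixes, `s z - z` loses this coordinate and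
  -- gains none, so it vanishes by minimality.
  set z := (β.repr x j)⁻¹ • x with hz
  have hzP : z ∈ P := hsmul _ _ hx
  have hz0 : z ≠ 0 := smul_ne_zero (inv_ne_zero hj') hx0
  have hzi : ∀ i, β.repr z i = (β.repr x j)⁻¹ * β.repr x i := fun i => by
    rw [hz, map_smul, Finsupp.smul_apply, smul_eq_mul]
  have hfix : s z - z = 0 := by
    apply hmin _ (sub_mem (hP z hzP) hzP)
    apply Finset.card_lt_card
    refine ⟨fun i hi => ?_, fun h => ?_⟩
    · rw [Finsupp.mem_support_iff] at hi ⊢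
      intro h0
      apply hi
      rw [map_sub, Finsupp.sub_apply, hrepr, hzi, h0, mul_zero, map_zero, sub_zero]
    · have := h hj
      rw [Finsupp.mem_support_iff, map_sub, Finsupp.sub_apply, hrepr, hzi,
        inv_mul_cancel₀ hj', map_one, sub_self] at this
      exact this rfl
  have hpow : ∀ i, β.repr z i ^ N = β.repr z i := fun i => by
    rw [← hφ, ← hrepr, sub_eq_zero.1 hfix]
  let _ : Algebra A (L ⊗[k] A) := Algebra.TensorProduct.rightAlgebra
  have hint : IsIntegral A z := by
    rw [← β.linearCombination_repr z, Finsupp.linearCombination_apply, Finsupp.sum]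
    refine IsIntegral.sum _ fun i _ => ?_
    rw [Algebra.smul_def]
    refine IsIntegral.mul ⟨Polynomial.X ^ N - Polynomial.X,
      Polynomial.monic_X_pow_sub (by simpa using by omega), ?_⟩ ?_
    · rw [Polynomial.eval₂_sub, Polynomial.eval₂_X_pow, Polynomial.eval₂_X, ← map_pow, hpow,
        sub_self]
    · rw [Algebra.TensorProduct.basis_apply]
      exact isIntegral_algebraMap (R := A) (A := L ⊗[k] A) (x := b i)
  exact Ideal.comap_ne_bot_of_integral_mem hz0 hzP hint hA

end FixedPoints

/-! ### The curves `C` and `C_L`; periodic points of `σ` -/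

section BaseCurves

open TensorProduct

variable {k L : Type u} [Field k] [Fintype k] [Field L] [Algebra k L] (B : Base k L)

instance : SmoothOfRelativeDimension 1 B.str :=
  have := smoothOfRelativeDimension_isStableUnderBaseChange (n := 1)
  MorphismProperty.of_isPullback (P := @SmoothOfRelativeDimension 1) B.isPullback inferInstance

instance : IsProper B.str :=
  MorphismProperty.of_isPullback (P := @IsProper) B.isPullback inferInstance

instance : IsCurve B.C := isCurve_of_smooth B.struct

instance : IsCurve B.CL := isCurve_of_smooth B.str

/-- A point over the generic point of `C` which is fixed by `id × Spec φ`, where `φ` is a power map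
`x ↦ x ^ N` with `N ≥ 2`, is the generic point of `C_L`. -/
theorem eq_generic_of_fixed {ρ : B.CL ⟶ B.CL} (h1 : ρ ≫ B.pr = B.pr) {φ : L →ₐ[k] L} {N : ℕ}
    (hN : 2 ≤ N) (hφ : ∀ x, φ x = x ^ N)
    (h2 : ρ ≫ B.str = B.str ≫ Spec.map (CommRingCat.ofHom φ.toRingHom)) {y : B.CL}
    (hy : ρ y = y) (hg : B.pr y = genericPoint B.C) : y = genericPoint B.CL := by
  obtain ⟨_, ⟨W, hW, rfl⟩, hgW, -⟩ := B.C.isBasis_affineOpens.exists_subset_of_mem_open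
    (Set.mem_univ (genericPoint B.C)) isOpen_univ
  have : Nonempty W := ⟨⟨_, hgW⟩⟩
  let f := Spec.preimage (hW.fromSpec ≫ B.struct)
  have hf : Spec.map f = hW.fromSpec ≫ B.struct := Spec.map_preimage _
  let _ : Algebra k Γ(B.C, W) := f.hom.toAlgebra
  let iR : Γ(B.C, W) ⟶ .of (TensorProduct k L Γ(B.C, W)) :=
    CommRingCat.ofHom (Algebra.TensorProduct.includeRight (R := k) (A := L) (B := Γ(B.C, W))).toRingHom
  let iL : .of L ⟶ CommRingCat.of (TensorProduct k L Γ(B.C, W)) :=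
    CommRingCat.ofHom (Algebra.TensorProduct.includeLeftRingHom)
  have hpo : IsPushout (CommRingCat.ofHom (algebraMap k L)) f iL iR :=
    CommRingCat.isPushout_tensorProduct k L Γ(B.C, W)
  have hpb := isPullback_SpecMap_of_isPushout _ _ _ _ hpo
  rw [hf] at hpb
  -- This chart is the preimage in `C_L` of an affine open set `W` around the generic point of `C`;
  -- it contains `y`.
  let j : Spec _ ⟶ B.CL := B.isPullback.lift (Spec.map iR ≫ hW.fromSpec) (Spec.map iL)
    (by rw [Category.assoc, hpb.flip.w])
  have hj1 : j ≫ B.pr = Spec.map iR ≫ hW.fromSpec := B.isPullback.lift_fst _ _ _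
  have hj2 : j ≫ B.str = Spec.map iL := B.isPullback.lift_snd _ _ _
  have hsq : IsPullback j (Spec.map iR) B.pr hW.fromSpec :=
    IsPullback.of_right (by rw [hj2]; exact hpb) hj1 B.isPullback.flip
  have hoi : IsOpenImmersion hW.fromSpec := hW.isOpenImmersion_fromSpec
  have : IsOpenImmersion j :=
    MorphismProperty.of_isPullback (P := @IsOpenImmersion) hsq.flip inferInstance
  obtain ⟨q, hq⟩ : genericPoint B.C ∈ Set.range hW.fromSpec := by
    rw [hW.range_fromSpec]; exact hgW
  obtain ⟨p, hp, hpq⟩ := Scheme.exists_preimage_of_isPullback hsq y q (hg.trans hq.symm)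
  have hne : Nonempty (Spec (.of (TensorProduct k L Γ(B.C, W)))) := ⟨p⟩
  have hint : IsIntegral (Spec (.of (TensorProduct k L Γ(B.C, W)))) :=
    isIntegral_of_isOpenImmersion j
  have hdom : IsDomain (TensorProduct k L Γ(B.C, W)) :=
    (affine_isIntegral_iff (.of (TensorProduct k L Γ(B.C, W)))).1 hint
  have hgen : ∀ (R : CommRingCat.{u}) [IsDomain R] (X : Scheme.{u}) [IrreducibleSpace X]
      (i : Spec R ⟶ X) [IsOpenImmersion i] (p : Spec R), i p = genericPoint X ↔ p.asIdeal = ⊥ := by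
    intro R _ X _ i _ p
    have := genericPoint_eq_of_isOpenImmersion i
    rw [← this]
    refine i.isOpenEmbedding.injective.eq_iff.trans ?_
    rw [genericPoint_eq_bot_of_affine]
    exact PrimeSpectrum.ext_iff
  let s : TensorProduct k L Γ(B.C, W) →ₐ[k] TensorProduct k L Γ(B.C, W) :=
    Algebra.TensorProduct.map φ (AlgHom.id k _)
  -- On the chart, `ρ` is the spectrum of `φ ⊗ id`, so the prime of a fixed point is stable under `φ
  -- ⊗ id`.
  have hs : Spec.map (CommRingCat.ofHom s.toRingHom) ≫ j = j ≫ ρ := by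
    apply B.isPullback.hom_ext
    · rw [Category.assoc, Category.assoc, h1, hj1, ← Category.assoc, ← Spec.map_comp]
      congr 2
      ext a
      change s (1 ⊗ₜ a) = 1 ⊗ₜ a
      simp [s]
    · rw [Category.assoc, Category.assoc, h2, hj2, reassoc_of% hj2, ← Spec.map_comp,
        ← Spec.map_comp]
      congr 1
  have hsp : Spec.map (CommRingCat.ofHom s.toRingHom) p = p := by
    apply j.isOpenEmbedding.injective
    rw [← Scheme.Hom.comp_apply, hs, Scheme.Hom.comp_apply, hp, hy]
  rw [← hp, hgen]
  refine eq_bot_of_frobenius φ hN hφ p.asIdeal (fun x hx => ?_) ?_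
  · have : x ∈ (Spec.map (CommRingCat.ofHom s.toRingHom) p).asIdeal := by rw [hsp]; exact hx
    exact this
  -- The contraction of the prime to `Γ(C, W)` belongs to `pr y`, which is the generic point, and is
  -- therefore zero.
  · have := (hgen _ B.C hW.fromSpec q).1 hq
    rw [← hpq] at this
    exact this

/-- Iterates of `σ` are again of the form `id × Spec φ` with `φ` the `q ^ n`-power map, so periodic
points of `σ` are covered by the statement on fixed points. -/
theorem exists_iterate (n : ℕ) : ∃ (ρ : B.CL ⟶ B.CL) (φ : L →ₐ[k] L), ρ ≫ B.pr = B.pr ∧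
    (∀ x, φ x = x ^ (Fintype.card k ^ n)) ∧
    ρ ≫ B.str = B.str ≫ Spec.map (CommRingCat.ofHom φ.toRingHom) ∧ ∀ y, ρ y = B.σ^[n] y := by
  induction n with
  | zero =>
    refine ⟨𝟙 _, AlgHom.id k L, by simp, by simp, ?_, by simp⟩
    have : CommRingCat.ofHom (AlgHom.id k L).toRingHom = 𝟙 _ := rfl
    rw [this, Spec.map_id, Category.comp_id, Category.id_comp]
  | succ n ih =>
    obtain ⟨ρ, φ, h1, h2, h3, h4⟩ := ih
    refine ⟨B.σ ≫ ρ, (FiniteField.frobeniusAlgHom k L).comp φ, by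
      rw [Category.assoc, h1, B.σ_pr], fun x => ?_, ?_, fun y => ?_⟩
    · rw [AlgHom.comp_apply, h2, FiniteField.coe_frobeniusAlgHom, pow_succ, pow_mul]
    · rw [Category.assoc, h3, reassoc_of% B.σ_str, Base.frob, ← Spec.map_comp]
      rfl
    · rw [Scheme.Hom.comp_apply, h4, Function.iterate_succ_apply]

theorem eq_generic_of_iterate_fixed {n : ℕ} (hn : n ≠ 0) {y : B.CL} (hy : B.σ^[n] y = y)
    (hg : B.pr y = genericPoint B.C) : y = genericPoint B.CL := by
  obtain ⟨ρ, φ, h1, h2, h3, h4⟩ := exists_iterate B n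
  exact eq_generic_of_fixed B h1 (Nat.one_lt_pow hn Fintype.one_lt_card) h2 h3
    ((h4 y).trans hy) hg

theorem generic_notMem {Z : Set B.C} (hZ : Z.Finite) (hZ' : IsClosed Z) : genericPoint B.C ∉ Z :=
  generic_notMem_of_finite B.struct hZ hZ'

theorem pr_σ (y : B.CL) : B.pr (B.σ y) = B.pr y := by
  rw [← Scheme.Hom.comp_apply, B.σ_pr]

theorem σ_surjective : Function.Surjective B.σ := by
  have : Surjective B.σ := MorphismProperty.of_isPullback B.isPullback_σ.flip inferInstance
  exact B.σ.surjective

theorem pr_surjective : Function.Surjective B.pr := B.pr.surjective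

/-- The point `∞` of the curve. -/
def inftyPt : B.C := B.infty (IsLocalRing.closedPoint k)

/-- The point of `C_L` on the graph of the characteristic. -/
def graphPt : B.CL := B.graph (IsLocalRing.closedPoint L)

theorem mem_support_infty_iff {z : B.C} : z ∈ B.infty.ker.support ↔ z = inftyPt B := by
  have : IsClosedImmersion B.infty := isClosedImmersion_of_comp_eq_id _ _ B.infty_struct
  have h : (B.infty.ker.support : Set B.C) = {inftyPt B} := by
    rw [Scheme.Hom.support_ker, B.infty.isClosedEmbedding.isClosed_range.closure_eq]
    ext z
    constructor
    · rintro ⟨p, rfl⟩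
      exact congrArg B.infty (Subsingleton.elim (α := PrimeSpectrum k) _ _)
    · rintro rfl
      exact ⟨_, rfl⟩
  exact Set.ext_iff.1 h z

theorem mem_support_I_iff {y : B.CL} : y ∈ B.I.support ↔ y = graphPt B := by
  have : IsClosedImmersion B.graph :=
    isClosedImmersion_of_comp_eq_id B.str _ (B.isPullback.lift_snd _ _ _)
  have h : (B.I.support : Set B.CL) = {graphPt B} := by
    rw [Base.I, Scheme.Hom.support_ker, B.graph.isClosedEmbedding.isClosed_range.closure_eq]
    ext z
    constructor
    · rintro ⟨p, rfl⟩
      exact congrArg B.graph (Subsingleton.elim (α := PrimeSpectrum L) _ _)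
    · rintro rfl
      exact ⟨_, rfl⟩
  exact Set.ext_iff.1 h y

theorem isClosed_inftyPt : IsClosed {inftyPt B} := by
  have : ({inftyPt B} : Set B.C) = B.infty.ker.support := by
    ext z
    exact (mem_support_infty_iff B).symm
  rw [this]
  exact B.infty.ker.support.isClosed

theorem inftyPt_ne_generic : genericPoint B.C ≠ inftyPt B :=
  generic_notMem B (Set.finite_singleton _) (isClosed_inftyPt B)

end BaseCurves

/-! ### Local rings as valuation rings, ideal sheaves and approximation -/

section LocalRings

variable {X : Scheme.{u}} [IsCurve X]

instance (x : X) : ValuationRing (X.presheaf.stalk x) :=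
  ValuationRing.iff_local_bezout_domain.2 ⟨inferInstance, inferInstance⟩

/-- The embedding of a local ring in the function field. -/
abbrev toFF {X : Scheme.{u}} [IrreducibleSpace X] (x : X) :
    X.presheaf.stalk x →+* X.functionField :=
  algebraMap (X.presheaf.stalk x) X.functionField

theorem toFF_germ {X : Scheme.{u}} [IrreducibleSpace X] {x : X} {U : X.Opens} (hx : x ∈ U)
    (g : Γ(X, U)) : toFF x (X.presheaf.germ U x hx g) =
      X.presheaf.germ U (genericPoint X) (generic_mem hx) g :=
  congr($(X.presheaf.germ_stalkSpecializes hx (generic_specializes x)).hom g)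

theorem toFF_injective {X : Scheme.{u}} [IsIntegral X] (x : X) : Function.Injective (toFF x) :=
  IsFractionRing.injective _ _

/-- The local ring at a point, as a valuation ring of the function field. -/
def locRing (x : X) : ValuationSubring X.functionField :=
  { (toFF x).range with
    mem_or_inv_mem' := fun a => ValuationRing.isInteger_or_isInteger (X.presheaf.stalk x) a }

theorem toFF_mem {x : X} (r : X.presheaf.stalk x) : toFF x r ∈ locRing x := ⟨r, rfl⟩

theorem germ_mem_locRing {x : X} {U : X.Opens} (hx : x ∈ U) (g : Γ(X, U)) :
    (X.presheaf.germ U (genericPoint X) (generic_mem hx) g : X.functionField) ∈ locRing x :=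
  ⟨_, toFF_germ hx g⟩

theorem mem_locRing_iff_exists {x : X} {a : X.functionField} : a ∈ locRing x ↔
    ∃ (U : X.affineOpens) (hx : x ∈ U.1) (g : Γ(X, U.1)),
      X.presheaf.germ U.1 (genericPoint X) (generic_mem hx) g = a := by
  constructor
  · rintro ⟨r, rfl⟩
    obtain ⟨V, hV, s, rfl⟩ := X.presheaf.exists_germ_eq r
    obtain ⟨_, ⟨W, hW, rfl⟩, hxW, hWV⟩ := X.isBasis_affineOpens.exists_subset_of_mem_open hV V.isOpen
    have hWV' : W ≤ V := hWV
    refine ⟨⟨W, hW⟩, hxW, X.presheaf.map (homOfLE hWV').op s, ?_⟩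
    refine (X.presheaf.germ_res_apply (homOfLE hWV') _ (generic_mem hxW) s).trans ?_
    exact (toFF_germ hV s).symm
  · rintro ⟨U, hx, g, rfl⟩
    exact germ_mem_locRing hx g

theorem isOpen_locRing (a : X.functionField) : IsOpen {x : X | a ∈ locRing x} := by
  rw [isOpen_iff_forall_mem_open]
  intro x hx
  obtain ⟨U, hU, g, rfl⟩ := mem_locRing_iff_exists.1 hx
  exact ⟨U.1, fun y hy => germ_mem_locRing hy g, U.1.isOpen, hU⟩

theorem mem_locRing_generic (a : X.functionField) : a ∈ locRing (genericPoint X) := by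
  obtain ⟨U, hU, g, rfl⟩ := X.presheaf.exists_germ_eq a
  exact germ_mem_locRing hU g

theorem finite_poles (a : X.functionField) : {x : X | a ∉ locRing x}.Finite :=
  finite_of_isClosed (isOpen_locRing a).isClosed_compl fun h => h (mem_locRing_generic a)

theorem isUnit_iff_inv_mem {x : X} {r : X.presheaf.stalk x} (hr : r ≠ 0) :
    IsUnit r ↔ (toFF x r)⁻¹ ∈ locRing x := by
  have h0 : toFF x r ≠ 0 := (map_ne_zero_iff _ (toFF_injective x)).2 hr
  constructor
  · rintro ⟨u, rfl⟩
    refine ⟨↑u⁻¹, eq_inv_of_mul_eq_one_left ?_⟩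
    rw [← map_mul, Units.inv_mul, map_one]
  · rintro ⟨s, hs⟩
    refine IsUnit.of_mul_eq_one s (toFF_injective x ?_)
    rw [map_mul, map_one, hs, mul_inv_cancel₀ h0]

section Maps

variable {Y : Scheme.{u}} [IsCurve Y] (f : X ⟶ Y) [IsDominant f]

theorem fnMap_toFF (y : X) (r : Y.presheaf.stalk (f y)) :
    fnMap f (toFF (f y) r) = toFF y (f.stalkMap y r) := by
  obtain ⟨U, hU, g, rfl⟩ := Y.presheaf.exists_germ_eq r
  have hU' : y ∈ f ⁻¹ᵁ U := hU
  have e1 : toFF (f y) (Y.presheaf.germ U (f y) hU g) = _ := toFF_germ hU g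
  have e2 : f.stalkMap y (Y.presheaf.germ U (f y) hU g) = X.presheaf.germ (f ⁻¹ᵁ U) y hU' (f.app U g) :=
    Scheme.Hom.germ_stalkMap_apply f U y hU g
  have e3 := fnMap_germ f U (generic_mem hU) (generic_mem hU') g
  erw [e1, e2]
  exact e3.trans (toFF_germ hU' _).symm

/-- If `a` is not regular at `f y`, then `a⁻¹` is a non-unit there. The map of local rings is local,
so `a⁻¹` stays a non-unit at `y` and `a` stays irregular. Applied to `pr` and to `σ`. -/
theorem fnMap_mem_iff (y : X) (a : Y.functionField) :
    fnMap f a ∈ locRing y ↔ a ∈ locRing (f y) := by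
  constructor
  · intro h
    by_contra ha
    obtain ⟨r, hr⟩ := ((locRing (f y)).mem_or_inv_mem a).resolve_left ha
    have ha0 : a ≠ 0 := by
      rintro rfl
      exact ha (zero_mem _)
    have hr0 : r ≠ 0 := by
      rintro rfl
      rw [map_zero] at hr
      exact inv_ne_zero ha0 hr.symm
    have hs0 : f.stalkMap y r ≠ 0 := by
      intro h0
      have := fnMap_toFF f y r
      rw [h0, map_zero, map_eq_zero, hr] at this
      exact inv_ne_zero ha0 this
    have hu : IsUnit (f.stalkMap y r) := by
      rw [isUnit_iff_inv_mem hs0, ← fnMap_toFF, hr, map_inv₀, inv_inv]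
      exact h
    have hu' : IsUnit r := isUnit_of_map_unit (f.stalkMap y).hom r hu
    rw [isUnit_iff_inv_mem hr0, hr, inv_inv] at hu'
    exact ha hu'
  · rintro ⟨r, rfl⟩
    rw [fnMap_toFF]
    exact toFF_mem _

end Maps

/-- The stalk of an ideal sheaf. -/
def locIdeal {X : Scheme.{u}} (J : X.IdealSheafData) (x : X) : Ideal (X.presheaf.stalk x) :=
  ⨆ (W : X.affineOpens) (hx : x ∈ W.1), (J.ideal W).map (X.presheaf.germ W.1 x hx).hom

theorem map_germ_eq {X : Scheme.{u}} (J : X.IdealSheafData) {x : X} (W W' : X.affineOpens)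
    (hx : x ∈ W.1) (hx' : x ∈ W'.1) : (J.ideal W).map (X.presheaf.germ W.1 x hx).hom =
      (J.ideal W').map (X.presheaf.germ W'.1 x hx').hom := by
  obtain ⟨_, ⟨V, hV, rfl⟩, hxV, hVW⟩ := X.isBasis_affineOpens.exists_subset_of_mem_open
    (show x ∈ W.1 ⊓ W'.1 from ⟨hx, hx'⟩) (W.1 ⊓ W'.1).isOpen
  have key : ∀ (U : X.affineOpens) (hU : x ∈ U.1) (h : (⟨V, hV⟩ : X.affineOpens) ≤ U),
      (J.ideal U).map (X.presheaf.germ U.1 x hU).hom =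
        (J.ideal ⟨V, hV⟩).map (X.presheaf.germ V x hxV).hom := fun U hU h => by
    rw [← J.map_ideal h, Ideal.map_map, ← CommRingCat.hom_comp]
    congr 2
    exact (X.presheaf.germ_res (homOfLE h) x hxV).symm
  rw [key W hx (fun y hy => (hVW hy).1), key W' hx' (fun y hy => (hVW hy).2)]

theorem locIdeal_eq {X : Scheme.{u}} (J : X.IdealSheafData) {x : X} (W : X.affineOpens)
    (hx : x ∈ W.1) : locIdeal J x = (J.ideal W).map (X.presheaf.germ W.1 x hx).hom := by
  refine le_antisymm (iSup₂_le fun W' hx' => (map_germ_eq J W' W hx' hx).le) ?_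
  exact le_iSup₂_of_le W hx le_rfl

theorem exists_affine_mem {X : Scheme.{u}} (x : X) : ∃ W : X.affineOpens, x ∈ W.1 := by
  obtain ⟨_, ⟨V, hV, rfl⟩, hxV, -⟩ := X.isBasis_affineOpens.exists_subset_of_mem_open
    (Set.mem_univ x) isOpen_univ
  exact ⟨⟨V, hV⟩, hxV⟩

theorem germ_mem_locIdeal {X : Scheme.{u}} (J : X.IdealSheafData) {x : X} (W : X.affineOpens)
    (hx : x ∈ W.1) {g : Γ(X, W.1)} (hg : g ∈ J.ideal W) :
    X.presheaf.germ W.1 x hx g ∈ locIdeal J x := by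
  rw [locIdeal_eq J W hx]
  exact Ideal.mem_map_of_mem _ hg

theorem locIdeal_mul {X : Scheme.{u}} (I J : X.IdealSheafData) (x : X) :
    locIdeal (I * J) x = locIdeal I x * locIdeal J x := by
  obtain ⟨W, hx⟩ := exists_affine_mem x
  rw [locIdeal_eq _ W hx, locIdeal_eq _ W hx, locIdeal_eq _ W hx, ← Ideal.map_mul]
  rfl

theorem locIdeal_pow {X : Scheme.{u}} (I : X.IdealSheafData) (n : ℕ) (x : X) :
    locIdeal (I ^ n) x = locIdeal I x ^ n := by
  obtain ⟨W, hx⟩ := exists_affine_mem x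
  rw [locIdeal_eq _ W hx, locIdeal_eq _ W hx, ← Ideal.map_pow]
  rfl

theorem locIdeal_eq_top_iff {X : Scheme.{u}} (J : X.IdealSheafData) (x : X) :
    locIdeal J x = ⊤ ↔ x ∉ J.support := by
  obtain ⟨W, hx⟩ := exists_affine_mem x
  have h : x ∈ J.support ↔ locIdeal J x ≤ IsLocalRing.maximalIdeal _ := by
    rw [J.mem_support_iff_of_mem hx, locIdeal_eq J W hx, Ideal.map_le_iff_le_comap]
    simp only [Scheme.mem_zeroLocus_iff, SetLike.le_def, SetLike.mem_coe]
    refine forall₂_congr fun g hg => ?_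
    rw [X.mem_basicOpen g x hx]
    rfl
  rw [h]
  constructor
  · intro e hle
    exact (IsLocalRing.maximalIdeal.isMaximal _).ne_top (top_le_iff.1 (e ▸ hle))
  · intro h
    by_contra hne
    exact h (IsLocalRing.le_maximalIdeal hne)

theorem locIdeal_ne_bot {X : Scheme.{u}} [IsIntegral X] (D : EffDiv X) (x : X) :
    locIdeal D.ideal x ≠ ⊥ := by
  obtain ⟨W, hx⟩ := exists_affine_mem x
  rw [locIdeal_eq _ W hx, Ne, Ideal.map_eq_bot_iff_of_injective]
  · exact D.ne_bot W ⟨x, hx⟩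
  · exact germ_injective_of_isIntegral X x hx

/-- An ideal sheaf whose support does not contain the generic point defines an effective
divisor. -/
def EffDiv.ofIdeal {X : Scheme.{u}} [IsIntegral X] (J : X.IdealSheafData)
    (h : genericPoint X ∉ J.support) : EffDiv X where
  ideal := J
  ne_bot W hW e := by
    obtain ⟨x, hx⟩ := hW
    apply h
    rw [J.mem_support_iff_of_mem (generic_mem hx), e]
    simp only [Scheme.mem_zeroLocus_iff, SetLike.mem_coe, Ideal.mem_bot]
    rintro _ rfl
    simp

theorem generic_notMem_support {X : Scheme.{u}} [IsIntegral X] (D : EffDiv X) :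
    genericPoint X ∉ D.ideal.support := by
  intro h
  obtain ⟨W, hx⟩ := exists_affine_mem (genericPoint X)
  obtain ⟨g, hg, hg0⟩ := Submodule.exists_mem_ne_zero_of_ne_bot (D.ne_bot W ⟨_, hx⟩)
  rw [D.ideal.mem_support_iff_of_mem hx, Scheme.mem_zeroLocus_iff] at h
  have := h g hg
  rw [X.mem_basicOpen g _ hx, isUnit_iff_ne_zero] at this
  exact this fun e => hg0 (germ_injective_of_isIntegral X _ hx (e.trans (map_zero _).symm))

/-- If all non-zero elements of the local ring were units, every non-empty basic open subset of an
affine neighbourhood would contain `x`, which makes `x` generic. -/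
theorem exists_ne_zero_nonunit {x : X} (hx : x ≠ genericPoint X) :
    ∃ a : X.functionField, a ≠ 0 ∧ a ∈ locRing x ∧ a⁻¹ ∉ locRing x := by
  by_contra! h
  have hU : ∀ W : X.affineOpens, x ∈ W.1 → ∀ r : X.presheaf.stalk x, r ≠ 0 → IsUnit r :=
    fun W _ r hr => (isUnit_iff_inv_mem hr).2
      (h _ ((map_ne_zero_iff _ (toFF_injective x)).2 hr) (toFF_mem r))
  obtain ⟨W, hW⟩ := exists_affine_mem x
  have hcl : ∀ g : Γ(X, W.1), genericPoint X ∈ X.basicOpen g → x ∈ X.basicOpen g := by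
    intro g hg
    rw [X.mem_basicOpen g x hW]
    refine hU W hW _ fun h0 => ?_
    have : g = 0 := germ_injective_of_isIntegral X x hW (h0.trans (map_zero _).symm)
    rw [this, Scheme.basicOpen_zero] at hg
    exact hg
  apply hx
  refine (Specializes.antisymm ?_ (generic_specializes x)).eq
  rw [specializes_iff_forall_open]
  intro U hU hgU
  obtain ⟨f, hf1, hf2⟩ := W.2.exists_basicOpen_le (V := ⟨U, hU⟩) ⟨genericPoint X, hgU⟩
    (generic_mem hW)
  exact hf1 (hcl f hf2)

variable {Q : Type*} [Field Q]

/-- The quotient `T ^ (M - N)` would be a unit, hence so would `T`, valuation rings being closed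
under roots. Thus at most one exponent turns `T ^ N * y` into a unit. -/
theorem not_unit_of_pow (O : ValuationSubring Q) {T y : Q} (hT : ¬(T ∈ O ∧ T⁻¹ ∈ O)) {N M : ℕ}
    (hNM : N < M) (hy : y ≠ 0) (h1 : T ^ N * y ∈ O ∧ (T ^ N * y)⁻¹ ∈ O)
    (h2 : T ^ M * y ∈ O ∧ (T ^ M * y)⁻¹ ∈ O) : False := by
  have hT0 : T ≠ 0 := by
    rintro rfl
    exact hT ⟨zero_mem _, by simp [zero_mem]⟩
  have hn : M - N ≠ 0 := by omega
  have e : T ^ (M - N) = (T ^ M * y) * (T ^ N * y)⁻¹ := by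
    obtain ⟨c, rfl⟩ := Nat.exists_eq_add_of_lt hNM
    rw [show N + c + 1 - N = c + 1 by omega, pow_add, pow_add]
    field_simp
    ring
  have e1 : T ^ (M - N) ∈ O := e ▸ mul_mem h2.1 h1.2
  have e2 : (T ^ (M - N))⁻¹ ∈ O := by
    rw [e, mul_inv, inv_inv]
    exact mul_mem h2.2 h1.1
  have root : ∀ t : Q, t ^ (M - N) ∈ O → t ∈ O := by
    intro t ht
    rw [← O.valuation_le_one_iff] at ht ⊢
    rw [map_pow] at ht
    exact (pow_le_one_iff hn).1 ht
  exact hT ⟨root _ e1, root _ (by rwa [inv_pow])⟩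

/-- Finitely many proper valuation rings of a field have a common non-unit. -/
theorem exists_forall_not_unit {ι : Type*} (O : ι → ValuationSubring Q) (s : Finset ι)
    (h : ∀ i ∈ s, ∃ a : Q, a ≠ 0 ∧ a ∈ O i ∧ a⁻¹ ∉ O i) :
    ∃ T : Q, T ≠ 0 ∧ ∀ i ∈ s, ¬(T ∈ O i ∧ T⁻¹ ∈ O i) := by
  classical
  induction s using Finset.induction_on with
  | empty => exact ⟨1, one_ne_zero, by simp⟩
  | insert j s hj ih =>
    obtain ⟨T, hT0, hT⟩ := ih fun i hi => h i (Finset.mem_insert_of_mem hi)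
    by_cases hTj : T ∈ O j ∧ T⁻¹ ∈ O j
    · obtain ⟨y, hy0, hy1, hy2⟩ := h j (Finset.mem_insert_self _ _)
      -- Each index in `s` excludes at most one exponent `N`. At `j` every `N` is allowed: `T` is a
      -- unit there, so `T ^ N * y` has the valuation of `y`.
      have hbad : {N : ℕ | ∃ i ∈ s, T ^ N * y ∈ O i ∧ (T ^ N * y)⁻¹ ∈ O i}.Finite := by
        have : {N : ℕ | ∃ i ∈ s, T ^ N * y ∈ O i ∧ (T ^ N * y)⁻¹ ∈ O i} =
            ⋃ i ∈ (s : Set ι), {N : ℕ | T ^ N * y ∈ O i ∧ (T ^ N * y)⁻¹ ∈ O i} := by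
          ext N; simp only [Set.mem_ofPred_eq, Set.mem_iUnion, exists_prop, Finset.mem_coe]
        rw [this]
        refine s.finite_toSet.biUnion fun i hi => Set.Subsingleton.finite fun N hN M hM => ?_
        rcases lt_trichotomy N M with hlt | heq | hlt
        · exact (not_unit_of_pow (O i) (hT i hi) hlt hy0 hN hM).elim
        · exact heq
        · exact (not_unit_of_pow (O i) (hT i hi) hlt hy0 hM hN).elim
      obtain ⟨N, hN⟩ := hbad.exists_notMem
      refine ⟨T ^ N * y, mul_ne_zero (pow_ne_zero _ hT0) hy0, fun i hi => ?_⟩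
      rcases Finset.mem_insert.1 hi with rfl | hi
      · rintro ⟨-, h2⟩
        apply hy2
        have := mul_mem (pow_mem hTj.1 N) h2
        rwa [mul_inv, mul_inv_cancel_left₀ (pow_ne_zero _ hT0)] at this
      · exact fun hu => hN ⟨i, hi, hu⟩
    · refine ⟨T, hT0, fun i hi => ?_⟩
      rcases Finset.mem_insert.1 hi with rfl | hi
      · exact hTj
      · exact hT i hi

/-- Finitely many proper valuation rings of a field have a common non-zero element of their
maximal ideals. -/
theorem exists_forall_nonunit {ι : Type*} (O : ι → ValuationSubring Q) (s : Finset ι)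
    (h : ∀ i ∈ s, ∃ a : Q, a ≠ 0 ∧ a ∈ O i ∧ a⁻¹ ∉ O i) :
    ∃ x : Q, x ≠ 0 ∧ ∀ i ∈ s, x ∈ O i ∧ x⁻¹ ∉ O i := by
  rcases s.eq_empty_or_nonempty with rfl | ⟨i0, hi0⟩
  · exact ⟨1, one_ne_zero, by simp⟩
  obtain ⟨T, hT0, hT⟩ := exists_forall_not_unit O s h
  -- Were it zero, `T⁻¹ = -T` would make `T` a unit of every one of the rings.
  have hne : 1 + T ^ 2 ≠ 0 := by
    intro h0
    refine hT i0 hi0 ?_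
    have e : T⁻¹ = -T := by
      rw [inv_eq_iff_eq_inv, eq_comm, inv_eq_of_mul_eq_one_left]
      linear_combination -h0
    rcases (O i0).mem_or_inv_mem T with h1 | h1
    · exact ⟨h1, e ▸ neg_mem h1⟩
    · exact ⟨by rw [e] at h1; simpa using neg_mem h1, h1⟩
  -- The inverse of this element is `T⁻¹ + T`, which has a pole whether `T` has a zero or a pole.
  refine ⟨T * (1 + T ^ 2)⁻¹, mul_ne_zero hT0 (inv_ne_zero hne), fun i hi => ?_⟩
  have e : (T * (1 + T ^ 2)⁻¹)⁻¹ = T⁻¹ + T := by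
    rw [mul_inv, inv_inv]; field_simp
  have hn : T⁻¹ + T ∉ O i := by
    intro hm
    rcases (O i).mem_or_inv_mem T with h1 | h1
    · exact hT i hi ⟨h1, by simpa using sub_mem hm h1⟩
    · exact hT i hi ⟨by simpa using sub_mem hm h1, h1⟩
  rw [e]
  exact ⟨by have := ((O i).mem_or_inv_mem (T⁻¹ + T)).resolve_left hn; rwa [← e, inv_inv] at this, hn⟩

/-- A non-zero proper ideal of the local ring is a power of the maximal ideal, and the latter
contains `J`. -/
theorem exists_pow_mem {x : X} {I : Ideal (X.presheaf.stalk x)} (hI : I ≠ ⊥)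
    {J : Ideal (X.presheaf.stalk x)} (hJ : J ≠ ⊤) : ∃ n, J ^ n ≤ I := by
  by_cases hx : I = ⊤
  · exact ⟨0, by rw [hx]; exact le_top⟩
  obtain ⟨n, hn⟩ := exists_maximalIdeal_pow_eq_of_principal _
    (IsPrincipalIdealRing.principal (IsLocalRing.maximalIdeal (X.presheaf.stalk x))) I hI
  exact ⟨n, hn ▸ Ideal.pow_right_mono (IsLocalRing.le_maximalIdeal hJ) n⟩

/-- For every effective divisor `D` there is a rational function which vanishes along `D` to
the order prescribed by `D`. -/
theorem exists_vanishing (D : EffDiv X) : ∃ a : X.functionField, a ≠ 0 ∧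
    ∀ x ∈ D.ideal.support, ∃ r ∈ locIdeal D.ideal x, toFF x r = a := by
  have hfin : (D.ideal.support : Set X).Finite :=
    finite_of_isClosed D.ideal.support.isClosed (generic_notMem_support D)
  -- A common non-unit `b` at the finitely many points of the support; a high power of it lies in
  -- the ideal of `D` at each of them.
  obtain ⟨b, hb0, hb⟩ := exists_forall_nonunit (fun x : X => locRing x) hfin.toFinset
    fun x hx => exists_ne_zero_nonunit fun e =>
      generic_notMem_support D (e ▸ hfin.mem_toFinset.1 hx)
  have hpow : ∀ x ∈ D.ideal.support, ∃ n, ∀ m, n ≤ m → ∃ r ∈ locIdeal D.ideal x,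
      toFF x r = b ^ m := by
    intro x hx
    obtain ⟨⟨r, hr⟩, hr'⟩ := hb x (hfin.mem_toFinset.2 hx)
    have hr0 : r ≠ 0 := by
      rintro rfl
      rw [map_zero] at hr
      exact hb0 hr.symm
    have hspan : Ideal.span {r} ≠ ⊤ := by
      rw [Ne, Ideal.span_singleton_eq_top, isUnit_iff_inv_mem hr0, hr]
      exact hr'
    obtain ⟨n, hn⟩ := exists_pow_mem (locIdeal_ne_bot D x) hspan
    refine ⟨n, fun m hm => ⟨r ^ m, ?_, by rw [map_pow, hr]⟩⟩
    exact hn (Ideal.pow_le_pow_right hm (Ideal.pow_mem_pow (Ideal.mem_span_singleton_self r) m))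
  choose! n hn using hpow
  refine ⟨b ^ hfin.toFinset.sup n, pow_ne_zero _ hb0, fun x hx => hn x hx _ ?_⟩
  exact Finset.le_sup (hfin.mem_toFinset.2 hx)

end LocalRings

/-! ### Stalks as lattices in the generic fibre, and twists -/

section Lattices

variable {X : Scheme.{u}}

theorem cosp_smul' [IrreducibleSpace X] (M : X.Modules) {y : X} (r : X.presheaf.stalk y)
    (m : Stalk M y) :
    cosp M (generic_specializes y) (r • m) = toFF y r • cosp M (generic_specializes y) m := by
  obtain ⟨U, hU, g, rfl⟩ := X.presheaf.exists_germ_eq r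
  exact (cosp_smul M hU g m).trans (congrArg (· • _) (toFF_germ hU g).symm)

/-- The image of the stalk at `y` in the generic fibre. -/
def lat [IrreducibleSpace X] (M : X.Modules) (y : X) : AddSubgroup (GenFib M) :=
  (cosp M (generic_specializes y)).range

theorem cosp_mem_lat [IrreducibleSpace X] (M : X.Modules) {y : X} (m : Stalk M y) :
    cosp M (generic_specializes y) m ∈ lat M y := ⟨m, rfl⟩

theorem germ_mem_lat [IrreducibleSpace X] (M : X.Modules) {y : X} {U : X.Opens} (hy : y ∈ U)
    (m : Γ(M, U)) : (germ M (generic_mem hy) m : GenFib M) ∈ lat M y := ⟨germ M hy m, cosp_germ M _ hy m⟩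

theorem smul_mem_lat [IsCurve X] {M : X.Modules} {y : X} {a : X.functionField}
    (ha : a ∈ locRing y) {v : GenFib M} (hv : v ∈ lat M y) : a • v ∈ lat M y := by
  obtain ⟨r, rfl⟩ := ha
  obtain ⟨m, rfl⟩ := hv
  exact ⟨r • m, cosp_smul' M r m⟩

theorem cosp_generic [IrreducibleSpace X] (M : X.Modules) (v : GenFib M) :
    cosp M (generic_specializes (genericPoint X)) v = v := by
  obtain ⟨U, hU, m, rfl⟩ := germ_exists M v
  exact cosp_germ M _ hU m

theorem mem_lat_generic [IrreducibleSpace X] (M : X.Modules) (v : GenFib M) :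
    v ∈ lat M (genericPoint X) := ⟨v, cosp_generic M v⟩

theorem section_eq_zero {M : X.Modules} {U : X.Opens} {m : Γ(M, U)}
    (h : ∀ (y : X) (hy : y ∈ U), germ M hy m = 0) : m = 0 :=
  TopCat.Presheaf.section_ext (C := Ab) (X := X.toTopCat) ⟨M.presheaf, M.isSheaf⟩ U m 0 fun y hy =>
    (h y hy).trans (map_zero (germ M hy)).symm

section LocallyFree

variable [IsCurve X] {M : X.Modules} {r : ℕ} (hM : IsLocallyFree M r)
include hM

/-- A local trivialisation gives one basis of the generic fibre which describes the lattices at all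
points of a neighbourhood by integrality of coordinates. -/
theorem exists_lat_basis (x : X) : ∃ (U : X.Opens) (_ : x ∈ U)
    (b : Module.Basis (Fin r) X.functionField (GenFib M)), ∀ y ∈ U, ∀ v,
      v ∈ lat M y ↔ ∀ j, b.repr v j ∈ locRing y := by
  obtain ⟨U, hU, e, he⟩ := exists_stalk_basis hM x
  have hg := generic_mem hU
  let E : (Fin r → X.functionField) ≃ₗ[X.functionField] GenFib M :=
    LinearEquiv.ofBijective
      (Fintype.linearCombination X.functionField fun j => (germ M hg (e j) : GenFib M)) (by
        rw [Function.bijective_iff_existsUnique]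
        intro v
        obtain ⟨c, hc, hc'⟩ := he _ hg v
        exact ⟨c, hc.symm, fun c' h' => hc' c' h'.symm⟩)
  have hE : ∀ c, E c = ∑ j, c j • (germ M hg (e j) : GenFib M) := fun c => rfl
  have hcosp : ∀ (y : X) (hy : y ∈ U) (c : Fin r → X.presheaf.stalk y),
      cosp M (generic_specializes y) (∑ j, c j • germ M hy (e j)) = E fun j => toFF y (c j) := by
    intro y hy c
    rw [map_sum, hE]
    refine Finset.sum_congr rfl fun j _ => ?_
    rw [cosp_smul', cosp_germ]
  refine ⟨U, hU, Module.Basis.ofEquivFun E.symm, fun y hy v => ⟨?_, fun h => ?_⟩⟩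
  · rintro ⟨m, rfl⟩ j
    obtain ⟨c, rfl, -⟩ := he y hy m
    rw [hcosp, Module.Basis.ofEquivFun_repr_apply, E.symm_apply_apply]
    exact toFF_mem _
  · choose c hc using h
    refine ⟨∑ j, c j • germ M hy (e j), (hcosp y hy c).trans ?_⟩
    rw [← E.apply_symm_apply v]
    congr 1
    funext j
    refine (hc j).trans ?_
    rw [Module.Basis.ofEquivFun_repr_apply]

/-- Local rings embed in the function field, so the coordinates of a germ in a basis of the stalk
vanish once they vanish generically. -/
theorem section_eq_zero_of_generic {U : X.Opens} {m : Γ(M, U)}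
    (h : ∀ hU : genericPoint X ∈ U, germ M hU m = 0) : m = 0 := by
  refine section_eq_zero fun y hy => ?_
  obtain ⟨V, hV, e, he⟩ := exists_stalk_basis hM y
  obtain ⟨c, hc, -⟩ := he y hV (germ M hy m)
  have h0 : cosp M (generic_specializes y) (germ M hy m) = 0 := (cosp_germ M _ hy m).trans (h _)
  rw [hc, map_sum] at h0
  have hg := generic_mem hV
  have h1 : (0 : GenFib M) = ∑ j, toFF y (c j) • (germ M hg (e j) : GenFib M) := by
    rw [← h0]
    refine Finset.sum_congr rfl fun j _ => ?_
    rw [cosp_smul', cosp_germ]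
  have h2 : (0 : GenFib M) = ∑ j, (0 : Fin r → X.functionField) j • (germ M hg (e j) : GenFib M) := by
    simp
  have h3 := (he _ hg 0).unique h1 h2
  rw [hc]
  refine Finset.sum_eq_zero fun j _ => ?_
  have : toFF y (c j) = 0 := congrFun h3 j
  rw [(map_eq_zero_iff _ (toFF_injective y)).1 this, zero_smul]

end LocallyFree

section LocTwist

variable [IsCurve X] {C : Scheme.{u}} [IsCurve C] (pr : X ⟶ C) [IsDominant pr]

/-- The pole condition only depends on the stalk of the ideal of `D`: functions regular at `pr y`
pull back to functions regular at `y`, and these preserve the lattice. -/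
theorem locTwist_iff (D : EffDiv C) (M : X.Modules) (y : X) (v : GenFib M) :
    LocTwist pr D M y v ↔
      ∀ d ∈ locIdeal D.ideal (pr y), fnMap pr (toFF (pr y) d) • v ∈ lat M y := by
  constructor
  · intro h d hd
    obtain ⟨W, hW⟩ := exists_affine_mem (pr y)
    rw [locIdeal_eq _ W hW] at hd
    refine Submodule.span_induction (p := fun d _ => fnMap pr (toFF (pr y) d) • v ∈ lat M y)
      ?_ ?_ ?_ ?_ hd
    · rintro _ ⟨g, hg, rfl⟩
      obtain ⟨m, hm⟩ := h W hW g hg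
      have e : toFF (pr y) (C.presheaf.germ W.1 (pr y) hW g) = _ := toFF_germ hW g
      change fnMap pr (toFF (pr y) (C.presheaf.germ W.1 (pr y) hW g)) • v ∈ lat M y
      rw [e, ← hm]
      exact cosp_mem_lat M m
    · rw [map_zero, map_zero, zero_smul]
      exact zero_mem _
    · intro a b _ _ ha hb
      rw [map_add, map_add, add_smul]
      exact add_mem ha hb
    · intro a b _ hb
      rw [smul_eq_mul, map_mul, map_mul, mul_smul]
      exact smul_mem_lat ((fnMap_mem_iff pr y _).2 (toFF_mem a)) hb
  · intro h W hW g hg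
    have := h _ (germ_mem_locIdeal D.ideal W hW hg)
    rw [toFF_germ hW g] at this
    exact this

theorem locTwist_iff_of_notMem {D : EffDiv C} {M : X.Modules} {y : X}
    (hy : pr y ∉ D.ideal.support) {v : GenFib M} : LocTwist pr D M y v ↔ v ∈ lat M y := by
  rw [locTwist_iff, (locIdeal_eq_top_iff _ _).2 hy]
  constructor
  · intro h
    simpa using h 1 trivial
  · intro h d _
    exact smul_mem_lat ((fnMap_mem_iff pr y _).2 (toFF_mem d)) h

/-- Sections of a twist are constant functions with values in the generic fibre, so a single value
determines them. -/
theorem eval_cosp_injective (D : EffDiv C) (M : X.Modules) (y : X) :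
    Function.Injective fun v : Stalk (twist pr D M) y =>
      eval pr D M (cosp _ (generic_specializes y) v) := by
  have key : ∀ v : Stalk (twist pr D M) y,
      eval pr D M (cosp _ (generic_specializes y) v) = 0 → v = 0 := by
    intro v hv
    obtain ⟨U, hU, s, rfl⟩ := germ_exists _ v
    have hg := generic_mem hU
    rw [cosp_germ, eval_germ pr D M hg s] at hv
    have : s = 0 := by
      apply Subtype.ext
      funext z
      exact ((show twistSections pr D M U from s).2.1 z ⟨_, hg⟩).trans hv
    rw [this]
    exact map_zero (germ (twist pr D M) hU)
  intro v w h
  refine sub_eq_zero.1 (key _ ?_)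
  rw [map_sub, map_sub]
  exact sub_eq_zero.2 h

theorem twist_section_eq_zero {D : EffDiv C} {M : X.Modules} {U : X.Opens}
    {m : Γ(twist pr D M, U)} (h : ∀ hU : genericPoint X ∈ U, germ (twist pr D M) hU m = 0) :
    m = 0 := by
  apply Subtype.ext
  funext y
  have hg := generic_mem y.2
  have e : (show twistSections pr D M U from m).1 ⟨_, hg⟩ = 0 := by
    rw [← eval_germ pr D M hg, h hg, map_zero]
  exact ((show twistSections pr D M U from m).2.1 _ _).trans e

end LocTwist

end Lattices

/-! ### Poles of homomorphisms of generic fibres -/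

section Bounds

variable {X : Scheme.{u}} [IsCurve X] {M N : X.Modules} {r s : ℕ} (hM : IsLocallyFree M r)
  (hN : IsLocallyFree N s)

include hM in
theorem exists_basis_at (y : X) : ∃ b : Module.Basis (Fin r) X.functionField (GenFib M),
    ∀ v, v ∈ lat M y ↔ ∀ j, b.repr v j ∈ locRing y := by
  obtain ⟨U, hU, b, hb⟩ := exists_lat_basis hM y
  exact ⟨b, hb y hU⟩

include hM hN in
-- Near any point the lattices of `M` and `N` are given by fixed bases. The matrix of `φ` has
-- finitely many entries with finitely many poles each, and quasi-compactness reduces to finitely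
-- many such neighbourhoods.
theorem finite_not_le (φ : GenFib M →ₗ[X.functionField] GenFib N) :
    {y : X | ¬ ∀ v ∈ lat M y, φ v ∈ lat N y}.Finite := by
  have key : ({y : X | ¬ ∀ v ∈ lat M y, φ v ∈ lat N y} ∩ Set.univ).Finite := by
    refine isCompact_univ.induction_on
      (p := fun t => ({y : X | ¬ ∀ v ∈ lat M y, φ v ∈ lat N y} ∩ t).Finite) (by simp)
      (fun t t' h h' => h'.subset (Set.inter_subset_inter_right _ h))
      (fun t t' h h' => by rw [Set.inter_union_distrib_left]; exact h.union h') fun x _ => ?_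
    obtain ⟨U, hU, b, hb⟩ := exists_lat_basis hM x
    obtain ⟨U', hU', b', hb'⟩ := exists_lat_basis hN x
    refine ⟨U ∩ U', mem_nhdsWithin_of_mem_nhds
      ((U ⊓ U').isOpen.mem_nhds (show x ∈ U ⊓ U' from ⟨hU, hU'⟩)), ?_⟩
    refine (Set.finite_iUnion fun j : Fin r => Set.finite_iUnion fun i : Fin s =>
      finite_poles (b'.repr (φ (b j)) i)).subset ?_
    rintro y ⟨hy, hyU, hyU'⟩
    by_contra hn
    simp only [Set.mem_iUnion, not_exists, Set.mem_ofPred_eq, not_not] at hn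
    refine hy fun v hv => ?_
    rw [hb' y hyU']
    intro i
    rw [← b.sum_repr v, map_sum, map_sum, Finsupp.finsetSum_apply]
    refine sum_mem fun j _ => ?_
    rw [map_smul, map_smul, Finsupp.smul_apply, smul_eq_mul]
    exact mul_mem ((hb y hyU v).1 hv j) (hn j i)
  rwa [Set.inter_univ] at key

variable {C : Scheme.{u}} [IsCurve C] (pr : X ⟶ C) [IsDominant pr]

/-- The image in the function field of `X` of an element of a local ring of `C`. -/
abbrev pullFF (y : X) (d : C.presheaf.stalk (pr y)) : X.functionField := fnMap pr (toFF (pr y) d)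

theorem pullFF_mem (y : X) (d : C.presheaf.stalk (pr y)) : pullFF pr y d ∈ locRing y :=
  (fnMap_mem_iff pr y _).2 (toFF_mem d)

include hM in
-- The `a` with `a • v` in the lattice form an ideal, non-zero by clearing denominators. A proper
-- ideal at `pr y` generates a proper ideal at `y`, since the map of local rings is local, and a
-- power of that ideal lies in the first one.
theorem exists_pow_smul_mem (y : X) {J : Ideal (C.presheaf.stalk (pr y))} (hJ : J ≠ ⊤)
    (v : GenFib M) : ∃ n, ∀ d ∈ J ^ n, pullFF pr y d • v ∈ lat M y := by
  let I : Ideal (X.presheaf.stalk y) :=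
    { carrier := {a | toFF y a • v ∈ lat M y}
      zero_mem' := by simp [zero_mem]
      add_mem' := fun {a b} ha hb => by
        simp only [Set.mem_ofPred_eq, map_add, add_smul] at ha hb ⊢
        exact add_mem ha hb
      smul_mem' := fun a b hb => by
        simp only [Set.mem_ofPred_eq, smul_eq_mul, map_mul, mul_smul] at hb ⊢
        exact smul_mem_lat (toFF_mem a) hb }
  have hI : I ≠ ⊥ := by
    obtain ⟨b, hb⟩ := exists_basis_at hM y
    obtain ⟨c, hc⟩ := IsLocalization.exist_integer_multiples
      (nonZeroDivisors (X.presheaf.stalk y)) Finset.univ (fun j => b.repr v j)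
    refine Submodule.ne_bot_iff _ |>.2 ⟨c.1, ?_, nonZeroDivisors.ne_zero c.2⟩
    change toFF y c.1 • v ∈ lat M y
    rw [hb]
    intro j
    obtain ⟨e, he⟩ := hc j (Finset.mem_univ j)
    refine ⟨e, he.trans ?_⟩
    rw [map_smul, Finsupp.smul_apply, smul_eq_mul]
    exact Algebra.smul_def _ _
  have hJ' : J.map (pr.stalkMap y).hom ≠ ⊤ := by
    intro h
    have h1 : J.map (pr.stalkMap y).hom ≤ IsLocalRing.maximalIdeal _ :=
      Ideal.map_le_iff_le_comap.2 fun a ha hu =>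
        IsLocalRing.le_maximalIdeal hJ ha (isUnit_of_map_unit (pr.stalkMap y).hom a hu)
    exact (IsLocalRing.maximalIdeal.isMaximal _).ne_top (top_le_iff.1 (h ▸ h1))
  obtain ⟨n, hn⟩ := exists_pow_mem hI hJ'
  refine ⟨n, fun d hd => ?_⟩
  have : pr.stalkMap y d ∈ I := hn (by
    rw [← Ideal.map_pow]
    exact Ideal.mem_map_of_mem (pr.stalkMap y).hom hd)
  rw [pullFF, fnMap_toFF]
  exact this

include hM hN in
theorem exists_pow_map_mem (φ : GenFib M →ₗ[X.functionField] GenFib N) (y : X)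
    {J : Ideal (C.presheaf.stalk (pr y))} (hJ : J ≠ ⊤) :
    ∃ n, ∀ d ∈ J ^ n, ∀ v ∈ lat M y, pullFF pr y d • φ v ∈ lat N y := by
  obtain ⟨b, hb⟩ := exists_basis_at hM y
  choose n hn using fun j => exists_pow_smul_mem hN pr y hJ (φ (b j))
  refine ⟨Finset.univ.sup n, fun d hd v hv => ?_⟩
  rw [← b.sum_repr v, map_sum, Finset.smul_sum]
  refine sum_mem fun j _ => ?_
  rw [map_smul, smul_comm]
  exact smul_mem_lat ((hb v).1 hv j)
    (hn j d (Ideal.pow_le_pow_right (Finset.le_sup (Finset.mem_univ j)) hd))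

include hM hN in
/-- A homomorphism of generic fibres which is regular away from `Z` becomes regular after
multiplication by a power of the ideal of `Z`. -/
theorem exists_pow_bound (φ : GenFib M →ₗ[X.functionField] GenFib N) (Z : Closeds C)
    (hφ : ∀ y, pr y ∉ Z → ∀ v ∈ lat M y, φ v ∈ lat N y) :
    ∃ n, ∀ m, n ≤ m → ∀ y, ∀ d ∈ locIdeal (Scheme.IdealSheafData.vanishingIdeal Z ^ m) (pr y),
      ∀ v ∈ lat M y, pullFF pr y d • φ v ∈ lat N y := by
  have hfin := finite_not_le hM hN φ
  have hbad : ∀ y ∈ {y : X | ¬ ∀ v ∈ lat M y, φ v ∈ lat N y}, ∃ n,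
      ∀ d ∈ locIdeal (Scheme.IdealSheafData.vanishingIdeal Z) (pr y) ^ n,
        ∀ v ∈ lat M y, pullFF pr y d • φ v ∈ lat N y := by
    intro y hy
    -- A bad point lies over `Z`, so the ideal of `Z` is proper there; the maximum over the finitely
    -- many bad points is a uniform exponent.
    apply exists_pow_map_mem hM hN pr φ y
    intro h
    rw [locIdeal_eq_top_iff] at h
    refine hy (hφ y fun hZ => h ?_)
    exact SetLike.mem_coe.1 (by
      rw [Scheme.IdealSheafData.coe_support_vanishingIdeal]; exact hZ)
  choose! n hn using hbad
  refine ⟨hfin.toFinset.sup n, fun m hm y d hd v hv => ?_⟩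
  rw [locIdeal_pow] at hd
  by_cases hy : ∀ v ∈ lat M y, φ v ∈ lat N y
  · exact smul_mem_lat (pullFF_mem pr y d) (hy v hv)
  · exact hn y hy d (Ideal.pow_le_pow_right
      ((Finset.le_sup (hfin.mem_toFinset.2 hy)).trans hm) hd) v hv

end Bounds

/-! ### The lattices of an abelian `τ`-sheaf and the ideal of `∞` -/

section TauLattices

variable {k L : Type u} [Field k] [Fintype k] [Field L] [Algebra k L] {B : Base k L}

namespace AbelianTauSheaf

variable (F : AbelianTauSheaf B)

theorem exists_basis (i : ℤ) :
    Nonempty (Module.Basis (Fin F.rank) B.K (GenFib (F.obj i))) := by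
  obtain ⟨b, -⟩ := exists_basis_at (F.locallyFree i) (genericPoint B.CL)
  exact ⟨b⟩

theorem Pi_bijective (i : ℤ) :
    Function.Bijective (stalkHom (F.Pi i) (genericPoint B.CL)) := by
  have := F.mono_Pi i
  have hinj := stalkHom_injective (F.Pi i) (genericPoint B.CL)
  obtain ⟨b⟩ := F.exists_basis i
  obtain ⟨b'⟩ := F.exists_basis (i + 1)
  have := Module.Basis.finiteDimensional_of_finite b
  have := Module.Basis.finiteDimensional_of_finite b'
  let g : GenFib (F.obj i) →ₗ[B.K] GenFib (F.obj (i + 1)) := stalkHom (F.Pi i) (genericPoint B.CL)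
  have h : Module.finrank B.K (GenFib (F.obj i)) = Module.finrank B.K (GenFib (F.obj (i + 1))) := by
    rw [Module.finrank_eq_card_basis b, Module.finrank_eq_card_basis b']
  exact ⟨hinj, (LinearMap.injective_iff_surjective_of_finrank_eq_finrank (f := g) h).1 hinj⟩

/-- The isomorphism of generic fibres induced by `Π_i`. -/
def PiEquiv (i : ℤ) : GenFib (F.obj i) ≃ₗ[B.K] GenFib (F.obj (i + 1)) :=
  LinearEquiv.ofBijective (stalkHom (F.Pi i) (genericPoint B.CL)) (F.Pi_bijective i)

/-- The identification of the generic fibre of `F_i` with that of `F_0` by means of the `Π_j`. -/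
def toZero : ∀ i : ℤ, GenFib (F.obj i) ≃ₗ[B.K] GenFib (F.obj 0)
  | .ofNat n => n.rec (LinearEquiv.refl _ _) fun n e => (F.PiEquiv (.ofNat n)).symm.trans e
  | .negSucc n => n.rec (F.PiEquiv (.negSucc 0))
      fun n e => (F.PiEquiv (.negSucc (n + 1))).trans e

theorem toZero_Pi : ∀ (i : ℤ) (v : GenFib (F.obj i)), F.toZero (i + 1) (F.PiEquiv i v) = F.toZero i v
  | .ofNat n, v => by
    change F.toZero (.ofNat n) ((F.PiEquiv (.ofNat n)).symm (F.PiEquiv (.ofNat n) v)) = _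
    rw [LinearEquiv.symm_apply_apply]
  | .negSucc 0, v => rfl
  | .negSucc (n + 1), v => rfl

theorem toZero_Pi' (i : ℤ) (v : GenFib (F.obj i)) :
    F.toZero (i + 1) (stalkHom (F.Pi i) (genericPoint B.CL) v) = F.toZero i v := F.toZero_Pi i v

theorem toZero_eqToHom {i j : ℤ} (h : i = j) (v : GenFib (F.obj i)) :
    F.toZero j (stalkHom (eqToHom (congrArg F.obj h)) (genericPoint B.CL) v) = F.toZero i v := by
  subst h
  congr 1
  obtain ⟨U, hU, m, rfl⟩ := germ_exists _ v
  exact stalkHom_germ _ hU m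

theorem toZero_PiPow (i : ℤ) (l : ℕ) (v : GenFib (F.obj i)) :
    F.toZero (i + l) (stalkHom (F.PiPow i l) (genericPoint B.CL) v) = F.toZero i v := by
  induction l with
  | zero => exact F.toZero_eqToHom (by simp) v
  | succ l ih =>
    have e : stalkHom (F.PiPow i (l + 1)) (genericPoint B.CL) v =
        stalkHom (eqToHom (congrArg F.obj (by push_cast; ring : i + l + 1 = i + ((l + 1 : ℕ) : ℤ))))
          (genericPoint B.CL) (stalkHom (F.Pi (i + l)) (genericPoint B.CL)
            (stalkHom (F.PiPow i l) (genericPoint B.CL) v)) := by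
      rw [← LinearMap.comp_apply, ← stalkHom_comp, ← LinearMap.comp_apply, ← stalkHom_comp]
      simp only [TauData.PiPow]
    rw [e, toZero_eqToHom _ (by push_cast; ring), toZero_Pi', ih]

/-- The lattice at `y` given by `F_i`, inside the generic fibre of `F_0`. -/
def lattice (i : ℤ) (y : B.CL) : AddSubgroup (GenFib (F.obj 0)) :=
  (lat (F.obj i) y).map (F.toZero i).toLinearMap.toAddMonoidHom

theorem mem_lattice {i : ℤ} {y : B.CL} {v : GenFib (F.obj 0)} :
    v ∈ F.lattice i y ↔ (F.toZero i).symm v ∈ lat (F.obj i) y := by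
  constructor
  · rintro ⟨w, hw, rfl⟩
    change (F.toZero i).symm (F.toZero i w) ∈ _
    rwa [LinearEquiv.symm_apply_apply]
  · intro h
    exact ⟨_, h, (F.toZero i).apply_symm_apply v⟩

theorem toZero_mem_lattice {i : ℤ} {y : B.CL} {v : GenFib (F.obj i)} :
    F.toZero i v ∈ F.lattice i y ↔ v ∈ lat (F.obj i) y := by
  rw [mem_lattice, LinearEquiv.symm_apply_apply]

theorem mem_lattice_zero {y : B.CL} {v : GenFib (F.obj 0)} : v ∈ F.lattice 0 y ↔ v ∈ lat (F.obj 0) y :=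
  F.toZero_mem_lattice (i := 0)

theorem smul_mem_lattice {i : ℤ} {y : B.CL} {a : B.K} (ha : a ∈ locRing y) {v : GenFib (F.obj 0)}
    (hv : v ∈ F.lattice i y) : a • v ∈ F.lattice i y := by
  rw [mem_lattice] at hv ⊢
  rw [map_smul]
  exact smul_mem_lat ha hv

/-- The map `Π_i` is defined on stalks and becomes the identity after the identification of generic
fibres. -/
theorem lattice_le_succ (i : ℤ) (y : B.CL) : F.lattice i y ≤ F.lattice (i + 1) y := by
  rintro _ ⟨w, ⟨m, rfl⟩, rfl⟩
  change F.toZero i (cosp (F.obj i) (generic_specializes y) m) ∈ _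
  rw [← toZero_Pi', stalkHom_cosp, toZero_mem_lattice]
  exact cosp_mem_lat _ _

theorem lattice_le_add (i : ℤ) (n : ℕ) (y : B.CL) : F.lattice i y ≤ F.lattice (i + n) y := by
  induction n with
  | zero => simp
  | succ n ih =>
    refine ih.trans ((F.lattice_le_succ _ y).trans (le_of_eq ?_))
    congr 1
    push_cast
    ring

end AbelianTauSheaf

variable (B) in
/-- A generator of the pull back to the local ring at `y` of the ideal of `∞`, as an element of the
function field. -/
def inftyGen (y : B.CL) : B.K :=
  pullFF B.pr y (Submodule.IsPrincipal.generator (locIdeal B.infty.ker (B.pr y)))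

theorem inftyGen_mem (y : B.CL) : inftyGen B y ∈ locRing y := pullFF_mem _ _ _

theorem span_generator (y : B.CL) :
    Ideal.span {Submodule.IsPrincipal.generator (locIdeal B.infty.ker (B.pr y))} =
      locIdeal B.infty.ker (B.pr y) := Ideal.span_singleton_generator _

theorem inftyGen_ne_zero (y : B.CL) : inftyGen B y ≠ 0 := by
  have hg : genericPoint B.C ∉ B.infty.ker.support := fun h =>
    inftyPt_ne_generic B ((mem_support_infty_iff B).1 h)
  have h := locIdeal_ne_bot (EffDiv.ofIdeal B.infty.ker hg) (B.pr y)
  change locIdeal B.infty.ker (B.pr y) ≠ ⊥ at h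
  rw [← span_generator, Ne, Ideal.span_singleton_eq_bot] at h
  rw [inftyGen, pullFF, map_ne_zero, map_ne_zero_iff _ (toFF_injective _)]
  exact h

theorem inftyGen_inv_mem_iff (y : B.CL) : (inftyGen B y)⁻¹ ∈ locRing y ↔ B.pr y ≠ inftyPt B := by
  rw [Ne, ← mem_support_infty_iff, ← locIdeal_eq_top_iff, ← span_generator,
    Ideal.span_singleton_eq_top, isUnit_iff_inv_mem, inftyGen, pullFF, ← map_inv₀, fnMap_mem_iff]
  intro h0
  apply inftyGen_ne_zero (B := B) y
  rw [inftyGen, h0, pullFF, map_zero, map_zero]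

theorem germ_appLE_eq (W : B.C.affineOpens) (U : B.CL.Opens) (h : U ≤ B.pr ⁻¹ᵁ W.1) {y : B.CL}
    (hy : y ∈ U) (g : Γ(B.C, W.1)) :
    (B.CL.presheaf.germ U (genericPoint B.CL) (generic_mem hy) (B.pr.appLE W.1 U h g) : B.K) =
      pullFF B.pr y (B.C.presheaf.germ W.1 (B.pr y) (h hy) g) := by
  have hW : B.pr y ∈ W.1 := h hy
  have e1 : toFF (B.pr y) (B.C.presheaf.germ W.1 (B.pr y) hW g) = _ := toFF_germ hW g
  have e2 := fnMap_germ B.pr W.1 (generic_mem hW) (generic_mem (h hy)) g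
  rw [pullFF, e1]
  refine Eq.trans ?_ e2.symm
  exact B.CL.presheaf.germ_res_apply (homOfLE h) _ (generic_mem hy) (B.pr.app W.1 g)

theorem germ_inftyIdeal (n : ℕ) (W : B.C.affineOpens) (U : B.CL.Opens) (h : U ≤ B.pr ⁻¹ᵁ W.1)
    {y : B.CL} (hy : y ∈ U) {g : Γ(B.CL, U)} (hg : g ∈ inftyIdeal B n W U h) :
    ∃ a ∈ locRing y, (B.CL.presheaf.germ U (genericPoint B.CL) (generic_mem hy) g : B.K) =
      inftyGen B y ^ n * a := by
  have hW : B.pr y ∈ W.1 := h hy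
  refine Submodule.span_induction (p := fun g _ => ∃ a ∈ locRing y,
    (B.CL.presheaf.germ U (genericPoint B.CL) (generic_mem hy) g : B.K) =
      inftyGen B y ^ n * a) ?_ ?_ ?_ ?_ hg
  · rintro _ ⟨g, hg, rfl⟩
    have h1 := germ_mem_locIdeal (B.infty.ker ^ n) W hW hg
    rw [locIdeal_pow, ← span_generator, Ideal.span_singleton_pow, Ideal.mem_span_singleton'] at h1
    obtain ⟨c, hc⟩ := h1
    refine ⟨pullFF B.pr y c, pullFF_mem _ _ _, ?_⟩
    refine (germ_appLE_eq W U h hy g).trans ?_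
    rw [← hc, pullFF, map_mul, map_mul, map_pow, map_pow, mul_comm]
    rfl
  · exact ⟨0, zero_mem _, by rw [map_zero, mul_zero]⟩
  · rintro x y _ _ ⟨a, ha, ea⟩ ⟨b, hb, eb⟩
    exact ⟨a + b, add_mem ha hb, by rw [map_add, ea, eb, mul_add]⟩
  · rintro x y _ ⟨a, ha, ea⟩
    refine ⟨_, mul_mem (germ_mem_locRing hy x) ha, ?_⟩
    rw [smul_eq_mul, map_mul, ea]
    ring

end TauLattices

/-! ### Periodicity and weights in terms of lattices -/

section Periods

variable {k L : Type u} [Field k] [Fintype k] [Field L] [Algebra k L] {B : Base k L}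

theorem exists_affine_le {y : B.CL} {V : B.CL.Opens} (hy : y ∈ V) (W : B.C.affineOpens)
    (hW : B.pr y ∈ W.1) : ∃ U : B.CL.affineOpens, y ∈ U.1 ∧ U.1 ≤ V ∧ U.1 ≤ B.pr ⁻¹ᵁ W.1 := by
  obtain ⟨_, ⟨U, hU, rfl⟩, hyU, hUV⟩ := B.CL.isBasis_affineOpens.exists_subset_of_mem_open
    (show y ∈ V ⊓ B.pr ⁻¹ᵁ W.1 from ⟨hy, hW⟩) (V ⊓ B.pr ⁻¹ᵁ W.1).isOpen
  exact ⟨⟨U, hU⟩, hyU, fun z hz => (hUV hz).1, fun z hz => (hUV hz).2⟩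

namespace AbelianTauSheaf

variable (F : AbelianTauSheaf B)

/-- The periodicity of an abelian `τ`-sheaf in terms of lattices. -/
theorem exists_period : ∃ m l : ℕ, 0 < m ∧ 0 < l ∧ l * F.dim = m * F.rank ∧
    ∀ (i : ℤ) (y : B.CL) (v : GenFib (F.obj 0)),
      v ∈ F.lattice (i + l) y ↔ inftyGen B y ^ m • v ∈ F.lattice i y := by
  obtain ⟨m, l, hm, hl, h, hper⟩ := F.periodic
  refine ⟨m, l, hm, hl, h, fun i y v => ?_⟩
  obtain ⟨W, hW⟩ := exists_affine_mem (B.pr y)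
  obtain ⟨w, rfl⟩ := (F.toZero (i + l)).surjective v
  constructor
  · intro hv
    rw [toZero_mem_lattice] at hv
    obtain ⟨n, rfl⟩ := hv
    obtain ⟨V, hV, s, rfl⟩ := germ_exists _ n
    obtain ⟨U, hU, hUV, hUW⟩ := exists_affine_le hV W hW
    rw [← germ_res _ (homOfLE hUV) hU, cosp_germ]
    set s' : Γ(F.obj (i + l), U.1) := (F.obj (i + l)).presheaf.map (homOfLE hUV).op s with hs'
    -- For a function `g` on `W` vanishing to order `m` at `∞`, the product `g • s'` lies in
    -- `F_{i+l}(-m·∞)`, hence comes from `F_i`. Such `g` generate the stalk of the ideal, which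
    -- contains the `m`-th power of the chosen generator.
    have key : ∀ d ∈ locIdeal (B.infty.ker ^ m) (B.pr y),
        pullFF B.pr y d • F.toZero (i + l) (germ _ (generic_mem hU) s') ∈ F.lattice i y := by
      intro d hd
      rw [locIdeal_eq _ W hW] at hd
      refine Submodule.span_induction (p := fun d _ =>
        pullFF B.pr y d • F.toZero (i + l) (germ _ (generic_mem hU) s') ∈ F.lattice i y)
        ?_ ?_ ?_ ?_ hd
      · rintro _ ⟨g, hg, rfl⟩
        have h1 : B.pr.appLE W.1 U.1 hUW g • s' ∈ (inftyIdeal B m W U.1 hUW • ⊤ :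
            Submodule Γ(B.CL, U.1) Γ(F.obj (i + l), U.1)) :=
          Submodule.smul_mem_smul (Ideal.mem_map_of_mem _ hg) trivial
        obtain ⟨t, ht⟩ := (hper i W U hUW _).2 h1
        have h2 := germ_appLE_eq W U.1 hUW hU g
        have h3 : pullFF B.pr y (B.C.presheaf.germ W.1 (B.pr y) hW g) •
            (germ (F.obj (i + l)) (generic_mem hU) s' : GenFib _) =
              stalkHom (F.PiPow i l) _ (germ (F.obj i) (generic_mem hU) t) := by
          rw [← h2, stalkHom_germ, ht]
          exact (germ_smul' _ (generic_mem hU) _ s').symm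
        change pullFF B.pr y (B.C.presheaf.germ W.1 (B.pr y) hW g) • _ ∈ _
        rw [← map_smul, h3, toZero_PiPow, toZero_mem_lattice]
        exact germ_mem_lat _ hU t
      · rw [pullFF, map_zero, map_zero, zero_smul]
        exact zero_mem _
      · intro a b _ _ ha hb
        rw [pullFF, map_add, map_add, add_smul]
        exact add_mem ha hb
      · intro a b _ hb
        rw [pullFF, smul_eq_mul, map_mul, map_mul, mul_smul]
        exact F.smul_mem_lattice (pullFF_mem _ _ _) hb
    have h4 := key (Submodule.IsPrincipal.generator (locIdeal B.infty.ker (B.pr y)) ^ m) (by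
      rw [locIdeal_pow]
      exact Ideal.pow_mem_pow (Submodule.IsPrincipal.generator_mem _) m)
    rwa [pullFF, map_pow, map_pow] at h4
  · intro hv
    rw [mem_lattice] at hv
    obtain ⟨n, hn⟩ := hv
    obtain ⟨V, hV, s, rfl⟩ := germ_exists _ n
    obtain ⟨U, hU, hUV, hUW⟩ := exists_affine_le hV W hW
    rw [← germ_res _ (homOfLE hUV) hU, cosp_germ] at hn
    set s' : Γ(F.obj i, U.1) := (F.obj i).presheaf.map (homOfLE hUV).op s with hs'
    have h1 := (hper i W U hUW _).1 ⟨s', rfl⟩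
    -- Conversely, sections of `F_{i+l}(-m·∞)` are locally `m`-th powers of the generator times
    -- lattice elements; this power is cancelled below.
    have h2 : ∃ w' ∈ lat (F.obj (i + l)) y,
        (germ _ (generic_mem hU) ((F.PiPow i l).app U.1 s') : GenFib (F.obj (i + l))) =
          inftyGen B y ^ m • w' := by
      refine Submodule.smul_induction_on (p := fun x : Γ(F.obj (i + l), U.1) =>
        ∃ w' ∈ lat (F.obj (i + l)) y, (germ _ (generic_mem hU) x : GenFib (F.obj (i + l))) =
          inftyGen B y ^ m • w') h1 ?_ ?_
      · intro g hg x _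
        obtain ⟨a, ha, e⟩ := germ_inftyIdeal m W U.1 hUW hU hg
        refine ⟨a • (germ _ (generic_mem hU) x : GenFib _),
          smul_mem_lat ha (germ_mem_lat _ hU x), ?_⟩
        rw [smul_smul, ← e]
        exact germ_smul' _ (generic_mem hU) g x
      · rintro x x' ⟨w1, hw1, e1⟩ ⟨w2, hw2, e2⟩
        exact ⟨w1 + w2, add_mem hw1 hw2, by rw [map_add, e1, e2, smul_add]⟩
    obtain ⟨w', hw', e⟩ := h2
    rw [← stalkHom_germ, hn] at e
    have h3 := congrArg (F.toZero (i + l)) e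
    rw [toZero_PiPow, LinearEquiv.apply_symm_apply, map_smul] at h3
    have h4 := smul_right_injective _ (pow_ne_zero m (inftyGen_ne_zero y)) h3
    rw [h4, toZero_mem_lattice]
    exact hw'

theorem period_mul {m l : ℕ} (h : ∀ (i : ℤ) (y : B.CL) (v : GenFib (F.obj 0)),
      v ∈ F.lattice (i + l) y ↔ inftyGen B y ^ m • v ∈ F.lattice i y) (n : ℕ) (i : ℤ) (y : B.CL)
    (v : GenFib (F.obj 0)) :
    v ∈ F.lattice (i + (n * l : ℕ)) y ↔ inftyGen B y ^ (n * m) • v ∈ F.lattice i y := by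
  induction n generalizing v with
  | zero => simp
  | succ n ih =>
    have e : i + ((n + 1) * l : ℕ) = i + (n * l : ℕ) + l := by push_cast; ring
    rw [e, h, ih, smul_smul, add_mul, one_mul, pow_add]

/-- Away from `∞` the generator of its ideal is a unit, so a whole period does not enlarge the
lattice; the increasing chain inside the period is constant. -/
theorem lattice_succ_eq {y : B.CL} (hy : B.pr y ≠ inftyPt B) (i : ℤ) :
    F.lattice (i + 1) y = F.lattice i y := by
  obtain ⟨m, l, hm, hl, -, h⟩ := F.exists_period
  refine le_antisymm (fun v hv => ?_) (F.lattice_le_succ i y)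
  obtain ⟨l', rfl⟩ := Nat.exists_eq_succ_of_ne_zero hl.ne'
  have h1 : v ∈ F.lattice (i + (l' + 1 : ℕ)) y := by
    have := F.lattice_le_add (i + 1) l' y hv
    rwa [add_assoc, add_comm (1 : ℤ), ← Nat.cast_succ] at this
  have h2 := (h i y v).1 h1
  have h3 := F.smul_mem_lattice (pow_mem ((inftyGen_inv_mem_iff y).2 hy) m) h2
  rwa [smul_smul, inv_pow, inv_mul_cancel₀ (pow_ne_zero m (inftyGen_ne_zero y)), one_smul] at h3

theorem lattice_eq_zero {y : B.CL} (hy : B.pr y ≠ inftyPt B) (i : ℤ) :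
    F.lattice i y = F.lattice 0 y := by
  induction i using Int.induction_on with
  | zero => rfl
  | succ n ih => rw [lattice_succ_eq _ hy, ih]
  | pred n ih => rw [← ih, ← F.lattice_succ_eq hy (-(n : ℤ) - 1)]; congr 1; ring

variable {F}
variable {F' : AbelianTauSheaf B}

/-- The homomorphism on the `i`-th generic fibres corresponding to `φ`. -/
def transport (φ : GenFib (F.obj 0) →ₗ[B.K] GenFib (F'.obj 0)) (i : ℤ) :
    GenFib (F.obj i) →ₗ[B.K] GenFib (F'.obj i) :=
  (F'.toZero i).symm.toLinearMap ∘ₗ φ ∘ₗ (F.toZero i).toLinearMap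

theorem toZero_transport (φ : GenFib (F.obj 0) →ₗ[B.K] GenFib (F'.obj 0)) (i : ℤ)
    (v : GenFib (F.obj i)) : F'.toZero i (transport φ i v) = φ (F.toZero i v) :=
  (F'.toZero i).apply_symm_apply _

theorem transport_Pi (φ : GenFib (F.obj 0) →ₗ[B.K] GenFib (F'.obj 0)) (i : ℤ)
    (v : GenFib (F.obj i)) : transport φ (i + 1) (stalkHom (F.Pi i) _ v) =
      stalkHom (F'.Pi i) _ (transport φ i v) := by
  apply (F'.toZero (i + 1)).injective
  rw [toZero_transport, toZero_Pi', toZero_Pi', toZero_transport]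

/-- As the `Π_i` are bijective on generic fibres, a compatible family is determined by its member at
0, by induction in both directions. -/
theorem eq_transport {φ : ∀ i, GenFib (F.obj i) →ₗ[B.K] GenFib (F'.obj i)}
    (h : ∀ i v, φ (i + 1) (stalkHom (F.Pi i) _ v) = stalkHom (F'.Pi i) _ (φ i v)) (i : ℤ) :
    φ i = transport (φ 0) i := by
  have up : ∀ i, φ i = transport (φ 0) i → φ (i + 1) = transport (φ 0) (i + 1) := by
    intro i hi
    ext v
    obtain ⟨w, rfl⟩ := (F.Pi_bijective i).2 v
    rw [h, transport_Pi, hi]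
  have down : ∀ i, φ (i + 1) = transport (φ 0) (i + 1) → φ i = transport (φ 0) i := by
    intro i hi
    ext v
    apply (F'.Pi_bijective i).1
    rw [← h, ← transport_Pi, hi]
  induction i using Int.induction_on with
  | zero =>
    ext v
    rfl
  | succ n ih => exact up _ ih
  | pred n ih =>
    apply down
    have e : -(n : ℤ) - 1 + 1 = -n := by ring
    rw [e]
    exact ih

theorem smul_transport_mem_iff {φ : GenFib (F.obj 0) →ₗ[B.K] GenFib (F'.obj 0)} {i : ℤ} {y : B.CL}
    {a : B.K} :
    (∀ v ∈ lat (F.obj i) y, a • transport φ i v ∈ lat (F'.obj i) y) ↔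
      ∀ v ∈ F.lattice i y, a • φ v ∈ F'.lattice i y := by
  constructor
  · rintro h _ ⟨w, hw, rfl⟩
    have := h w hw
    rw [← toZero_mem_lattice, map_smul, toZero_transport] at this
    exact this
  · intro h v hv
    rw [← toZero_mem_lattice, map_smul, toZero_transport]
    exact h _ (F.toZero_mem_lattice.2 hv)

/-- Since `m / l` and `m' / l'` are the two weights, their equality gives `l' * m = l * m'`: `l'`
periods of `F` and `l` periods of `F'` have the same length and the same exponent. -/
theorem exists_common_period (hw : F.weight = F'.weight) (hr : F.rank ≠ 0) (hr' : F'.rank ≠ 0) :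
    ∃ m l : ℕ, 0 < l ∧
      (∀ (i : ℤ) (y : B.CL) (v : GenFib (F.obj 0)),
        v ∈ F.lattice (i + l) y ↔ inftyGen B y ^ m • v ∈ F.lattice i y) ∧
      ∀ (i : ℤ) (y : B.CL) (v : GenFib (F'.obj 0)),
        v ∈ F'.lattice (i + l) y ↔ inftyGen B y ^ m • v ∈ F'.lattice i y := by
  obtain ⟨m, l, hm, hl, e, h⟩ := F.exists_period
  obtain ⟨m', l', hm', hl', e', h'⟩ := F'.exists_period
  have hml : l' * m = l * m' := by
    rw [weight, weight, div_eq_div_iff (by exact_mod_cast hr) (by exact_mod_cast hr')] at hw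
    have hw' : F.dim * F'.rank = F'.dim * F.rank := by exact_mod_cast hw
    have hp : F.rank * F'.rank ≠ 0 := mul_ne_zero hr hr'
    apply Nat.eq_of_mul_eq_mul_right (Nat.pos_of_ne_zero hp)
    calc l' * m * (F.rank * F'.rank) = l' * F'.rank * (m * F.rank) := by ring
      _ = l * l' * (F.dim * F'.rank) := by rw [← e]; ring
      _ = l * (l' * F'.dim) * F.rank := by rw [hw']; ring
      _ = l * m' * (F.rank * F'.rank) := by rw [e']; ring
  refine ⟨l' * m, l' * l, Nat.mul_pos hl' hl, F.period_mul h l', fun i y v => ?_⟩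
  rw [hml, mul_comm l' l]
  exact F'.period_mul h' l i y v

end AbelianTauSheaf

end Periods

/-! ### Equality of weights and boundedness of poles -/

section Weights

variable {k L : Type u} [Field k] [Fintype k] [Field L] [Algebra k L] {B : Base k L}

/-- The element is divisible by all powers of the non-unit `t`, so it vanishes by Krull's
intersection theorem. -/
theorem eq_zero_of_forall_pow {X : Scheme.{u}} [IsCurve X] {y : X} {t a : X.functionField}
    (ht : t ∈ locRing y) (ht0 : t ≠ 0) (ht' : t⁻¹ ∉ locRing y)
    (h : ∀ n : ℕ, t⁻¹ ^ n * a ∈ locRing y) : a = 0 := by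
  obtain ⟨τ, rfl⟩ := ht
  have hτ0 : τ ≠ 0 := by
    rintro rfl
    exact ht0 (map_zero _)
  have hτ : Ideal.span {τ} ≠ ⊤ := by
    rwa [Ne, Ideal.span_singleton_eq_top, isUnit_iff_inv_mem hτ0]
  obtain ⟨r, hr⟩ := h 0
  rw [pow_zero, one_mul] at hr
  have hmem : r ∈ (⨅ n : ℕ, Ideal.span {τ} ^ n) := by
    refine Ideal.mem_iInf.2 fun n => ?_
    obtain ⟨s, hs⟩ := h n
    rw [Ideal.span_singleton_pow, Ideal.mem_span_singleton']
    refine ⟨s, toFF_injective y ?_⟩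
    rw [map_mul, map_pow, hs, hr, inv_pow, mul_comm, ← mul_assoc, mul_inv_cancel₀
      (pow_ne_zero n ht0), one_mul]
  rw [Ideal.iInf_pow_eq_bot_of_isLocalRing _ hτ, Ideal.mem_bot] at hmem
  rw [← hr, hmem, map_zero]

namespace AbelianTauSheaf

variable {F F' : AbelianTauSheaf B} {φ : GenFib (F.obj 0) →ₗ[B.K] GenFib (F'.obj 0)}

theorem rank_ne_zero (hφ : φ ≠ 0) : F.rank ≠ 0 ∧ F'.rank ≠ 0 := by
  obtain ⟨b⟩ := F.exists_basis 0
  obtain ⟨b'⟩ := F'.exists_basis 0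
  refine ⟨fun h => hφ (b.ext fun j => ?_), fun h => hφ (LinearMap.ext fun v => b'.ext_elem fun j => ?_)⟩
  · exact (Fin.cast h j).elim0
  · exact (Fin.cast h j).elim0

theorem eq_zero_of_forall_lattice {y : B.CL} (h : ∀ v ∈ F.lattice 0 y, φ v = 0) : φ = 0 := by
  obtain ⟨b, hb⟩ := exists_basis_at (F.locallyFree 0) y
  refine b.ext fun j => h _ (F.mem_lattice_zero.2 ((hb _).2 fun i => ?_))
  rw [b.repr_self, Finsupp.single_apply]
  split_ifs
  exacts [one_mem _, zero_mem _]

theorem eq_zero_of_forall_inftyGen {y : B.CL} (hy : B.pr y = inftyPt B) {w : GenFib (F.obj 0)}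
    {c : ℕ} (hc : c ≠ 0) (h : ∀ n : ℕ, (inftyGen B y)⁻¹ ^ (n * c) • w ∈ F.lattice 0 y) : w = 0 := by
  obtain ⟨b, hb⟩ := exists_basis_at (F.locallyFree 0) y
  refine b.ext_elem fun j => ?_
  rw [map_zero]
  refine eq_zero_of_forall_pow (inftyGen_mem y) (inftyGen_ne_zero y)
    (fun h => (inftyGen_inv_mem_iff y).1 h hy) fun n => ?_
  have h1 := (hb _).1 (F.mem_lattice_zero.1 (h n)) j
  rw [map_smul, Finsupp.smul_apply, smul_eq_mul] at h1
  -- Multiplication by the power `n * c'` of the generator leaves exactly `n` negative powers,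
  -- whatever the step `c = c' + 1` was.
  obtain ⟨c', rfl⟩ := Nat.exists_eq_succ_of_ne_zero hc
  have h2 := mul_mem (pow_mem (inftyGen_mem (B := B) y) (n * c')) h1
  rwa [← mul_assoc, Nat.succ_eq_add_one, mul_add, mul_one, pow_add, ← mul_assoc, ← mul_pow,
    mul_inv_cancel₀ (inftyGen_ne_zero y), one_pow, one_mul] at h2

/-- The homomorphism `φ` has poles bounded by `E` on all lattices. -/
def Bounded (E : EffDiv B.C) (φ : GenFib (F.obj 0) →ₗ[B.K] GenFib (F'.obj 0)) : Prop :=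
  ∀ (i : ℤ) (y : B.CL), ∀ d ∈ locIdeal E.ideal (B.pr y), ∀ v ∈ F.lattice i y,
    pullFF B.pr y d • φ v ∈ F'.lattice i y

/-- Between abelian `τ`-sheaves of different weights there are no non-zero homomorphisms. -/
theorem weight_eq_of_bounded {E : EffDiv B.C} (h : Bounded E φ) (hφ : φ ≠ 0) :
    F.weight = F'.weight := by
  obtain ⟨hr, hr'⟩ := rank_ne_zero hφ
  obtain ⟨m, l, hm, hl, e, hF⟩ := F.exists_period
  obtain ⟨m', l', hm', hl', e', hF'⟩ := F'.exists_period
  obtain ⟨y, hy⟩ := pr_surjective B (inftyPt B)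
  obtain ⟨d, hd, hd0⟩ := Submodule.exists_mem_ne_zero_of_ne_bot (locIdeal_ne_bot E (B.pr y))
  set c := pullFF B.pr y d with hc
  have hc0 : c ≠ 0 := by
    rw [hc, pullFF, map_ne_zero, map_ne_zero_iff _ (toFF_injective _)]
    exact hd0
  have ht0 := inftyGen_ne_zero (B := B) y
  set t := inftyGen B y with ht
  -- Boundedness at the indices `n * l' * l` and `-(n * l' * l)`, a common multiple of both periods,
  -- is carried back to index 0. The shift costs the exponent `n * l' * m` on the side of `F` and `n
  -- * l * m'` on that of `F'`.
  have key : ∀ v ∈ F.lattice 0 y, ∀ n : ℕ,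
      t⁻¹ ^ (n * (l' * m)) • t ^ (n * (l * m')) • c • φ v ∈ F'.lattice 0 y ∧
      t ^ (n * (l' * m)) • t⁻¹ ^ (n * (l * m')) • c • φ v ∈ F'.lattice 0 y := by
    intro v hv n
    have hFn : ∀ (i : ℤ) (v : GenFib (F.obj 0)), v ∈ F.lattice (i + (n * (l' * l) : ℕ)) y ↔
        t ^ (n * (l' * m)) • v ∈ F.lattice i y := fun i v => by
      rw [← mul_assoc, ← mul_assoc]; exact F.period_mul hF (n * l') i y v
    have hFn' : ∀ (i : ℤ) (v : GenFib (F'.obj 0)), v ∈ F'.lattice (i + (n * (l' * l) : ℕ)) y ↔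
        t ^ (n * (l * m')) • v ∈ F'.lattice i y := fun i v => by
      rw [mul_comm l' l, ← mul_assoc, ← mul_assoc]; exact F'.period_mul hF' (n * l) i y v
    constructor
    · have h1 : t⁻¹ ^ (n * (l' * m)) • v ∈ F.lattice (0 + (n * (l' * l) : ℕ)) y := by
        rw [hFn, smul_smul, ← mul_pow, mul_inv_cancel₀ ht0, one_pow, one_smul]
        exact hv
      have h2 := (hFn' _ _).1 (h _ y d hd _ h1)
      rw [map_smul] at h2
      rwa [smul_comm (t⁻¹ ^ _), smul_comm (t⁻¹ ^ _)]
    · have e0 : F.lattice (-(n * (l' * l) : ℕ) + (n * (l' * l) : ℕ)) y = F.lattice 0 y := by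
        rw [neg_add_cancel]
      have e1 : F'.lattice (-(n * (l' * l) : ℕ) + (n * (l' * l) : ℕ)) y = F'.lattice 0 y := by
        rw [neg_add_cancel]
      rw [← e0, hFn] at hv
      have h2 := h _ y d hd _ hv
      rw [← e1, hFn', smul_comm (t ^ (n * (l' * m))), smul_smul, ← mul_pow, mul_inv_cancel₀ ht0,
        one_pow, one_smul, smul_comm, ← map_smul]
      exact h2
  -- If the two exponents differ, one of the two families makes `c • φ v` divisible by all powers of
  -- `t`, so `φ` vanishes on a lattice.
  have hml : l' * m = l * m' := by
    by_contra hne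
    apply hφ
    refine eq_zero_of_forall_lattice (y := y) fun v hv => ?_
    have h0 : c • φ v = 0 := by
      rcases Nat.lt_or_gt_of_ne hne with hlt | hlt
      · obtain ⟨x, hx⟩ := Nat.exists_eq_add_of_lt hlt
        refine eq_zero_of_forall_inftyGen hy (c := x + 1) (by omega) fun n => ?_
        have := (key v hv n).2
        rwa [hx, add_assoc, mul_add, pow_add, mul_smul, smul_smul, ← mul_pow, mul_inv_cancel₀ ht0,
          one_pow, one_smul] at this
      · obtain ⟨x, hx⟩ := Nat.exists_eq_add_of_lt hlt
        refine eq_zero_of_forall_inftyGen hy (c := x + 1) (by omega) fun n => ?_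
        have := (key v hv n).1
        rwa [smul_comm, hx, add_assoc, mul_add n (l * m'), pow_add, mul_smul, smul_smul, ← mul_pow,
          mul_inv_cancel₀ ht0, one_pow, one_smul] at this
    exact (smul_eq_zero.1 h0).resolve_left hc0
  rw [weight, weight, div_eq_div_iff (by exact_mod_cast hr) (by exact_mod_cast hr')]
  have : F.dim * F'.rank = F'.dim * F.rank := by
    apply Nat.eq_of_mul_eq_mul_right (Nat.mul_pos hl hl')
    calc F.dim * F'.rank * (l * l') = (l * F.dim) * (F'.rank * l') := by ring
      _ = l' * m * (F.rank * F'.rank) := by rw [e]; ring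
      _ = (l' * F'.dim) * F.rank * l := by rw [hml, e']; ring
      _ = F'.dim * F.rank * (l * l') := by ring
  exact_mod_cast this

/-- A homomorphism of generic fibres between abelian `τ`-sheaves of equal weights which is regular
away from a finite closed set has bounded poles. -/
theorem exists_bounded (hw : φ ≠ 0 → F.weight = F'.weight) {Z : Set B.C} (hZ : Z.Finite)
    (hZ' : IsClosed Z) (h : ∀ y, B.pr y ∉ Z → ∀ v ∈ F.lattice 0 y, φ v ∈ F'.lattice 0 y) :
    ∃ E : EffDiv B.C, Bounded E φ := by
  by_cases hφ : φ = 0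
  · refine ⟨0, fun i y d _ v _ => ?_⟩
    rw [hφ, LinearMap.zero_apply, smul_zero]
    exact zero_mem _
  obtain ⟨hr, hr'⟩ := rank_ne_zero hφ
  obtain ⟨m, l, hl, hF, hF'⟩ := exists_common_period (hw hφ) hr hr'
  -- The point `∞` is added because off `∞` all lattices agree with that of index 0, where
  -- regularity is known.
  let Z' : Closeds B.C := ⟨Z ∪ {inftyPt B}, hZ'.union (isClosed_inftyPt B)⟩
  have hgZ : genericPoint B.C ∉ Z' := generic_notMem B (hZ.union (Set.finite_singleton _)) Z'.isClosed
  have hreg : ∀ (i : ℤ) (y : B.CL), B.pr y ∉ Z' → ∀ v ∈ lat (F.obj i) y,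
      transport φ i v ∈ lat (F'.obj i) y := by
    intro i y hy v hv
    have hy1 : B.pr y ∉ Z := fun hz => hy (Or.inl hz)
    have hy2 : B.pr y ≠ inftyPt B := fun hz => hy (Or.inr hz)
    rw [← one_smul B.K (transport φ i v)]
    refine smul_transport_mem_iff.2 (fun v hv => ?_) v hv
    rw [lattice_eq_zero _ hy2] at hv ⊢
    rw [one_smul]
    exact h y hy1 v hv
  choose n hn using fun i : ℤ => exists_pow_bound (F.locallyFree i) (F'.locallyFree i) B.pr
    (transport φ i) Z' (hreg i)
  -- Exponents for the indices of one period suffice: `φ` commutes with the powers of the generator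
  -- of `∞`, which relate lattices one period apart on both sides.
  let N := (Finset.range l).sup fun j => n j
  let J := Scheme.IdealSheafData.vanishingIdeal Z' ^ N
  have hJ : genericPoint B.C ∉ J.support := by
    intro hg
    rw [← Classical.not_not (a := _ ∈ _), ← locIdeal_eq_top_iff] at hg
    apply hg
    have : locIdeal (Scheme.IdealSheafData.vanishingIdeal Z') (genericPoint B.C) = ⊤ := by
      rw [locIdeal_eq_top_iff]
      intro h0
      rw [← SetLike.mem_coe, Scheme.IdealSheafData.coe_support_vanishingIdeal] at h0
      exact hgZ h0
    rw [locIdeal_pow, this, Ideal.top_pow]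
  refine ⟨EffDiv.ofIdeal J hJ, fun i y d hd => ?_⟩
  change d ∈ locIdeal J (B.pr y) at hd
  set a := pullFF B.pr y d with ha
  have ht0 := inftyGen_ne_zero (B := B) y
  have hstep : ∀ i : ℤ, (∀ v ∈ F.lattice i y, a • φ v ∈ F'.lattice i y) ↔
      ∀ v ∈ F.lattice (i + l) y, a • φ v ∈ F'.lattice (i + l) y := by
    intro i
    constructor
    · intro h v hv
      have := h _ ((hF i y v).1 hv)
      rwa [map_smul, smul_comm, ← hF'] at this
    · intro h v hv
      have h1 : (inftyGen B y ^ m)⁻¹ • v ∈ F.lattice (i + l) y := by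
        rwa [hF, smul_inv_smul₀ (pow_ne_zero m ht0)]
      have h2 := (hF' _ _ _).1 (h _ h1)
      rwa [map_smul, smul_comm a, smul_inv_smul₀ (pow_ne_zero m ht0)] at h2
  have hsmall : ∀ j : ℕ, j < l → ∀ v ∈ F.lattice j y, a • φ v ∈ F'.lattice j y := fun j hj =>
    smul_transport_mem_iff.1 (hn j N (Finset.le_sup (f := fun j : ℕ => n j)
      (Finset.mem_range.2 hj)) y d hd)
  have hall : ∀ (j q : ℤ), (∀ v ∈ F.lattice j y, a • φ v ∈ F'.lattice j y) ↔
      ∀ v ∈ F.lattice (j + l * q) y, a • φ v ∈ F'.lattice (j + l * q) y := by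
    intro j q
    induction q using Int.induction_on with
    | zero => rw [mul_zero, add_zero]
    | succ q ih => rw [ih, hstep, mul_add, mul_one, add_assoc]
    | pred q ih =>
      rw [ih, hstep (j + l * (-q - 1)), show j + l * (-(q : ℤ) - 1) + l = j + l * -q by ring]
  have hl' : (l : ℤ) ≠ 0 := by exact_mod_cast hl.ne'
  obtain ⟨j, hj⟩ := Int.eq_ofNat_of_zero_le (Int.emod_nonneg i hl')
  have hjl : j < l := by
    have := Int.emod_lt_of_pos i (show (0 : ℤ) < l by exact_mod_cast hl)
    omega
  have := (hall j (i / l)).1 (hsmall j hjl)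
  rwa [← hj, Int.emod_add_mul_ediv] at this

end AbelianTauSheaf

end Weights

/-! ### Frobenius-compatible maps are regular off a finite set of `C` -/

section Frobenius

variable {k L : Type u} [Field k] [Fintype k] [Field L] [Algebra k L] {B : Base k L}

namespace AbelianTauSheaf

variable (F : AbelianTauSheaf B)

/-- Off the graph some local function in its ideal is a unit at `y`, and its `d`-th power kills the
cokernel. -/
theorem subsingleton_coker_tau (i : ℤ) {y : B.CL} (hy : y ≠ graphPt B) :
    Subsingleton (Stalk (cokernel (F.tau i)) y) := by
  have hs : y ∉ B.I.support := fun h => hy ((mem_support_I_iff B).1 h)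
  refine subsingleton_of_forall_eq 0 fun v => ?_
  obtain ⟨V, hV, s, rfl⟩ := germ_exists _ v
  obtain ⟨_, ⟨U, hU, rfl⟩, hyU, hUV⟩ := B.CL.isBasis_affineOpens.exists_subset_of_mem_open hV V.isOpen
  have hUV' : U ≤ V := hUV
  let U' : B.CL.affineOpens := ⟨U, hU⟩
  rw [← germ_res _ (homOfLE hUV') hyU]
  obtain ⟨a, ha, hay⟩ : ∃ a ∈ B.I.ideal U', y ∈ B.CL.basicOpen a := by
    by_contra! hn
    exact hs ((B.I.mem_support_iff_of_mem (U := U') hyU).2 ((B.CL.mem_zeroLocus_iff _ _).2 hn))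
  have h1 := F.coker_tau_killed i U' (a ^ F.dim) (Ideal.pow_mem_pow ha F.dim)
    ((cokernel (F.tau i)).presheaf.map (homOfLE hUV').op s)
  have h2 := congrArg (germ (cokernel (F.tau i)) hyU) h1
  rw [germ_smul, map_zero, map_pow] at h2
  have hu : IsUnit (B.CL.presheaf.germ U y hyU a ^ F.dim) :=
    ((B.CL.mem_basicOpen a y hyU).1 hay).pow _
  exact hu.smul_left_cancel.1 (h2.trans (smul_zero _).symm)

theorem semi_mem (i : ℤ) (y : B.CL) {v : GenFib (F.obj i)} (hv : v ∈ lat (F.obj i) (B.σ y)) :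
    semi B (F.tau i) v ∈ lat (F.obj (i + 1)) y := by
  obtain ⟨m, rfl⟩ := hv
  exact ⟨_, (sharpGen_cosp B.σ (adj B (F.tau i)) y m).symm⟩

/-- Off the graph point the stalk of `F_{i+1}` at `y` is generated by the image of the stalk of
`F_i` at `σ y`, hence by the images of a basis of the latter. -/
theorem exists_semi_coords (i : ℤ) {y : B.CL} (hy : y ≠ graphPt B)
    {b : Module.Basis (Fin F.rank) B.K (GenFib (F.obj i))}
    (hb : ∀ v, v ∈ lat (F.obj i) (B.σ y) ↔ ∀ j, b.repr v j ∈ locRing (B.σ y))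
    {v : GenFib (F.obj (i + 1))} (hv : v ∈ lat (F.obj (i + 1)) y) :
    ∃ c : Fin F.rank → B.K, (∀ j, c j ∈ locRing y) ∧ v = ∑ j, c j • semi B (F.tau i) (b j) := by
  obtain ⟨m, rfl⟩ := hv
  have hm : m ∈ Submodule.span (B.CL.presheaf.stalk y) (Set.range (sharp B.σ (adj B (F.tau i)) y)) := by
    rw [span_sharp_eq_top B.σ (F.tau i) y (F.subsingleton_coker_tau i hy)]
    trivial
  refine Submodule.span_induction (p := fun m _ => ∃ c : Fin F.rank → B.K, (∀ j, c j ∈ locRing y) ∧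
    cosp (F.obj (i + 1)) (generic_specializes y) m = ∑ j, c j • semi B (F.tau i) (b j))
    ?_ ?_ ?_ ?_ hm
  · rintro _ ⟨u, rfl⟩
    have hu := (hb _).1 (cosp_mem_lat (F.obj i) u)
    refine ⟨fun j => fnMap B.σ (b.repr (cosp (F.obj i) (generic_specializes (B.σ y)) u) j),
      fun j => (fnMap_mem_iff B.σ y _).2 (hu j), ?_⟩
    refine (sharpGen_cosp B.σ (adj B (F.tau i)) y u).symm.trans ?_
    change semi B (F.tau i) _ = _
    conv_lhs => rw [← b.sum_repr (cosp (F.obj i) (generic_specializes (B.σ y)) u)]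
    rw [map_sum]
    exact Finset.sum_congr rfl fun j _ => LinearMap.map_smulₛₗ _ _ _
  · exact ⟨0, fun j => zero_mem _, by simp⟩
  · rintro x x' _ _ ⟨c, hc, e⟩ ⟨c', hc', e'⟩
    refine ⟨c + c', fun j => add_mem (hc j) (hc' j), ?_⟩
    rw [map_add, e, e', ← Finset.sum_add_distrib]
    exact Finset.sum_congr rfl fun j _ => (add_smul _ _ _).symm
  · rintro a x _ ⟨c, hc, e⟩
    refine ⟨fun j => toFF y a * c j, fun j => mul_mem (toFF_mem a) (hc j), ?_⟩
    rw [cosp_smul', e, Finset.smul_sum]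
    exact Finset.sum_congr rfl fun j _ => smul_smul _ _ _

/-- The images of a basis at `σ y` span, so they form a basis by counting. The coordinates of `w`
are therefore integral at `σ y` exactly when their images under `σ` are integral at `y`. -/
theorem mem_of_semi_mem (i : ℤ) {y : B.CL} (hy : y ≠ graphPt B) {w : GenFib (F.obj i)}
    (hw : semi B (F.tau i) w ∈ lat (F.obj (i + 1)) y) : w ∈ lat (F.obj i) (B.σ y) := by
  obtain ⟨b, hb⟩ := exists_basis_at (F.locallyFree i) (B.σ y)
  obtain ⟨b', hb'⟩ := exists_basis_at (F.locallyFree (i + 1)) y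
  have hspan : (⊤ : Submodule B.K (GenFib (F.obj (i + 1)))) ≤
      Submodule.span B.K (Set.range fun j => semi B (F.tau i) (b j)) := by
    rw [← b'.span_eq, Submodule.span_le]
    rintro _ ⟨j, rfl⟩
    obtain ⟨c, -, e⟩ := F.exists_semi_coords i hy hb (v := b' j) ((hb' _).2 fun t => by
      rw [b'.repr_self, Finsupp.single_apply]
      split_ifs
      exacts [one_mem _, zero_mem _])
    rw [SetLike.mem_coe, e]
    exact Submodule.sum_mem _ fun t _ => Submodule.smul_mem _ _ (Submodule.subset_span ⟨t, rfl⟩)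
  let β := basisOfTopLeSpanOfCardEqFinrank _ hspan (Module.finrank_eq_card_basis b').symm
  have hβ : ∀ j, β j = semi B (F.tau i) (b j) := fun j =>
    congrFun (coe_basisOfTopLeSpanOfCardEqFinrank _ hspan _) j
  obtain ⟨c, hc, e⟩ := F.exists_semi_coords i hy hb hw
  rw [hb]
  intro j
  rw [← fnMap_mem_iff B.σ y]
  have h1 : semi B (F.tau i) w = ∑ j, fnMap B.σ (b.repr w j) • β j := by
    conv_lhs => rw [← b.sum_repr w]
    rw [map_sum]
    refine Finset.sum_congr rfl fun j _ => ?_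
    rw [LinearMap.map_smulₛₗ, hβ]
  have h2 : semi B (F.tau i) w = ∑ j, c j • β j := by
    rw [e]
    exact Finset.sum_congr rfl fun j _ => by rw [hβ]
  have h3 := congrArg (fun v => β.repr v j) (h1.symm.trans h2)
  simp only [β.repr_sum_self] at h3
  rw [h3]
  exact hc j

variable {F} {F' : AbelianTauSheaf B}

theorem semi_Pi (i : ℤ) (v : GenFib (F.obj i)) :
    stalkHom (F.Pi (i + 1)) _ (semi B (F.tau i) v) =
      semi B (F.tau (i + 1)) (stalkHom (F.Pi i) _ v) :=
  semi_square B (F.comm i) v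

/-- The relation at index 0 spreads to all indices, as the `Π_i` commute with the `τ_i` and are
bijective on generic fibres. -/
theorem transport_semi {φ : GenFib (F.obj 0) →ₗ[B.K] GenFib (F'.obj 0)}
    (h : φ ∈ GenHom F.toTauData F'.toTauData) (i : ℤ) (v : GenFib (F.obj i)) :
    transport φ (i + 1) (semi B (F.tau i) v) = semi B (F'.tau i) (transport φ i v) := by
  have h0 : ∀ v, transport φ (0 + 1) (semi B (F.tau 0) v) = semi B (F'.tau 0) (transport φ 0 v) := by
    intro v
    obtain ⟨w, hw⟩ := (F.Pi_bijective 0).2 (semi B (F.tau 0) v)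
    rw [← hw, transport_Pi]
    exact h v w hw
  have up : ∀ i : ℤ, (∀ v, transport φ (i + 1) (semi B (F.tau i) v) =
      semi B (F'.tau i) (transport φ i v)) → ∀ v, transport φ (i + 1 + 1)
        (semi B (F.tau (i + 1)) v) = semi B (F'.tau (i + 1)) (transport φ (i + 1) v) := by
    intro i hi v
    obtain ⟨w, rfl⟩ := (F.Pi_bijective i).2 v
    rw [← semi_Pi, transport_Pi, hi, semi_Pi, transport_Pi]
  have down : ∀ i : ℤ, (∀ v, transport φ (i + 1 + 1)
        (semi B (F.tau (i + 1)) v) = semi B (F'.tau (i + 1)) (transport φ (i + 1) v)) →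
      ∀ v, transport φ (i + 1) (semi B (F.tau i) v) = semi B (F'.tau i) (transport φ i v) := by
    intro i hi v
    apply (F'.Pi_bijective (i + 1)).1
    rw [semi_Pi, ← transport_Pi, ← transport_Pi, semi_Pi, hi]
  revert v
  induction i using Int.induction_on with
  | zero => exact h0
  | succ n ih => exact up _ ih
  | pred n ih =>
    apply down
    have e : -(n : ℤ) - 1 + 1 = -n := by ring
    rw [e]
    exact ih

/-- A homomorphism of generic fibres which is compatible with Frobenius is regular at all points
over the generic point of `C`. -/
theorem regular_of_generic {φ : GenFib (F.obj 0) →ₗ[B.K] GenFib (F'.obj 0)}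
    (h : φ ∈ GenHom F.toTauData F'.toTauData) {y : B.CL} (hy : B.pr y = genericPoint B.C) :
    ∀ v ∈ lat (F.obj 0) y, φ v ∈ lat (F'.obj 0) y := by
  set S : Set B.CL := {y | B.pr y = genericPoint B.C ∧
    ¬ ∀ v ∈ lat (F.obj 0) y, φ v ∈ lat (F'.obj 0) y} with hS
  have hfin : S.Finite := (finite_not_le (F.locallyFree 0) (F'.locallyFree 0) φ).subset fun y h => h.2
  have hgen : genericPoint B.CL ∉ S := fun h => h.2 fun v _ => mem_lat_generic _ _
  have hσg : B.σ (genericPoint B.CL) = genericPoint B.CL := map_generic B.σ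
  -- Points over the generic point of `C` do not lie over `∞`, so there the lattices of index 0 and
  -- 1 coincide; this absorbs the shift made by `τ`.
  have hone : ∀ y, B.pr y = genericPoint B.C →
      ((∀ v ∈ lat (F.obj 0) y, φ v ∈ lat (F'.obj 0) y) ↔
        ∀ v ∈ lat (F.obj (0 + 1)) y, transport φ (0 + 1) v ∈ lat (F'.obj (0 + 1)) y) := by
    intro y hy
    have hy' : B.pr y ≠ inftyPt B := hy ▸ inftyPt_ne_generic B
    have h1 := smul_transport_mem_iff (φ := φ) (i := 0) (y := y) (a := 1)
    have h2 := smul_transport_mem_iff (φ := φ) (i := 0 + 1) (y := y) (a := 1)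
    rw [lattice_eq_zero F hy' (0 + 1), lattice_eq_zero F' hy' (0 + 1), ← h1] at h2
    simp only [one_smul] at h2
    exact h2.symm
  -- Regularity at `σ y` passes to `y`, because the lattice at `y` is generated by Frobenius images
  -- from `σ y`.
  have fwd : ∀ y ∈ S, y ≠ graphPt B → B.σ y ∈ S := by
    rintro y ⟨hy, hbad⟩ hyg
    refine ⟨(pr_σ B y).trans hy, fun hgood => hbad ((hone y hy).2 fun v hv => ?_)⟩
    obtain ⟨b, hb⟩ := exists_basis_at (F.locallyFree 0) (B.σ y)
    obtain ⟨c, hc, rfl⟩ := F.exists_semi_coords 0 hyg hb hv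
    rw [map_sum]
    refine sum_mem fun j _ => ?_
    rw [map_smul, transport_semi h]
    refine smul_mem_lat (hc j) (F'.semi_mem 0 y (hgood _ ((hb _).2 fun t => ?_)))
    rw [b.repr_self, Finsupp.single_apply]
    split_ifs
    exacts [one_mem _, zero_mem _]
  -- Regularity at `y` passes to `σ y`, because Frobenius of `F'` detects membership in the lattice
  -- at `σ y`.
  have bwd : ∀ y, B.σ y ∈ S → y ≠ graphPt B → y ∈ S := by
    rintro y ⟨hy, hbad⟩ hyg
    have hy' : B.pr y = genericPoint B.C := (pr_σ B y).symm.trans hy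
    refine ⟨hy', fun hgood => hbad fun v hv => F'.mem_of_semi_mem 0 hyg ?_⟩
    have h1 := (hone y hy').1 hgood _ (F.semi_mem 0 y hv)
    rw [transport_semi h] at h1
    exact h1
  have nofix : ∀ y, B.pr y = genericPoint B.C → y ≠ genericPoint B.CL →
      ∀ n, n ≠ 0 → B.σ^[n] y ≠ y := fun y hy hy' n hn e =>
    hy' (eq_generic_of_iterate_fixed B hn e hy)
  have infinite : ∀ f : ℕ → B.CL, (∀ n, f n ∈ S) → ∃ a b, a < b ∧ f a = f b := by
    intro f hf
    obtain ⟨a, -, b, -, hne, e⟩ := Set.infinite_univ.exists_ne_map_eq_of_mapsTo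
      (f := f) (t := S) (fun n _ => hf n) hfin
    rcases Nat.lt_or_gt_of_ne hne with h | h
    exacts [⟨a, b, h, e⟩, ⟨b, a, h, e.symm⟩]
  by_contra hbad
  have hyS : y ∈ S := ⟨hy, hbad⟩
  obtain ⟨s, hs⟩ := (σ_surjective B).hasRightInverse
  have hback : ∀ n, B.σ^[n] (s^[n] y) = y := fun n => (hs.iterate n) y
  -- A backward orbit that never meets the graph point stays in the finite set `S`, so it repeats
  -- and yields a periodic point. Hence it reaches the graph point after a positive number of steps.
  obtain ⟨n, hn0, hn⟩ : ∃ n, n ≠ 0 ∧ s^[n] y = graphPt B := by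
    by_contra! hne
    have hall : ∀ n, s^[n] y ∈ S := by
      intro n
      induction n with
      | zero => exact hyS
      | succ n ih =>
        refine bwd _ ?_ (hne (n + 1) n.succ_ne_zero)
        rw [Function.iterate_succ_apply', hs]
        exact ih
    obtain ⟨a, b, hab, e⟩ := infinite _ hall
    obtain ⟨c, rfl⟩ := Nat.exists_eq_add_of_lt hab
    have e1 : B.σ^[c + 1] (s^[a + c + 1] y) = s^[a] y := by
      rw [show a + c + 1 = (c + 1) + a by ring, Function.iterate_add_apply s]
      exact (hs.iterate (c + 1)) _
    rw [e] at e1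
    exact nofix _ (hall _).1 (fun h => hgen (h ▸ hall _)) (c + 1) c.succ_ne_zero e1
  -- In the same way the forward orbit reaches the graph point, possibly with `m = 0`.
  obtain ⟨m, hm⟩ : ∃ m, B.σ^[m] y = graphPt B := by
    by_contra! hne
    have hall : ∀ n, B.σ^[n] y ∈ S := by
      intro n
      induction n with
      | zero => exact hyS
      | succ n ih =>
        rw [Function.iterate_succ_apply']
        exact fwd _ ih (hne n)
    obtain ⟨a, b, hab, e⟩ := infinite _ hall
    obtain ⟨c, rfl⟩ := Nat.exists_eq_add_of_lt hab
    rw [show a + c + 1 = (c + 1) + a by ring, Function.iterate_add_apply] at e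
    exact nofix _ (hall a).1 (fun h => hgen (h ▸ hall _)) (c + 1) c.succ_ne_zero e.symm
  have hgy : B.σ^[n] (graphPt B) = y := hn ▸ hback n
  -- The graph point lies both before and after `y`, so it is periodic with period `m + n > 0`. It
  -- lies over the generic point of `C` as `y` does, and is not generic since `y` is not.
  have hg : B.σ^[m + n] (graphPt B) = graphPt B := by
    rw [Function.iterate_add_apply, hgy, hm]
  have hpr : ∀ n z, B.pr (B.σ^[n] z) = B.pr z := by
    intro n z
    induction n with
    | zero => rfl
    | succ n ih => rw [Function.iterate_succ_apply', pr_σ, ih]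
  refine nofix (graphPt B) ?_ ?_ (m + n) (by omega) hg
  · rw [← hpr n, hgy, hy]
  · intro h0
    rw [h0, Function.iterate_fixed hσg] at hgy
    exact hgen (hgy ▸ hyS)

/-- The images in `C` of the finitely many bad points form a finite set which misses the generic
point, hence a closed one. -/
theorem exists_regular {φ : GenFib (F.obj 0) →ₗ[B.K] GenFib (F'.obj 0)}
    (h : φ ∈ GenHom F.toTauData F'.toTauData) : ∃ Z : Set B.C, Z.Finite ∧ IsClosed Z ∧
      ∀ y, B.pr y ∉ Z → ∀ v ∈ F.lattice 0 y, φ v ∈ F'.lattice 0 y := by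
  have hfin := (finite_not_le (F.locallyFree 0) (F'.locallyFree 0) φ).image B.pr
  refine ⟨_, hfin, isClosed_of_finite hfin ?_, fun y hy v hv => ?_⟩
  · rintro ⟨y, hy, hg⟩
    exact hy (regular_of_generic h hg)
  · rw [mem_lattice_zero] at hv ⊢
    by_contra hn
    exact hy ⟨y, fun h => hn (h v hv), rfl⟩

end AbelianTauSheaf

end Frobenius

/-! ### Twists at the generic point; zeros and poles of a rational function -/

section Generic

variable {X : Scheme.{u}} [IsCurve X] {C : Scheme.{u}} [IsCurve C] (pr : X ⟶ C) [IsDominant pr]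

theorem eval_toTwist (D : EffDiv C) (M : X.Modules) (v : GenFib M) :
    eval pr D M (stalkHom (toTwist pr D M) _ v) = v := congr($(gen_toTwist pr D M) v)

theorem eval_injective (D : EffDiv C) (M : X.Modules) : Function.Injective (eval pr D M) := by
  intro v w h
  have := eval_cosp_injective pr D M (genericPoint X) (a₁ := v) (a₂ := w)
  simp only [cosp_generic] at this
  exact this h

theorem toTwist_eval (D : EffDiv C) (M : X.Modules) (v : GenFib (twist pr D M)) :
    stalkHom (toTwist pr D M) _ (eval pr D M v) = v :=
  eval_injective pr D M (eval_toTwist pr D M _)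

theorem notMem_support_poleDiv {a : C.functionField} {z : C} (ha : a ∈ locRing z) :
    z ∉ (poleDiv a).ideal.support := by
  obtain ⟨W, hz, h, e⟩ := mem_locRing_iff_exists.1 ha
  rw [← locIdeal_eq_top_iff, locIdeal_eq _ W hz, Ideal.eq_top_iff_one]
  have : (1 : Γ(C, W.1)) ∈ (poleDiv a).ideal.ideal W :=
    ⟨h, fun hW => by rw [map_one, one_mul]; exact e.symm⟩
  have h1 := Ideal.mem_map_of_mem (C.presheaf.germ W.1 z hz).hom this
  rwa [map_one] at h1

/-- The set of zeros and poles of a rational function. -/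
def zerosPoles (a : C.functionField) : Set C := {z | a ∉ locRing z} ∪ {z | a⁻¹ ∉ locRing z}

theorem finite_zerosPoles (a : C.functionField) : (zerosPoles a).Finite :=
  (finite_poles a).union (finite_poles a⁻¹)

theorem isClosed_zerosPoles (a : C.functionField) : IsClosed (zerosPoles a) :=
  (isOpen_locRing a).isClosed_compl.union (isOpen_locRing a⁻¹).isClosed_compl

theorem smul_inv_mem_of_notMem_zerosPoles {a : C.functionField} {M : X.Modules} {y : X}
    (hy : pr y ∉ zerosPoles a) {w : GenFib M} (hw : LocTwist pr (poleDiv a) M y w) :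
    fnMap pr a⁻¹ • w ∈ lat M y := by
  have h1 : a ∈ locRing (pr y) := by
    by_contra h
    exact hy (Or.inl h)
  have h2 : a⁻¹ ∈ locRing (pr y) := by
    by_contra h
    exact hy (Or.inr h)
  exact smul_mem_lat ((fnMap_mem_iff pr y _).2 h2)
    ((locTwist_iff_of_notMem pr (notMem_support_poleDiv h1)).1 hw)

end Generic

/-! ### Isogenies on generic fibres and annihilation of their cokernels -/

section Morphisms

variable {k L : Type u} [Field k] [Fintype k] [Field L] [Algebra k L] {B : Base k L}

namespace TauData.Hom

variable {F G : TauData B} {D : EffDiv B.C} (f : Hom F (G.twist D))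

theorem genFib_apply (i : ℤ) (v : GenFib (F.obj i)) :
    f.genFib i v = eval B.pr D _ (stalkHom (f.app i) _ v) := rfl

theorem genFib_Pi (i : ℤ) (v : GenFib (F.obj i)) :
    f.genFib (i + 1) (stalkHom (F.Pi i) _ v) = stalkHom (G.Pi i) _ (f.genFib i v) := by
  rw [genFib_apply, genFib_apply, ← eval_Pi G D i, ← f.gen_Pi]

theorem genFib_tau (i : ℤ) (v : GenFib (F.obj i)) :
    f.genFib (i + 1) (semi B (F.tau i) v) = semi B (G.tau i) (f.genFib i v) := by
  rw [genFib_apply, genFib_apply, ← eval_tau G D i, ← f.gen_tau]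

theorem locTwist_genFib (i : ℤ) {y : B.CL} {v : GenFib (F.obj i)} (hv : v ∈ lat (F.obj i) y) :
    LocTwist B.pr D (G.obj i) y (f.genFib i v) := by
  obtain ⟨m, rfl⟩ := hv
  exact locTwist_gen B.pr (f.app i) m

/-- Both conditions in the definition of an isogeny are visible generically: sections are detected
at the generic point, and the stalks of `G(D)` embed in the generic fibre. The detection of sections
is a hypothesis so that twisted sources are covered as well as locally free ones. -/
theorem isIsogeny_of_genFib
    (hF : ∀ i (U : B.CL.Opens) (m : Γ(F.obj i, U)),
      (∀ hU : genericPoint B.CL ∈ U, germ (F.obj i) hU m = 0) → m = 0)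
    (hf : ∀ i, Function.Injective (f.genFib i)) {Z : Set B.C} (hZ : Z.Finite) (hZ' : IsClosed Z)
    (h : ∀ i (y : B.CL), B.pr y ∉ Z → ∀ w : GenFib (G.obj i), LocTwist B.pr D (G.obj i) y w →
      ∃ v ∈ lat (F.obj i) y, f.genFib i v = w) : f.IsIsogeny := by
  refine ⟨fun i => mono_of_app_injective _ fun U => ?_, Z, hZ, hZ', fun i y hy => ?_⟩
  · refine (injective_iff_map_eq_zero ((f.app i).app U).hom).2 fun m hm => hF i U m fun hU => ?_
    apply hf i
    rw [genFib_apply, stalkHom_germ]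
    refine Eq.trans ?_ (map_zero (f.genFib i)).symm
    refine Eq.trans ?_ (map_zero (eval B.pr D (G.obj i)))
    refine congrArg (eval B.pr D (G.obj i)) ?_
    exact (congrArg (germ _ hU) hm).trans (map_zero _)
  · rw [subsingleton_stalk_cokernel_iff]
    intro n
    obtain ⟨v, ⟨m, rfl⟩, e⟩ := h i y hy _ (locTwist_eval B.pr D (G.obj i) n)
    refine ⟨m, eval_cosp_injective B.pr D (G.obj i) y ?_⟩
    change eval B.pr D (G.obj i) _ = eval B.pr D (G.obj i) _
    rw [← e, genFib_apply, stalkHom_cosp]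

end TauData.Hom

open TauData

variable {F F' : AbelianTauSheaf B} {D : EffDiv B.C} {f : Hom F.toTauData (F'.toTauData.twist D)}

/-- The generic point of `C_L` lies over that of `C`, which is not in the finite closed set `Z`, so
the cokernel vanishes there. -/
theorem stalkHom_bijective (hf : f.IsIsogeny) (i : ℤ) :
    Function.Bijective (stalkHom (f.app i) (genericPoint B.CL)) := by
  obtain ⟨hm, Z, hZ, hZ', h⟩ := hf
  have := hm i
  refine ⟨stalkHom_injective _ _, (subsingleton_stalk_cokernel_iff _ _).1 (h i _ ?_)⟩
  rw [map_generic]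
  exact generic_notMem B hZ hZ'

/-- The isomorphism of generic fibres induced by an isogeny `F ⟶ G(D)`. -/
def stalkEquiv (hf : f.IsIsogeny) (i : ℤ) :
    GenFib (F.obj i) ≃ₗ[B.K] GenFib (twist B.pr D (F'.obj i)) :=
  LinearEquiv.ofBijective (stalkHom (f.app i) (genericPoint B.CL)) (stalkHom_bijective hf i)

theorem genFib_bijective (hf : f.IsIsogeny) (i : ℤ) : Function.Bijective (f.genFib i) :=
  Function.Bijective.comp (g := eval B.pr D (F'.obj i))
    ⟨eval_injective _ _ _, fun w => ⟨_, eval_toTwist B.pr D _ w⟩⟩ (stalkHom_bijective hf i)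

theorem genFib_eq_transport (f : Hom F.toTauData (F'.toTauData.twist D)) (i : ℤ) :
    f.genFib i = AbelianTauSheaf.transport (f.genFib 0) i :=
  AbelianTauSheaf.eq_transport f.genFib_Pi i

theorem bounded_genFib (f : Hom F.toTauData (F'.toTauData.twist D)) :
    AbelianTauSheaf.Bounded D (f.genFib 0) := by
  intro i y d hd
  rw [← AbelianTauSheaf.smul_transport_mem_iff]
  intro v hv
  rw [← genFib_eq_transport]
  exact (locTwist_iff B.pr D _ y _).1 (f.locTwist_genFib i hv) d hd

theorem inverse_mem_lat {i : ℤ} {y : B.CL} (hc : Subsingleton (Stalk (cokernel (f.app i)) y))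
    {w : GenFib (F'.obj i)} (hw : w ∈ lat (F'.obj i) y) :
    ∃ v ∈ lat (F.obj i) y, f.genFib i v = w := by
  obtain ⟨n, rfl⟩ := hw
  obtain ⟨u, hu⟩ := (subsingleton_stalk_cokernel_iff _ _).1 hc (stalkHom (toTwist B.pr D (F'.obj i)) y n)
  refine ⟨_, cosp_mem_lat _ u, ?_⟩
  rw [Hom.genFib_apply, stalkHom_cosp, hu]
  refine (congrArg (eval B.pr D (F'.obj i)) (stalkHom_cosp (toTwist B.pr D (F'.obj i)) n).symm).trans ?_
  exact eval_toTwist _ _ _ _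

/-- The cokernels of an isogeny are annihilated by a non-zero rational function. -/
theorem exists_annihilates (hf : f.IsIsogeny) : ∃ a : B.Q, a ≠ 0 ∧ Annihilates a f := by
  let φ : GenFib (F.obj 0) ≃ₗ[B.K] GenFib (F'.obj 0) :=
    LinearEquiv.ofBijective (f.genFib 0) (genFib_bijective hf 0)
  obtain ⟨Z, hZ, hZ', hc⟩ := hf.2
  have hφψ : ∀ i v, AbelianTauSheaf.transport φ.symm.toLinearMap i (f.genFib i v) = v := by
    intro i v
    rw [genFib_eq_transport]
    apply (F.toZero i).injective
    rw [AbelianTauSheaf.toZero_transport, AbelianTauSheaf.toZero_transport]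
    exact φ.symm_apply_apply _
  have hψφ : ∀ i w, f.genFib i (AbelianTauSheaf.transport φ.symm.toLinearMap i w) = w := by
    intro i w
    obtain ⟨v, rfl⟩ := (genFib_bijective hf i).2 w
    rw [hφψ]
  -- Bounding the inverse requires equal weights; the isogeny itself, being bounded by `D`, forces
  -- them unless it is zero.
  have hw : φ.symm.toLinearMap ≠ 0 → F'.weight = F.weight := by
    intro hne
    refine (AbelianTauSheaf.weight_eq_of_bounded (bounded_genFib f) fun h0 => hne ?_).symm
    ext w
    obtain ⟨v, rfl⟩ := φ.surjective w
    have : φ v = 0 := congr($h0 v)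
    rw [this, map_zero, map_zero]
  obtain ⟨E, hE⟩ := AbelianTauSheaf.exists_bounded hw hZ hZ' fun y hy w hw => by
    obtain ⟨v, hv, rfl⟩ := inverse_mem_lat (f := f) (hc 0 y hy) (F'.mem_lattice_zero.1 hw)
    rw [F.mem_lattice_zero]
    change φ.symm (φ v) ∈ _
    rwa [φ.symm_apply_apply]
  -- `D` makes up for the twist of the source and `E` for the poles of the inverse.
  obtain ⟨a, ha0, ha⟩ := exists_vanishing (D + E)
  refine ⟨a, ha0, fun i => ?_⟩
  let ψ : GenFib (F'.obj i) →ₗ[B.K] GenFib (F.obj i) :=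
    AbelianTauSheaf.transport φ.symm.toLinearMap i
  have hloc : ∀ (y : B.CL) (v : Stalk (twist B.pr D (F'.obj i)) y), LocTwist B.pr (poleDiv a)
      (F.obj i) y ((fnMap B.pr a • ψ ∘ₗ eval B.pr D (F'.obj i))
        (cosp (twist B.pr D (F'.obj i)) (generic_specializes y) v)) := by
    intro y v W hW g hg
    obtain ⟨h, e⟩ := hg
    have hw := (locTwist_iff B.pr D _ y _).1 (locTwist_eval B.pr D (F'.obj i) v)
    set w := eval B.pr D (F'.obj i) (cosp _ (generic_specializes y) v) with hw_def
    -- Here `h = g * a` is regular. On the support of `D + E` it inherits the vanishing of `a`;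
    -- elsewhere the ideal is the unit ideal.
    have hmem : B.C.presheaf.germ W.1 (B.pr y) hW h ∈ locIdeal (D + E).ideal (B.pr y) := by
      by_cases hs : B.pr y ∈ (D + E).ideal.support
      · obtain ⟨r, hr, hra⟩ := ha _ hs
        have : B.C.presheaf.germ W.1 (B.pr y) hW h = B.C.presheaf.germ W.1 (B.pr y) hW g * r := by
          apply toFF_injective
          rw [map_mul, toFF_germ hW, toFF_germ hW, hra]
          exact (e _).symm
        rw [this]
        exact Ideal.mul_mem_left _ _ hr
      · rw [(locIdeal_eq_top_iff _ _).2 hs]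
        trivial
    have key : ∀ r ∈ locIdeal (D + E).ideal (B.pr y), pullFF B.pr y r • ψ w ∈ lat (F.obj i) y := by
      intro r hr
      have hr : r ∈ locIdeal (D.ideal * E.ideal) (B.pr y) := hr
      rw [locIdeal_mul] at hr
      refine Submodule.mul_induction_on hr (fun d hd e he => ?_) fun r s hr hs => ?_
      · have := AbelianTauSheaf.smul_transport_mem_iff.2 (hE i y e he) _ (hw d hd)
        rwa [map_smul, smul_smul, mul_comm, ← map_mul, ← map_mul] at this
      · rw [pullFF, map_add, map_add, add_smul]
        exact add_mem hr hs
    have := key _ hmem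
    rw [pullFF, toFF_germ hW, ← e (generic_mem hW), map_mul, mul_smul] at this
    exact this
  -- Multiplication by `a` factors as `f ⊗ id` after `a · f⁻¹`, so it vanishes on the cokernel.
  have hfac : (Hom.mulPole a (F'.toTauData.twist D)).app i =
      ofGen B.pr (fnMap B.pr a • ψ ∘ₗ eval B.pr D (F'.obj i)) hloc ≫
        (Hom.twistMap (poleDiv a) f).app i := by
    apply gen_injective B.pr
    ext v
    have h1 := congr($(gen_comp B.pr (ofGen B.pr _ hloc) ((Hom.twistMap (poleDiv a) f).app i)) v)
    have h2 := congr($(gen_twistMap B.pr (poleDiv a) (f.app i))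
      (stalkHom (ofGen B.pr _ hloc) (genericPoint B.CL) v))
    have h3 := congr($(gen_ofGen B.pr _ hloc) v)
    have h4 := congr($(gen_mulPole B.pr a (twist B.pr D (F'.obj i))) v)
    refine h4.trans (Eq.trans ?_ (h1.trans h2).symm)
    refine Eq.trans ?_ (congrArg (stalkHom (f.app i) (genericPoint B.CL)) h3).symm
    apply eval_injective B.pr D (F'.obj i)
    change eval B.pr D (F'.obj i) (fnMap B.pr a • v) =
      f.genFib i (fnMap B.pr a • ψ (eval B.pr D (F'.obj i) v))
    rw [map_smul, map_smul, hψφ]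
  rw [hfac, Category.assoc, cokernel.condition, comp_zero]

end Morphisms

/-! ### The dual isogeny -/

section Duals

variable {k L : Type u} [Field k] [Fintype k] [Field L] [Algebra k L] {B : Base k L}

open TauData

variable {F F' : AbelianTauSheaf B} {D : EffDiv B.C} {f : Hom F.toTauData (F'.toTauData.twist D)}
  {a : B.Q}

/-- Annihilation says that, stalk by stalk, `a · w` is a value of `f ⊗ id`. By injectivity its
preimage is `a · f⁻¹ w`, which thus belongs to the stalk of `F((a)_∞)`. -/
theorem smul_stalkEquiv_symm_locTwist (hf : f.IsIsogeny) (ha : Annihilates a f) (i : ℤ) (y : B.CL)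
    (v : Stalk (twist B.pr D (F'.obj i)) y) : LocTwist B.pr (poleDiv a) (F.obj i) y
      ((fnMap B.pr a • (stalkEquiv hf i).symm.toLinearMap)
        (cosp (twist B.pr D (F'.obj i)) (generic_specializes y) v)) := by
  obtain ⟨u, hu⟩ := range_le_of_comp_cokernel _ _ (ha i) y ⟨v, rfl⟩
  set w := cosp (twist B.pr D (F'.obj i)) (generic_specializes y) v with hw
  have h1 := congrArg (cosp _ (generic_specializes y)) hu
  rw [← stalkHom_cosp, ← stalkHom_cosp] at h1
  have h2 := congrArg (eval B.pr (poleDiv a) _) h1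
  have h3 := congr($(gen_mulPole B.pr a (twist B.pr D (F'.obj i))) w)
  have h4 := congr($(gen_twistMap B.pr (poleDiv a) (f.app i)) (cosp _ (generic_specializes y) u))
  have h5 : stalkHom (f.app i) _ (eval B.pr (poleDiv a) (F.obj i) (cosp _ (generic_specializes y) u)) =
      fnMap B.pr a • w := h4.symm.trans (h2.trans h3)
  have h6 : (fnMap B.pr a • (stalkEquiv hf i).symm.toLinearMap) w =
      eval B.pr (poleDiv a) (F.obj i) (cosp _ (generic_specializes y) u) := by
    apply (stalkEquiv hf i).injective
    refine Eq.trans ?_ h5.symm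
    change (stalkEquiv hf i) (fnMap B.pr a • (stalkEquiv hf i).symm w) = _
    rw [map_smul, LinearEquiv.apply_symm_apply]
  rw [h6]
  exact locTwist_eval B.pr (poleDiv a) (F.obj i) u

/-- Since `f` is bijective on generic fibres, the relation `f ∘ g = a` there implies `g ∘ f = a`. It
also determines `g`, whence the uniqueness of the dual. -/
theorem isDual_iff (hf : f.IsIsogeny)
    {g : Hom (F'.toTauData.twist D) (F.toTauData.twist (poleDiv a))} :
    IsDual a f g ↔ ∀ i v, stalkHom (f.app i) _ (g.genFib i v) = fnMap B.pr a • v := by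
  have e1 : ∀ i v, (g.comp (Hom.twistMap (poleDiv a) f)).genFib i v =
      stalkHom (f.app i) _ (g.genFib i v) := fun i v =>
    (congr($(Hom.genFib_comp g (Hom.twistMap (poleDiv a) f) i) v)).trans
      congr($(Hom.genFib_twistMap (poleDiv a) f i) (stalkHom (g.app i) _ v))
  have e2 : ∀ i v, (f.comp g).genFib i v = g.genFib i (stalkHom (f.app i) _ v) := fun i v =>
    congr($(Hom.genFib_comp f g i) v)
  constructor
  · rintro ⟨-, h⟩ i v
    have h1 := congr(Hom.genFib $h i v)
    exact (e1 i v).symm.trans (h1.trans congr($(Hom.genFib_mulPole a (F'.toTauData.twist D) i) v))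
  · intro h
    refine ⟨Hom.genFib_ext fun i => LinearMap.ext fun v => ?_,
      Hom.genFib_ext fun i => LinearMap.ext fun v => ?_⟩
    · refine (e2 i v).trans (Eq.trans ?_ congr($(Hom.genFib_mulPole a F.toTauData i) v).symm)
      apply (stalkEquiv hf i).injective
      refine (h i _).trans ?_
      exact (map_smul (stalkHom (f.app i) (genericPoint B.CL)) (fnMap B.pr a) v).symm
    · exact (e1 i v).trans ((h i v).trans
        congr($(Hom.genFib_mulPole a (F'.toTauData.twist D) i) v).symm)

/-- Every isogeny whose cokernels are annihilated by `a` has a unique dual with respect to `a`. -/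
theorem existsUnique_isDual (hf : f.IsIsogeny) (ha : Annihilates a f) : ∃! g, IsDual a f g := by
  let S := stalkEquiv hf
  have hS : ∀ i (v : GenFib (twist B.pr D (F'.obj i))),
      stalkHom (f.app i) _ ((fnMap B.pr a • (S i).symm.toLinearMap) v) = fnMap B.pr a • v := by
    intro i v
    change S i (fnMap B.pr a • (S i).symm v) = _
    rw [map_smul, LinearEquiv.apply_symm_apply]
  let g : Hom (F'.toTauData.twist D) (F.toTauData.twist (poleDiv a)) :=
    Hom.ofGen (fun i => ofGen B.pr _ (smul_stalkEquiv_symm_locTwist hf ha i))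
      (fun i => fnMap B.pr a • (S i).symm.toLinearMap) (fun i => gen_ofGen _ _ _)
      (fun i v => by
        apply (S (i + 1)).injective
        refine (hS _ _).trans (Eq.trans ?_ (f.gen_Pi i _).symm)
        refine Eq.trans ?_ (congrArg (stalkHom ((F'.toTauData.twist D).Pi i) _) (hS i v)).symm
        exact (map_smul (stalkHom ((F'.toTauData.twist D).Pi i) (genericPoint B.CL)) _ _).symm)
      (fun i v => by
        apply (S (i + 1)).injective
        refine (hS _ _).trans (Eq.trans ?_ (f.gen_tau i _).symm)
        refine Eq.trans ?_ (congrArg (semi B ((F'.toTauData.twist D).tau i)) (hS i v)).symm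
        rw [LinearMap.map_smulₛₗ, fnMap_comp B.σ B.pr B.σ_pr])
  have hgen : ∀ i v, g.genFib i v = (fnMap B.pr a • (S i).symm.toLinearMap) v := fun i v =>
    congr($(gen_ofGen B.pr _ (smul_stalkEquiv_symm_locTwist hf ha i)) v)
  refine ⟨g, (isDual_iff hf).2 fun i v => ?_, fun g' hg' => Hom.genFib_ext fun i =>
    LinearMap.ext fun v => ?_⟩
  · exact (congrArg (stalkHom (f.app i) _) (hgen i v)).trans (hS i v)
  · apply (S i).injective
    refine ((isDual_iff hf).1 hg' i v).trans ((hS i v).symm.trans ?_)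
    exact (congrArg (stalkHom (f.app i) _) (hgen i v)).symm

variable {g : Hom (F'.toTauData.twist D) (F.toTauData.twist (poleDiv a))}

theorem IsDual.genFib_stalkHom (hg : IsDual a f g) (i : ℤ) (v : GenFib (F.obj i)) :
    g.genFib i (stalkHom (f.app i) _ v) = fnMap B.pr a • v :=
  (congr($(Hom.genFib_comp f g i) v)).symm.trans
    ((congr(Hom.genFib $(hg.1) i v)).trans congr($(Hom.genFib_mulPole a F.toTauData i) v))

theorem fnMap_ne_zero (ha : a ≠ 0) : fnMap B.pr a ≠ 0 :=
  (map_ne_zero (fnMap B.pr)).2 ha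

theorem IsDual.genFib_injective (hf : f.IsIsogeny) (ha : a ≠ 0) (hg : IsDual a f g) (i : ℤ) :
    Function.Injective (g.genFib i) := by
  intro v w h
  have := congrArg (stalkHom (f.app i) (genericPoint B.CL)) h
  rw [(isDual_iff hf).1 hg, (isDual_iff hf).1 hg] at this
  exact smul_right_injective _ (fnMap_ne_zero ha) this

theorem IsDual.genFib_stalkHom_inv_smul (ha : a ≠ 0) (hg : IsDual a f g) (i : ℤ)
    (w : GenFib (F.obj i)) : g.genFib i (stalkHom (f.app i) _ (fnMap B.pr a⁻¹ • w)) = w := by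
  rw [hg.genFib_stalkHom, smul_smul, ← map_mul, mul_inv_cancel₀ ha, map_one, one_smul]

theorem stalkHom_mem_lat {M N : B.CL.Modules} (f : M ⟶ N) {y : B.CL} {v : GenFib M}
    (hv : v ∈ lat M y) : stalkHom f _ v ∈ lat N y := by
  obtain ⟨m, rfl⟩ := hv
  rw [stalkHom_cosp]
  exact cosp_mem_lat _ _

/-- Off the zeros and poles of `a` the twist by `(a)_∞` is trivial and `a⁻¹` is regular, so `f (a⁻¹
w)` is a local preimage of `w`. -/
theorem IsDual.isIsogeny (hf : f.IsIsogeny) (ha : a ≠ 0) (hg : IsDual a f g) : g.IsIsogeny :=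
  g.isIsogeny_of_genFib (fun _ _ _ h => twist_section_eq_zero B.pr h)
    (hg.genFib_injective hf ha) (finite_zerosPoles a) (isClosed_zerosPoles a)
    fun i _ hy w hw => ⟨_, stalkHom_mem_lat (f.app i)
      (smul_inv_mem_of_notMem_zerosPoles B.pr hy hw), hg.genFib_stalkHom_inv_smul ha i w⟩

theorem finite_support (D : EffDiv B.C) : (D.ideal.support : Set B.C).Finite :=
  finite_of_isClosed D.ideal.support.isClosed (generic_notMem_support D)

theorem gen_dualClass {E : EffDiv B.C} {F G : TauData B} (g : Hom (G.twist D) (F.twist E)) (i : ℤ)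
    (v : GenFib (G.obj i)) :
    (dualClass g).gen i v = g.genFib i (stalkHom ((Hom.toTwist G D).app i) _ v) :=
  congr($(Hom.genFib_comp (Hom.toTwist G D) g i) v)

theorem stalkHom_toTwist_genFib (i : ℤ) (v : GenFib (F.obj i)) :
    stalkHom ((Hom.toTwist F'.toTauData D).app i) _ (f.genFib i v) = stalkHom (f.app i) _ v :=
  toTwist_eval B.pr D _ _

/-- The exceptional set of the dual is enlarged by the support of `D`, off which `F'` and `F'(D)`
have the same stalks. -/
theorem IsDual.dualClass_mem (hf : f.IsIsogeny) (ha : a ≠ 0) (hg : IsDual a f g) :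
    dualClass g ∈ QHom.QIsog F'.toTauData F.toTauData := by
  refine ⟨poleDiv a, (Hom.toTwist F'.toTauData D).comp g, ?_, rfl⟩
  have e : ∀ i v, ((Hom.toTwist F'.toTauData D).comp g).genFib i v =
      g.genFib i (stalkHom ((Hom.toTwist F'.toTauData D).app i) _ v) := gen_dualClass g
  refine Hom.isIsogeny_of_genFib _
    (fun i _ _ h => section_eq_zero_of_generic (F'.locallyFree i) h) (fun i v w h => ?_)
    ((finite_zerosPoles a).union (finite_support D))
    ((isClosed_zerosPoles a).union D.ideal.support.isClosed) (fun i y hy w hw => ?_)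
  · rw [e, e] at h
    have h1 := hg.genFib_injective hf ha i h
    have h2 := congrArg (eval B.pr D (F'.obj i)) h1
    exact (eval_toTwist B.pr D _ v).symm.trans (h2.trans (eval_toTwist B.pr D _ w))
  · rw [Set.mem_union, not_or] at hy
    refine ⟨f.genFib i (fnMap B.pr a⁻¹ • w), (locTwist_iff_of_notMem B.pr hy.2).1
      (f.locTwist_genFib i (smul_inv_mem_of_notMem_zerosPoles B.pr hy.1 hw)), ?_⟩
    rw [e, stalkHom_toTwist_genFib, hg.genFib_stalkHom_inv_smul ha]

theorem IsDual.inv_smul_comp (ha : a ≠ 0) (hg : IsDual a f g) :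
    (a⁻¹ • dualClass g).comp (QHom.mk f) = QHom.id F.toTauData := by
  refine QHom.ext' fun i v => ?_
  rw [QHom.gen_comp, QHom.gen_smul, QHom.gen_id]
  change fnMap B.pr a⁻¹ • (dualClass g).gen i (f.genFib i v) = v
  rw [gen_dualClass, stalkHom_toTwist_genFib, hg.genFib_stalkHom, smul_smul, ← map_mul,
    inv_mul_cancel₀ ha, map_one, one_smul]

theorem IsDual.comp_inv_smul (hf : f.IsIsogeny) (ha : a ≠ 0) (hg : IsDual a f g) :
    (QHom.mk f).comp (a⁻¹ • dualClass g) = QHom.id F'.toTauData := by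
  refine QHom.ext' fun i v => ?_
  rw [QHom.gen_comp, QHom.gen_smul, QHom.gen_id]
  change f.genFib i (fnMap B.pr a⁻¹ • (dualClass g).gen i v) = v
  rw [map_smul, gen_dualClass, Hom.genFib_apply, (isDual_iff hf).1 hg, map_smul, smul_smul,
    ← map_mul, inv_mul_cancel₀ ha, map_one, one_smul]
  exact eval_toTwist B.pr D _ v

end Duals

/-! ### Quasi-isogenies and units -/

section Units

variable {k L : Type u} [Field k] [Fintype k] [Field L] [Algebra k L] {B : Base k L}

open TauData

/-- Off the supports of `D` and `E` both maps preserve the lattices, and they are inverse to each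
other, so the cokernels vanish there. -/
theorem isIsogeny_of_inverse {F F' : AbelianTauSheaf B} {D E : EffDiv B.C}
    {f : Hom F.toTauData (F'.toTauData.twist D)} {g : Hom F'.toTauData (F.toTauData.twist E)}
    (h : (QHom.mk g).comp (QHom.mk f) = QHom.id F.toTauData)
    (h' : (QHom.mk f).comp (QHom.mk g) = QHom.id F'.toTauData) : f.IsIsogeny := by
  have e : ∀ i v, g.genFib i (f.genFib i v) = v := fun i v =>
    congr($(QHom.gen_comp (QHom.mk g) (QHom.mk f) i) v).symm.trans
      ((congr(QHom.gen $h i v)).trans congr($(QHom.gen_id i) v))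
  have e' : ∀ i v, f.genFib i (g.genFib i v) = v := fun i v =>
    congr($(QHom.gen_comp (QHom.mk f) (QHom.mk g) i) v).symm.trans
      ((congr(QHom.gen $h' i v)).trans congr($(QHom.gen_id i) v))
  refine f.isIsogeny_of_genFib
    (fun i _ _ h => section_eq_zero_of_generic (F.locallyFree i) h)
    (fun i => Function.LeftInverse.injective (e i))
    ((finite_support D).union (finite_support E))
    (D.ideal.support.isClosed.union E.ideal.support.isClosed) (fun i y hy w hw => ?_)
  rw [Set.mem_union, not_or] at hy
  exact ⟨g.genFib i w, (locTwist_iff_of_notMem B.pr hy.2).1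
    (g.locTwist_genFib i ((locTwist_iff_of_notMem B.pr hy.1).1 hw)), e' i w⟩

/-- Quasi-isogenies are the units of the algebra of quasi-endomorphisms. -/
theorem qIsog_eq_units (F : AbelianTauSheaf B) :
    QHom.QIsog F.toTauData F.toTauData = {x : QEnd F.toTauData | IsUnit x} := by
  ext x
  constructor
  · rintro ⟨D, f, hf, rfl⟩
    obtain ⟨a, ha0, ha⟩ := exists_annihilates hf
    obtain ⟨g, hg, -⟩ := existsUnique_isDual hf ha
    exact ⟨⟨QHom.mk f, a⁻¹ • dualClass g, hg.comp_inv_smul hf ha0, hg.inv_smul_comp ha0⟩, rfl⟩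
  · rintro ⟨⟨x, y, hxy, hyx⟩, rfl⟩
    obtain ⟨⟨D, f⟩⟩ := x
    obtain ⟨⟨E, g⟩⟩ := y
    exact ⟨D, f, isIsogeny_of_inverse hyx hxy, rfl⟩

end Units

/-! ### Quasi-morphisms as Frobenius-compatible maps of generic fibres -/

section Generic

variable {k L : Type u} [Field k] [Fintype k] [Field L] [Algebra k L] {B : Base k L}

open TauData

/-- The map `[f] ↦ f_{0,η}`. -/
def toGenHom (F F' : AbelianTauSheaf B) :
    QHom F.toTauData F'.toTauData →ₗ[B.Q] GenHom F.toTauData F'.toTauData where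
  toFun x := ⟨x.gen 0, by
    obtain ⟨⟨D, f⟩⟩ := x
    intro v w h
    exact (f.genFib_Pi 0 w).symm.trans ((congrArg _ h).trans (f.genFib_tau 0 v))⟩
  map_add' x y := Subtype.ext (QHom.gen_add x y 0)
  map_smul' a x := Subtype.ext (QHom.gen_smul a x 0)

/-- Compatibility with the `Π_i` recovers all components from the zeroth; the weights play no role
here. -/
theorem toGenHom_injective (F F' : AbelianTauSheaf B) : Function.Injective (toGenHom F F') := by
  rintro ⟨⟨D, f⟩⟩ ⟨⟨E, g⟩⟩ h
  have h0 : f.genFib 0 = g.genFib 0 := congrArg Subtype.val h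
  refine QHom.gen_injective (funext fun i => ?_)
  exact (genFib_eq_transport f i).trans
    ((congrArg (AbelianTauSheaf.transport · i) h0).trans (genFib_eq_transport g i).symm)

/-- Frobenius-compatibility gives regularity off a finite closed set, and equality of weights then
bounds the poles for all indices at once by one divisor `E`. -/
theorem toGenHom_surjective {F F' : AbelianTauSheaf B} (hw : F.weight = F'.weight) :
    Function.Surjective (toGenHom F F') := by
  rintro ⟨φ, hφ⟩
  obtain ⟨Z, hZ, hZ', hreg⟩ := AbelianTauSheaf.exists_regular hφ
  obtain ⟨E, hE⟩ := AbelianTauSheaf.exists_bounded (fun _ => hw) hZ hZ' hreg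
  have hloc : ∀ i (y : B.CL) (v : Stalk (F.obj i) y), LocTwist B.pr E (F'.obj i) y
      (AbelianTauSheaf.transport φ i (cosp (F.obj i) (generic_specializes y) v)) :=
    fun i y v => (locTwist_iff B.pr E _ y _).2 fun d hd =>
      AbelianTauSheaf.smul_transport_mem_iff.2 (hE i y d hd) _ (cosp_mem_lat _ v)
  refine ⟨QHom.mk (Hom.ofGen (fun i => ofGen B.pr (AbelianTauSheaf.transport φ i) (hloc i)) _
    (fun i => gen_ofGen _ _ _) (AbelianTauSheaf.transport_Pi φ)
    (AbelianTauSheaf.transport_semi hφ)), Subtype.ext ?_⟩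
  exact gen_ofGen B.pr _ (hloc 0)

/-- The isomorphism `[f] ↦ f_{0,η}` for abelian `τ`-sheaves of the same weight. -/
def genHomEquiv (F F' : AbelianTauSheaf B) (hw : F.weight = F'.weight) :
    QHom F.toTauData F'.toTauData ≃ₗ[B.Q] GenHom F.toTauData F'.toTauData :=
  LinearEquiv.ofBijective (toGenHom F F') ⟨toGenHom_injective F F', toGenHom_surjective hw⟩

end Generic
end
end TauSheaf

/-! ### The three assertions assembled -/

theorem mainTheorem8 {k L : Type u} [Field k] [Fintype k] [Field L] [Algebra k L]
    (B : TauSheaf.Base k L) :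
    -- duals and inverses of quasi-isogenies
    (∀ (F F' : TauSheaf.AbelianTauSheaf B) (D : TauSheaf.EffDiv B.C)
        (f : TauSheaf.TauData.Hom F.toTauData (F'.toTauData.twist D)), f.IsIsogeny →
      (∃ a : B.Q, a ≠ 0 ∧ TauSheaf.Annihilates a f) ∧
      ∀ a : B.Q, a ≠ 0 → TauSheaf.Annihilates a f →
        (∃! g, TauSheaf.IsDual a f g) ∧
        ∀ g, TauSheaf.IsDual a f g →
          g.IsIsogeny ∧
          TauSheaf.dualClass g ∈ TauSheaf.QHom.QIsog F'.toTauData F.toTauData ∧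
          (a⁻¹ • TauSheaf.dualClass g).comp (TauSheaf.QHom.mk f) =
            TauSheaf.QHom.id F.toTauData ∧
          (TauSheaf.QHom.mk f).comp (a⁻¹ • TauSheaf.dualClass g) =
            TauSheaf.QHom.id F'.toTauData) ∧
    -- quasi-isogenies are the units of the endomorphism algebra
    (∀ F : TauSheaf.AbelianTauSheaf B,
      TauSheaf.QHom.QIsog F.toTauData F.toTauData =
        {x : TauSheaf.QEnd F.toTauData | IsUnit x}) ∧
    -- description by maps between generic fibres
    (∀ F : TauSheaf.AbelianTauSheaf B,
      Function.Bijective (TauSheaf.stalkHom (F.Pi 0) (genericPoint B.CL))) ∧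
    ∃ e : ∀ F F' : TauSheaf.AbelianTauSheaf B, F.weight = F'.weight →
        (TauSheaf.QHom F.toTauData F'.toTauData ≃ₗ[B.Q]
          TauSheaf.GenHom F.toTauData F'.toTauData),
      (∀ (F F' : TauSheaf.AbelianTauSheaf B) (h : F.weight = F'.weight)
          (D : TauSheaf.EffDiv B.C)
          (f : TauSheaf.TauData.Hom F.toTauData (F'.toTauData.twist D)),
        (e F F' h (TauSheaf.QHom.mk f)).1 = f.genFib 0) ∧
      ∀ (F F' F'' : TauSheaf.AbelianTauSheaf B) (h : F.weight = F'.weight)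
          (h' : F'.weight = F''.weight)
          (x : TauSheaf.QHom F.toTauData F'.toTauData)
          (y : TauSheaf.QHom F'.toTauData F''.toTauData),
        (e F F'' (h.trans h') (y.comp x)).1 = (e F' F'' h' y).1 ∘ₗ (e F F' h x).1 := by
  refine ⟨fun F F' D f hf => ⟨TauSheaf.exists_annihilates hf, fun a ha0 ha =>
      ⟨TauSheaf.existsUnique_isDual hf ha, fun g hg => ⟨hg.isIsogeny hf ha0,
        hg.dualClass_mem hf ha0, hg.inv_smul_comp ha0, hg.comp_inv_smul hf ha0⟩⟩⟩,
    TauSheaf.qIsog_eq_units, fun F => F.Pi_bijective 0, TauSheaf.genHomEquiv,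
    fun F F' h D f => rfl, fun F F' F'' h h' x y => ?_⟩
  exact TauSheaf.QHom.gen_comp y x 0
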